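/- Let $\mathbb{T}=\mathbb{R}\cup\{-\infty\}$ be the max-plus semiring ($x\oplus y=\max(x,y)$, $x\odot y=x+y$), and let $\mathbb{S}$ be the set of signed tropical numbers: $-\infty$, the positive elements $a$ and the negative elements $\ominus a$ ($a\in\mathbb{R}$). For $x \in \mathbb{S}$, denote by $|x|\in\mathbb{T}$ its modulus and by $x^+,x^-\in\mathbb{T}$ its positive and negative parts. A matrix over $\mathbb{S}$ is *strongly non-degenerate* if, for each of its $p\times p$ submatrices $M$, the maximum $\max_{\sigma\in S_p}\sum_i|M_{i\sigma(i)}|$ is not $-\infty$ and is attained by only one permutation. Let $\mathbb{K}$ be the ordered field of real generalized Puiseux series in $t$ (real exponents forming a decreasing sequence, finite or unbounded; the sign of a series is the sign of its leading coefficient), and let $\mathrm{sval}:\mathbb{K}\to\mathbb{S}$ map a series to its largest exponent, carrying the sign of the series ($\mathrm{sval}(0)=-\infty$); it is applied entrywise to matrices. *The algorithm $\mathrm{PCBC}(\mathbf{A},\mathbf{b})$* ($\mathbf{A}\in\mathbb{K}^{m\times n}$, $\mathbf{b}\in\mathbb{K}^m$, $\boldsymbol\epsilon\in\mathbb{K}$).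 Let $\mathbf{P}^{(k)}=\{\mathbf{x}\in\mathbb{K}^n:\mathbf{x}\ge 0,\ \mathbf{A}_i\mathbf{x}+\mathbf{b}_i\ge 0\ (i\le k)\}$. A basis is a set $B=I\uplus J$ of $n$ constraints ($I\subset[m]$, $J\subset[n]$ the indices of the constraints of the form $\mathbf{A}_i\mathbf{x}+\mathbf{b}_i\ge 0$ and $\mathbf{x}_j\ge 0$ respectively); the associated basic point is the point where they are all active. Set $\mathbf{u}=(\boldsymbol\epsilon,\boldsymbol\epsilon^2,\dots,\boldsymbol\epsilon^n)^\top$ and start from the basic point $\bar{\mathbf{x}}=0$ of basis $(\emptyset,[n])$. For $k=1,\dots,m$: if $\mathbf{A}_k\bar{\mathbf{x}}+\mathbf{b}_k\ge0$, keep $\bar{\mathbf{x}}$. Otherwise, starting from $\bar{\mathbf{x}}$, apply the simplex method over $\mathbf{P}^{(k-1)}$ with the following shadow-vertex rule. At the current basis $B$, let $\mathbf{y},\mathbf{z}\in\mathbb{K}^{B}$ be the reduced cost vectors of $\mathbf{u}$ and of $\mathbf{v}=\mathbf{A}_k^\top$, i.e. the solutions of $(\mathbf{A}'_{B})^\top\mathbf{y}=\mathbf{u}$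 and $(\mathbf{A}'_{B})^\top\mathbf{z}=\mathbf{v}$, where $\mathbf{A}'$ consists of the rows of the identity matrix and of $\mathbf{A}$. If no $l\in B$ satisfies $\mathbf{y}_l>0$ and $\mathbf{z}_l>0$, return "Empty". Otherwise let $k_{\mathrm{out}}$ minimize $\mathbf{y}_l/\mathbf{z}_l$ among these $l$. If the edge of the points of $\mathbf{P}^{(k-1)}$ activating $B\setminus\{k_{\mathrm{out}}\}$ contains a point $\bar{\mathbf{x}}'$ with $\mathbf{A}_k\bar{\mathbf{x}}'+\mathbf{b}_k=0$, set $\bar{\mathbf{x}}\leftarrow\bar{\mathbf{x}}'$, of basis $B\setminus\{k_{\mathrm{out}}\}\cup\{k\}$, and go on with $k+1$. Otherwise pivot to the basic point of $\mathbf{P}^{(k-1)}$ of basis $B\setminus\{k_{\mathrm{out}}\}\cup\{k_{\mathrm{in}}\}$ with $k_{\mathrm{in}}\notin B$. If all $k\le m$ have been processed, return "Non-empty". The number of visited basic points counts the initial point, and then every point reached by a pivot or found as $\bar{\mathbf{x}}'$. *The algorithm $\mathrm{TropPCBC}(A,b)$* ($A\in\mathbb{S}^{m\times n}$, $b\in\mathbb{S}^m$,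 $\epsilon\in\mathbb{R}$) is the same procedure over $\mathbb{T}^n$, in which the constraints are $A_i^+\odot x\oplus b_i^+\ge A_i^-\odot x\oplus b_i^-$ and $x_j\ge-\infty$, active when the two sides are equal; the starting point is $(-\infty,\dots,-\infty)$; $u=(\epsilon,\epsilon^{\odot2},\dots,\epsilon^{\odot n})^\top$ (positive entries); and the pivoting rule is the tropical shadow-vertex rule, defined as follows. For a set $K$ of rows and a set $L$ of columns with $|K|=|L|$, let $P_{K\times L}$ be the $(K\times L)$-minor, as a polynomial in formal variables, of a matrix with $m+2$ rows and $n$ columns. For $l\in B=I\uplus J$, with $J^c=[n]\setminus J$, let $Q_l=P_{(I\setminus\{l\}\cup\{m+1\})\times J^c}$ if $l\in I$, and $Q_l=P_{(I\cup\{m+1\})\times(J^c\cup\{l\})}$ if $l\in J$; let $R_l$ be defined in the same way with $m+2$ in place of $m+1$; let $T_{kl}=Q_kR_l-Q_lR_k$. Let $s_l\in\{\pm1\}$ be $(-1)^{|I|-p}$ if $l$ is the $p$-th element of $I$, and $(-1)^{|I|+1-p}$ if $l\in J$ is the $p$-th element of $J^c\cup\{l\}$ (so that the reduced costs are $s_lQ_l/P_{I\times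 J^c}$ and $s_lR_l/P_{I\times J^c}$). The tropical value of a polynomial at signed tropical arguments is that of its only term of maximal modulus. Evaluate tropically at the matrix with rows $A$, $u^\top$, $A_k$, and let $\Lambda$ be the set of the $l\in B$ such that both $Q_l$ and $R_l$ have the sign of $s_l$ times that of $P_{I\times J^c}$. The rule returns the element $k_{\mathrm{out}}\in\Lambda$ such that $T_{k_{\mathrm{out}}l}$ has sign $-s_{k_{\mathrm{out}}}s_l$ for all $l\in\Lambda\setminus\{k_{\mathrm{out}}\}$, and none if $\Lambda=\emptyset$. **Proposition.** Let $A\in\mathbb{S}^{m\times n}$ and $b\in\mathbb{S}^m$ be such that $(A\ b)$ is strongly non-degenerate, and let $\epsilon\in\mathbb{R}$ satisfy $\epsilon<n\,(\min_{ij}|A_{ij}|-\max_{ij}|A_{ij}|)$ (no condition if $A$ has no entry). Then $\mathrm{TropPCBC}(A,b)$ terminates, and it returns "Empty" if the tropical polyhedron $\{x\in\mathbb{T}^n:A^+\odot x\oplus b^+\ge A^-\odot x\oplus b^-\}$ is empty and "Non-empty" otherwise. Moreover, for all $\mathbf{A},\mathbf{b},\boldsymbol\epsilon$ over $\mathbb{K}$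 with $\mathrm{sval}(\mathbf{A})=A$, $\mathrm{sval}(\mathbf{b})=b$, $\mathrm{sval}(\boldsymbol\epsilon)=\epsilon$, the algorithm $\mathrm{PCBC}(\mathbf{A},\mathbf{b})$ also terminates, and the total numbers of basic points visited by $\mathrm{TropPCBC}(A,b)$ and by $\mathrm{PCBC}(\mathbf{A},\mathbf{b})$ are equal. -/

import Mathlib

/-! ### Generalized Puiseux series -/

/-- A Hahn series in `t` with real coefficients, whose support has only finitely many exponents
above any given real number: its exponents form a decreasing sequence that is finite or tends to
`-∞`. (Exponents live in `ℝᵒᵈ`, so the order of the series is its *largest* exponent.) -/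
def IsPuiseux (x : HahnSeries ℝᵒᵈ ℝ) : Prop :=
  ∀ c : ℝ, {α : ℝ | c ≤ α ∧ x.coeff (OrderDual.toDual α) ≠ 0}.Finite

theorem IsPuiseux.zero : IsPuiseux 0 := fun c => by simp

theorem IsPuiseux.single (v : ℝᵒᵈ) (a : ℝ) : IsPuiseux (HahnSeries.single v a) := fun c => by
  refine (Set.finite_singleton (OrderDual.ofDual v)).subset ?_
  rintro α ⟨-, h⟩
  by_contra hne
  exact h (HahnSeries.coeff_single_of_ne (fun h' => hne (by simp [← h'])))

theorem IsPuiseux.one : IsPuiseux 1 := IsPuiseux.single 0 1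

theorem IsPuiseux.neg {x : HahnSeries ℝᵒᵈ ℝ} (hx : IsPuiseux x) : IsPuiseux (-x) := fun c => by
  simpa using hx c

theorem IsPuiseux.add {x y : HahnSeries ℝᵒᵈ ℝ} (hx : IsPuiseux x) (hy : IsPuiseux y) :
    IsPuiseux (x + y) := fun c => by
  refine ((hx c).union (hy c)).subset ?_
  rintro α ⟨hc, h⟩
  by_contra hne
  simp only [Set.mem_union, Set.mem_ofPred_eq, not_or, not_and, not_not] at hne
  exact h (by simp [hne.1 hc, hne.2 hc])

theorem IsPuiseux.mul {x y : HahnSeries ℝᵒᵈ ℝ} (hx : IsPuiseux x) (hy : IsPuiseux y) :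
    IsPuiseux (x * y) := fun c => by
  refine (((hx (c - OrderDual.ofDual y.order)).prod (hy (c - OrderDual.ofDual x.order))).image
    (fun p => p.1 + p.2)).subset ?_
  rintro α ⟨hc, h⟩
  obtain ⟨i, hi, j, hj, hij⟩ := HahnSeries.support_mul_subset ((HahnSeries.mem_support _ _).2 h)
  have hi' : OrderDual.ofDual i ≤ OrderDual.ofDual x.order :=
    HahnSeries.order_le_of_coeff_ne_zero hi
  have hj' : OrderDual.ofDual j ≤ OrderDual.ofDual y.order :=
    HahnSeries.order_le_of_coeff_ne_zero hj
  have hs : OrderDual.ofDual i + OrderDual.ofDual j = α := congrArg OrderDual.ofDual hij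
  refine ⟨(OrderDual.ofDual i, OrderDual.ofDual j), ⟨⟨?_, hi⟩, ⟨?_, hj⟩⟩, hs⟩
  · simp only; linarith
  · simp only; linarith

theorem IsPuiseux.pow {x : HahnSeries ℝᵒᵈ ℝ} (hx : IsPuiseux x) (k : ℕ) : IsPuiseux (x ^ k) := by
  induction k with
  | zero => simpa using IsPuiseux.one
  | succ k ih => rw [pow_succ]; exact ih.mul hx

theorem IsPuiseux.sum_pow {x : HahnSeries ℝᵒᵈ ℝ} (hx : IsPuiseux x) (k : ℕ) :
    IsPuiseux (∑ i ∈ Finset.range k, x ^ i) := by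
  induction k with
  | zero => simpa using IsPuiseux.zero
  | succ k ih => rw [Finset.sum_range_succ]; exact ih.add (hx.pow k)

theorem IsPuiseux.inv_one_sub {e : HahnSeries ℝᵒᵈ ℝ} (he : IsPuiseux e)
    (hlt : e ≠ 0 → OrderDual.ofDual e.order < 0) (h1 : 1 - e ≠ 0) : IsPuiseux (1 - e)⁻¹ := by
  rcases eq_or_ne e 0 with rfl | h0
  · simpa using IsPuiseux.one
  intro c
  set w := (1 - e)⁻¹ with hw
  have hw0 : w ≠ 0 := inv_ne_zero h1
  set δ := - OrderDual.ofDual e.order with hδ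
  have hδ0 : 0 < δ := by have := hlt h0; linarith
  obtain ⟨k, hk⟩ := exists_nat_gt ((OrderDual.ofDual w.order - c) / δ)
  rw [div_lt_iff₀ hδ0] at hk
  have hgeom : w = ∑ i ∈ Finset.range k, e ^ i + e ^ k * w := by
    have h2 : (∑ i ∈ Finset.range k, e ^ i) * (1 - e) = 1 - e ^ k := geom_sum_mul_neg e k
    have h3 : (1 - e) * w = 1 := mul_inv_cancel₀ h1
    calc w = (1 - e ^ k) * w + e ^ k * w := by ring
      _ = (∑ i ∈ Finset.range k, e ^ i) * ((1 - e) * w) + e ^ k * w := by rw [← h2]; ring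
      _ = _ := by rw [h3, mul_one]
  refine (he.sum_pow k c).subset ?_
  rintro α ⟨hc, h⟩
  refine ⟨hc, fun hz => ?_⟩
  rw [hgeom, HahnSeries.coeff_add, hz, zero_add] at h
  have h4 : α ≤ OrderDual.ofDual (e ^ k * w).order := HahnSeries.order_le_of_coeff_ne_zero h
  rw [HahnSeries.order_mul (pow_ne_zero _ h0) hw0, HahnSeries.order_pow] at h4
  have h5 : OrderDual.ofDual (k • e.order + w.order)
      = (k : ℝ) * OrderDual.ofDual e.order + OrderDual.ofDual w.order := by
    simp [nsmul_eq_mul]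
  rw [h5] at h4
  nlinarith

theorem IsPuiseux.inv {x : HahnSeries ℝᵒᵈ ℝ} (hx : IsPuiseux x) : IsPuiseux x⁻¹ := by
  rcases eq_or_ne x 0 with rfl | h0
  · simpa using IsPuiseux.zero
  set s := HahnSeries.single x.order x.leadingCoeff with hs
  have hl : x.leadingCoeff ≠ 0 := HahnSeries.leadingCoeff_ne_zero.2 h0
  have hs0 : s ≠ 0 := by simpa [hs] using hl
  have hsi : s⁻¹ = HahnSeries.single (-x.order) x.leadingCoeff⁻¹ := HahnSeries.inv_single _ _
  have hsp : IsPuiseux s⁻¹ := hsi ▸ IsPuiseux.single _ _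
  set e := 1 - s⁻¹ * x with he
  have hx' : s * (1 - e) = x := by rw [he, sub_sub_cancel, mul_inv_cancel_left₀ hs0]
  have h1 : 1 - e ≠ 0 := by intro h; rw [h, mul_zero] at hx'; exact h0 hx'.symm
  have hep : IsPuiseux e := by
    rw [he, sub_eq_add_neg]; exact IsPuiseux.one.add (hsp.mul hx).neg
  rw [← hx', mul_inv]
  refine hsp.mul (hep.inv_one_sub (fun hne => ?_) h1)
  have hse : s * e = s - x := by rw [← hx']; ring
  have hd : s * e ≠ 0 := mul_ne_zero hs0 hne
  have ho : (s * e).order = x.order + e.order := by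
    rw [HahnSeries.order_mul hs0 hne, hs, HahnSeries.order_single hl]
  have hgt : x.order < (s * e).order := by
    by_contra hle
    rw [not_lt] at hle
    have hc : (s * e).coeff (s * e).order ≠ 0 := fun h => hd (HahnSeries.coeff_order_eq_zero.1 h)
    rw [hse] at hc hle
    rcases hle.lt_or_eq with hlt | heq
    · apply hc
      rw [HahnSeries.coeff_sub, HahnSeries.coeff_eq_zero_of_lt_order hlt, hs,
        HahnSeries.coeff_single_of_ne hlt.ne, sub_zero]
    · apply hc
      rw [heq, HahnSeries.coeff_sub, hs, HahnSeries.coeff_single_same, HahnSeries.leadingCoeff_eq,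
        sub_self]
  rw [ho] at hgt
  have : OrderDual.ofDual (x.order + e.order) < OrderDual.ofDual x.order := hgt
  have h6 : OrderDual.ofDual (x.order + e.order)
      = OrderDual.ofDual x.order + OrderDual.ofDual e.order := rfl
  linarith

/-- The generalized Puiseux series form a subfield of the field of Hahn series, ordered by the sign
of the leading coefficient (the lexicographic order). -/
def puiseuxSubfield : Subfield (Lex (HahnSeries ℝᵒᵈ ℝ)) where
  carrier := {x | IsPuiseux (ofLex x)}
  mul_mem' := fun hx hy => IsPuiseux.mul hx hy
  one_mem' := IsPuiseux.one
  add_mem' := fun hx hy => IsPuiseux.add hx hy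
  zero_mem' := IsPuiseux.zero
  neg_mem' := fun hx => IsPuiseux.neg hx
  inv_mem' := fun _ hx => IsPuiseux.inv hx

/-- The ordered field `𝕂` of real generalized Puiseux series. -/
abbrev PuiseuxSeries : Type := puiseuxSubfield

/-! ### Tropical numbers and signed tropical numbers

The max-plus semiring is `WithBot ℝ`: tropical addition is `⊔`, tropical multiplication is `+`,
the tropical zero is `⊥ = -∞` and the tropical unit is `0`. -/

/-- Signed tropical numbers: `-∞`, the positive elements `a`, the negative elements `⊖ a`. -/
inductive SignedTrop : Type where
  | zero : SignedTrop
  | pos (a : ℝ) : SignedTrop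
  | neg (a : ℝ) : SignedTrop

namespace SignedTrop

/-- The modulus `|x|`. -/
def modulus : SignedTrop → WithBot ℝ
  | zero => ⊥
  | pos a => a
  | neg a => a

/-- The sign of a signed tropical number. -/
def sgn : SignedTrop → SignType
  | zero => 0
  | pos _ => 1
  | neg _ => -1

/-- The positive part `x⁺`. -/
def posPart : SignedTrop → WithBot ℝ
  | pos a => a
  | _ => ⊥

/-- The negative part `x⁻`. -/
def negPart : SignedTrop → WithBot ℝ
  | neg a => a
  | _ => ⊥

/-- The tropical product: moduli add up, signs multiply. -/
protected noncomputable def mul : SignedTrop → SignedTrop → SignedTrop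
  | zero, _ => zero
  | _, zero => zero
  | pos a, pos c => pos (a + c)
  | pos a, neg c => neg (a + c)
  | neg a, pos c => neg (a + c)
  | neg a, neg c => pos (a + c)

noncomputable instance : CommMonoid SignedTrop where
  mul := SignedTrop.mul
  one := pos 0
  mul_assoc x y z := by
    change SignedTrop.mul (SignedTrop.mul x y) z = SignedTrop.mul x (SignedTrop.mul y z)
    cases x <;> cases y <;> cases z <;> simp [SignedTrop.mul, add_assoc]
  one_mul x := by
    change SignedTrop.mul (pos 0) x = x
    cases x <;> simp [SignedTrop.mul]
  mul_one x := by
    change SignedTrop.mul x (pos 0) = x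
    cases x <;> simp [SignedTrop.mul]
  mul_comm x y := by
    change SignedTrop.mul x y = SignedTrop.mul y x
    cases x <;> cases y <;> simp [SignedTrop.mul, add_comm]

end SignedTrop

open Classical in
/-- The signed valuation of a Puiseux series: its largest exponent, with the sign of the series. -/
noncomputable def sval (x : PuiseuxSeries) : SignedTrop :=
  if x = 0 then SignedTrop.zero
  else if 0 < x then SignedTrop.pos (OrderDual.ofDual (ofLex x.1).order)
  else SignedTrop.neg (OrderDual.ofDual (ofLex x.1).order)

/-- The modulus of the term of the tropical permanent of `M` associated with `σ`. -/
noncomputable def permWeight {p : ℕ} (M : Matrix (Fin p) (Fin p) SignedTrop)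
    (σ : Equiv.Perm (Fin p)) : WithBot ℝ :=
  ∑ i, (M i (σ i)).modulus

/-- The maximum of the weights of permutations is not `-∞` and is attained only once. -/
def IsGeneric {p : ℕ} (M : Matrix (Fin p) (Fin p) SignedTrop) : Prop :=
  ∃ σ, permWeight M σ ≠ ⊥ ∧ ∀ τ, τ ≠ σ → permWeight M τ < permWeight M σ

/-- All square submatrices are generic. -/
def StronglyNondegenerate {ι κ : Type*} (M : Matrix ι κ SignedTrop) : Prop :=
  ∀ (p : ℕ) (f : Fin p ↪ ι) (g : Fin p ↪ κ), IsGeneric (M.submatrix f g)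

/-- The left-hand side `(A⁺ ⊙ x ⊕ b⁺)ᵢ`. -/
noncomputable def tropLHS {m n : ℕ} (A : Matrix (Fin m) (Fin n) SignedTrop)
    (b : Fin m → SignedTrop) (i : Fin m) (x : Fin n → WithBot ℝ) : WithBot ℝ :=
  (Finset.univ.sup fun j => (A i j).posPart + x j) ⊔ (b i).posPart

/-- The right-hand side `(A⁻ ⊙ x ⊕ b⁻)ᵢ`. -/
noncomputable def tropRHS {m n : ℕ} (A : Matrix (Fin m) (Fin n) SignedTrop)
    (b : Fin m → SignedTrop) (i : Fin m) (x : Fin n → WithBot ℝ) : WithBot ℝ :=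
  (Finset.univ.sup fun j => (A i j).negPart + x j) ⊔ (b i).negPart

/-- The tropical polyhedron `{x : A⁺ ⊙ x ⊕ b⁺ ≥ A⁻ ⊙ x ⊕ b⁻}`. -/
def tropPolyhedron {m n : ℕ} (A : Matrix (Fin m) (Fin n) SignedTrop)
    (b : Fin m → SignedTrop) : Set (Fin n → WithBot ℝ) :=
  {x | ∀ i, tropRHS A b i x ≤ tropLHS A b i x}

/-! ### The constraint-by-constraint algorithm

The classical and the tropical procedures have the same control flow; they differ in the points
they handle, in the meaning of the constraints, and in the pivoting rule. The constraint `inl i`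
is the `i`-th inequality of the system, and `inr j` is the `j`-th nonnegativity constraint.
A basis `(I, J)` is handled as the disjoint union `I ⊎ J`, a finite set of constraints. -/

/-- The data on which the constraint-by-constraint procedure runs. -/
structure PCBCData (m n : ℕ) (X : Type) where
  /-- the point satisfies the constraint -/
  sat : Fin m ⊕ Fin n → X → Prop
  /-- the point satisfies the constraint with equality -/
  active : Fin m ⊕ Fin n → X → Prop
  /-- the graph of the pivoting rule used in the `k`-th iteration: at a given basis, it returns
  a leaving variable or the special value `none` -/
  rule : Fin m → Finset (Fin m ⊕ Fin n) → Option (Fin m ⊕ Fin n) → Prop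
  /-- the initial point -/
  origin : X

/-- The answer of the procedure. -/
inductive Answer : Type where
  | empty : Answer
  | nonempty : Answer

/-- The state of the procedure. Each state holds the number `N` of basic points visited so far. -/
inductive Config (m n : ℕ) (X : Type) : Type where
  /-- the first `k` inequalities have been processed, the current basic point is `x`,
  associated with the basis `B` -/
  | loop (k : ℕ) (B : Finset (Fin m ⊕ Fin n)) (x : X) (N : ℕ) : Config m n X
  /-- the simplex method is run because of the violation of the inequality of index `k`,
  and is located at the basic point `x`, associated with the basis `B` -/
  | simplex (k : Fin m) (B : Finset (Fin m ⊕ Fin n)) (x : X) (N : ℕ) : Config m n X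
  /-- the procedure has returned -/
  | halt (ans : Answer) (N : ℕ) : Config m n X

namespace PCBCData

variable {m n : ℕ} {X : Type}

/-- The constraint is one of the `n` nonnegativity constraints or of the first `k` inequalities. -/
def Among (k : ℕ) : Fin m ⊕ Fin n → Prop
  | Sum.inl i => i.val < k
  | Sum.inr _ => True

/-- The polyhedron defined by the nonnegativity constraints and the first `k` inequalities. -/
def polyhedron (S : PCBCData m n X) (k : ℕ) : Set X :=
  {x | ∀ l, Among k l → S.sat l x}

/-- The points of the previous polyhedron that activate all the constraints in `F`. If `F` is a
basis, this is the set reduced to the basic point of basis `F` (if the latter is feasible), and if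
`F` is a basis without its leaving variable, this is an edge. -/
def face (S : PCBCData m n X) (k : ℕ) (F : Finset (Fin m ⊕ Fin n)) : Set X :=
  {x ∈ S.polyhedron k | ∀ l ∈ F, S.active l x}

/-- One step of the procedure. Inequalities are indexed from `0`, so that the iteration dealing
with the inequality of index `k` pivots over the polyhedron defined by the first `k` ones. -/
inductive Step (S : PCBCData m n X) : Config m n X → Config m n X → Prop where
  /-- all the inequalities have been processed -/
  | finish (k : ℕ) (hk : k = m) (B : Finset (Fin m ⊕ Fin n)) (x : X) (N : ℕ) :
      Step S (.loop k B x N) (.halt .nonempty N)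
  /-- the current point satisfies the next inequality -/
  | keep (k : ℕ) (hk : k < m) (B : Finset (Fin m ⊕ Fin n)) (x : X) (N : ℕ)
      (h : S.sat (Sum.inl ⟨k, hk⟩) x) :
      Step S (.loop k B x N) (.loop (k + 1) B x N)
  /-- the current point violates the next inequality -/
  | enter (k : ℕ) (hk : k < m) (B : Finset (Fin m ⊕ Fin n)) (x : X) (N : ℕ)
      (h : ¬ S.sat (Sum.inl ⟨k, hk⟩) x) :
      Step S (.loop k B x N) (.simplex ⟨k, hk⟩ B x N)
  /-- the pivoting rule returns `none` -/
  | infeasible (k : Fin m) (B : Finset (Fin m ⊕ Fin n)) (x : X) (N : ℕ) (h : S.rule k B none) :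
      Step S (.simplex k B x N) (.halt .empty N)
  /-- a point activating the inequality of index `k` is found on the edge -/
  | hit (k : Fin m) (B : Finset (Fin m ⊕ Fin n)) (x : X) (N : ℕ)
      (kout : Fin m ⊕ Fin n) (h : S.rule k B (some kout))
      (y : X) (hy : y ∈ S.face k (B.erase kout)) (hk : S.active (Sum.inl k) y) :
      Step S (.simplex k B x N) (.loop (k + 1) (insert (Sum.inl k) (B.erase kout)) y (N + 1))
  /-- there is no such point, and the method pivots to the next basic point -/
  | pivot (k : Fin m) (B : Finset (Fin m ⊕ Fin n)) (x : X) (N : ℕ)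
      (kout : Fin m ⊕ Fin n) (h : S.rule k B (some kout))
      (hno : ¬ ∃ y ∈ S.face k (B.erase kout), S.active (Sum.inl k) y)
      (kin : Fin m ⊕ Fin n) (hkin : Among k kin) (hB : kin ∉ B)
      (y : X) (hy : y ∈ S.face k (insert kin (B.erase kout))) :
      Step S (.simplex k B x N) (.simplex k (insert kin (B.erase kout)) y (N + 1))

/-- The initial state: the basis is `(∅, [n])`, and the initial point is the first visited one. -/
def start (S : PCBCData m n X) : Config m n X :=
  .loop 0 (Finset.univ.map Function.Embedding.inr) S.origin 1

/-- The procedure terminates (there is no infinite execution), and all its executions end by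
returning `ans`, after having visited `N` basic points in total. -/
def Outputs (S : PCBCData m n X) (ans : Answer) (N : ℕ) : Prop :=
  Acc (fun c d => S.Step d c) S.start ∧
    ∀ c, Relation.ReflTransGen S.Step S.start c → (∀ d, ¬ S.Step c d) → c = .halt ans N

end PCBCData

/-! ### The classical procedure -/

section Classical

variable {F : Type} [Field F] {m n : ℕ}

/-- The vector `y`, supported by `B`, is the reduced cost vector of the basis `B = I ⊎ J` w.r.t.
the cost vector `u`: `(A'_{I ⊎ J})ᵀ y = u`, where `A'` consists of the identity matrix and `A`. -/
def IsReducedCost (A : Matrix (Fin m) (Fin n) F) (u : Fin n → F) (B : Finset (Fin m ⊕ Fin n))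
    (y : Fin m ⊕ Fin n → F) : Prop :=
  (∀ l ∉ B, y l = 0) ∧ ∀ j, ∑ l ∈ B, Sum.elim A (1 : Matrix (Fin n) (Fin n) F) l j * y l = u j

/-- The shadow-vertex pivoting rule `ρ_sv(A, u, v)` at basis `B = I ⊎ J`. It depends on `A` only
through the rows in `I`. -/
def shadowVertexRule [LinearOrder F] (A : Matrix (Fin m) (Fin n) F) (u v : Fin n → F)
    (B : Finset (Fin m ⊕ Fin n)) (out : Option (Fin m ⊕ Fin n)) : Prop :=
  ∃ y z, IsReducedCost A u B y ∧ IsReducedCost A v B z ∧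
    match out with
    | none => ∀ l ∈ B, ¬ (0 < y l ∧ 0 < z l)
    | some k => (k ∈ B ∧ 0 < y k ∧ 0 < z k) ∧
        ∀ l ∈ B, 0 < y l → 0 < z l → y k / z k ≤ y l / z l

/-- The procedure `PCBC(A, b)`, with objective vector `(ε, ε², …, εⁿ)`. -/
def classicalPCBC [LinearOrder F] (A : Matrix (Fin m) (Fin n) F) (b : Fin m → F) (ε : F) :
    PCBCData m n (Fin n → F) where
  sat := Sum.elim (fun i x => 0 ≤ A i ⬝ᵥ x + b i) (fun j x => 0 ≤ x j)
  active := Sum.elim (fun i x => A i ⬝ᵥ x + b i = 0) (fun j x => x j = 0)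
  rule k := shadowVertexRule A (fun j => ε ^ (j.val + 1)) (A k)
  origin := fun _ => 0

end Classical

/-! ### Tropical polynomials and the tropical shadow-vertex rule -/

section Tropical

/-- The modulus `|c_α| ⊙ |x|^α` of the monomial of `tropPol(P)` of exponent `α` at `x`. -/
noncomputable def termModulus {ι : Type} (P : MvPolynomial ι PuiseuxSeries) (x : ι → SignedTrop)
    (α : ι →₀ ℕ) : WithBot ℝ :=
  (sval (P.coeff α)).modulus + α.sum fun i e => e • (x i).modulus

/-- The exponent `α` is the only one at which the maximum of the moduli of the monomials of
`tropPol(P)` at `x` is attained, and this maximum is not `-∞`. -/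
def IsDominant {ι : Type} (P : MvPolynomial ι PuiseuxSeries) (x : ι → SignedTrop)
    (α : ι →₀ ℕ) : Prop :=
  α ∈ P.support ∧ termModulus P x α ≠ ⊥ ∧
    ∀ β ∈ P.support, β ≠ α → termModulus P x β < termModulus P x α

open Classical in
/-- The value of `tropPol(P)` at `x` when `tropPol(P)` does not vanish on `x`, i.e. when there is a
dominant exponent (and `-∞` otherwise). -/
noncomputable def tropEval {ι : Type} (P : MvPolynomial ι PuiseuxSeries) (x : ι → SignedTrop) :
    SignedTrop :=
  if h : ∃ α, IsDominant P x α then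
    sval (P.coeff h.choose) * h.choose.prod fun i e => x i ^ e
  else SignedTrop.zero

/-- The `(K × L)`-minor of the matrix of formal variables, as a polynomial. -/
noncomputable def minorPoly {p q : ℕ} (K : Finset (Fin p)) (L : Finset (Fin q)) :
    MvPolynomial (Fin p × Fin q) PuiseuxSeries :=
  if h : K.card = L.card then
    (Matrix.of fun i j : Fin L.card => (MvPolynomial.X (K.orderEmbOfFin h i, L.orderEmbOfFin rfl j) :
      MvPolynomial (Fin p × Fin q) PuiseuxSeries)).det
  else 0

variable {m n : ℕ}

/-- The rows in `I`, as rows of a matrix with two additional rows at the bottom. -/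
def liftRows (I : Finset (Fin m)) : Finset (Fin (m + 2)) :=
  I.map (Fin.castAddEmb 2)

/-- The minor `P_{I × Jᶜ}`. -/
noncomputable def basisPoly (B : Finset (Fin m ⊕ Fin n)) :
    MvPolynomial (Fin (m + 2) × Fin n) PuiseuxSeries :=
  minorPoly (liftRows B.toLeft) B.toRightᶜ

/-- The polynomials `Q_l` (when `r` is the first additional row) and `R_l` (when `r` is the
second one). -/
noncomputable def costPoly (B : Finset (Fin m ⊕ Fin n)) (r : Fin 2) :
    Fin m ⊕ Fin n → MvPolynomial (Fin (m + 2) × Fin n) PuiseuxSeries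
  | Sum.inl i => minorPoly (insert (Fin.natAdd m r) (liftRows (B.toLeft.erase i))) B.toRightᶜ
  | Sum.inr j => minorPoly (insert (Fin.natAdd m r) (liftRows B.toLeft)) (insert j B.toRightᶜ)

/-- The polynomial `T_{kl} = Q_k R_l - Q_l R_k`. -/
noncomputable def ratioPoly (B : Finset (Fin m ⊕ Fin n)) (k l : Fin m ⊕ Fin n) :
    MvPolynomial (Fin (m + 2) × Fin n) PuiseuxSeries :=
  costPoly B 0 k * costPoly B 1 l - costPoly B 0 l * costPoly B 1 k

/-- The sign `s_l` such that the reduced costs are `y_l = s_l Q_l / P_{I × Jᶜ}` and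
`z_l = s_l R_l / P_{I × Jᶜ}`. It is given by the position of `l` in `I` if `l ∈ I`, and in
`Jᶜ ∪ {l}` if `l ∈ J`. -/
def costSign (B : Finset (Fin m ⊕ Fin n)) : Fin m ⊕ Fin n → SignType
  | Sum.inl i => (-1) ^ (B.toLeft.card + (B.toLeft.filter (· ≤ i)).card)
  | Sum.inr j => (-1) ^ (B.toLeft.card + 1 + ((insert j B.toRightᶜ).filter (· ≤ j)).card)

/-- The matrix with rows `A`, `u`, `v`, as a family of values for the formal variables. -/
def stack (A : Matrix (Fin m) (Fin n) SignedTrop) (u v : Fin n → SignedTrop) :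
    Fin (m + 2) × Fin n → SignedTrop :=
  fun e => Fin.append A ![u, v] e.1 e.2

/-- The set `Λ` of the elements of the basis with positive tropical reduced costs. -/
def tropCandidates (A : Matrix (Fin m) (Fin n) SignedTrop) (u v : Fin n → SignedTrop)
    (B : Finset (Fin m ⊕ Fin n)) : Set (Fin m ⊕ Fin n) :=
  {l | l ∈ B ∧ ∀ r : Fin 2, (tropEval (costPoly B r l) (stack A u v)).sgn =
    costSign B l * (tropEval (basisPoly B) (stack A u v)).sgn}

/-- The tropical shadow-vertex pivoting rule at basis `B = I ⊎ J`. It depends on `A` only through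
the rows in `I`. -/
def tropShadowVertexRule (A : Matrix (Fin m) (Fin n) SignedTrop) (u v : Fin n → SignedTrop)
    (B : Finset (Fin m ⊕ Fin n)) : Option (Fin m ⊕ Fin n) → Prop
  | none => ∀ l, l ∉ tropCandidates A u v B
  | some k => k ∈ tropCandidates A u v B ∧ ∀ l ∈ tropCandidates A u v B, l ≠ k →
      (tropEval (ratioPoly B k l) (stack A u v)).sgn = -(costSign B k * costSign B l)

/-- The procedure `TropPCBC(A, b)`, with objective vector `(ε, ε^{⊙2}, …, ε^{⊙n})`. -/
def tropPCBC (A : Matrix (Fin m) (Fin n) SignedTrop) (b : Fin m → SignedTrop) (ε : ℝ) :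
    PCBCData m n (Fin n → WithBot ℝ) where
  sat := Sum.elim (fun i x => tropRHS A b i x ≤ tropLHS A b i x) (fun j x => ⊥ ≤ x j)
  active := Sum.elim (fun i x => tropLHS A b i x = tropRHS A b i x) (fun j x => x j = ⊥)
  rule k := tropShadowVertexRule A (fun j => SignedTrop.pos ε ^ (j.val + 1)) (A k)
  origin := fun _ => ⊥

end Tropical

/-!
The tropical procedure is the image under the valuation of the classical procedure run on any lift
of the data, so that the two visit the same number of basic points. The classical procedure is
correct because it is a dual feasible parametric simplex method on nondegenerate data.

*Points.* The sum of nonnegative series has the maximum of their valuations for valuation, so that a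
classical equality or inequality between nonnegative points passes to valuations. Conversely
(`exists_lift`), every tropical point has a nonnegative lift that activates all the inequalities
that the point activates. After a rescaling, the terms reaching the maxima in the active tropical
inequalities have a real residue matrix `N`; strong nondegeneracy of `(A b)` forbids two transversals
in a square submatrix of `N`, hence no nontrivial combination of the rows of `N` is nonnegative
(`eq_zero_of_vecMul_nonneg`). By convex duality, `N` has independent rows and a positive vector in
its kernel (`exists_rightInverse_and_pos_ker`), which extends to a solution over the Puiseux series
(`exists_ker_lift`). As strict tropical inequalities hold at every nonnegative lift, the tropical
faces are the images of the classical ones. In particular, the two polyhedra are empty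
simultaneously, and a violated inequality is violated at both levels, since a basic point is the
only lift of its valuation that activates its basis.

*Pivots.* By Cramer's rule (`basisMinor_mul`), the reduced costs are signed quotients of minors, and
by a Plücker relation (`costMinor_sub_eq`), the polynomial `T_{kl}` comparing two ratios of reduced
costs is a product of two minors up to sign. Since `ε` is very negative, a permutation of maximal
weight matches the objective row with the first available column, so that all these minors have a
single dominant monomial (`exists_isDominant_stack`), and so do products of them
(`IsDominant.mul`). The value of a polynomial with a dominant monomial has the sign of its tropical
value; thus the two pivoting rules agree (`tropShadowVertexRule_iff`).

*The classical procedure.* The same nonvanishing minors show that the classical data are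
nondegenerate (`classicalNondegenerate_of_sval`). The run then keeps reduced costs of the objective
minus a nonnegative multiple of the violated inequality nonnegative (`Invariant`). When the rule
returns nothing, the current basic point maximizes the violated inequality, and the polyhedron is
empty; otherwise each pivot strictly increases the violated inequality, so that no basis is
visited twice and the procedure terminates.

The procedures have the same steps at corresponding states (`step_map_valVec`,
`exists_step_of_step_map_valVec`), and hence the same number of visited points. As every signed
tropical number has a lift (`exists_sval_eq`), and the outcome of the tropical procedure is unique,
this number does not depend on the lift.
-/

open scoped Matrix

/-! ### The signed valuation -/

/-- The sign of a signed valuation is the sign of the series. -/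
theorem sval_sgn (x : PuiseuxSeries) : (sval x).sgn = SignType.sign x := by
  unfold sval
  split_ifs with h h'
  · subst h; simp [SignedTrop.sgn]
  · simp [SignedTrop.sgn, h']
  · simp [SignedTrop.sgn, sign_neg (lt_of_le_of_ne (not_lt.1 h') h)]

/-- The valuation of a Puiseux series: the modulus of its signed valuation. -/
noncomputable def val (x : PuiseuxSeries) : WithBot ℝ := (sval x).modulus

theorem val_zero : val 0 = ⊥ := by simp [val, sval, SignedTrop.modulus]

theorem val_of_ne {x : PuiseuxSeries} (h : x ≠ 0) :
    val x = ((OrderDual.ofDual (ofLex x.1).order : ℝ) : WithBot ℝ) := by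
  unfold val sval
  rw [if_neg h]
  split_ifs <;> simp [SignedTrop.modulus]

theorem val_eq_bot {x : PuiseuxSeries} : val x = ⊥ ↔ x = 0 := by
  refine ⟨fun h => ?_, fun h => h ▸ val_zero⟩
  by_contra hx
  rw [val_of_ne hx] at h
  exact WithBot.coe_ne_bot h

/-- A signed tropical number is determined by its modulus and its sign. -/
theorem SignedTrop.ext_modulus_sgn {x y : SignedTrop} (h : x.modulus = y.modulus)
    (h' : x.sgn = y.sgn) : x = y := by
  cases x <;> cases y <;> simp_all [SignedTrop.modulus, SignedTrop.sgn]

theorem SignedTrop.modulus_mul (x y : SignedTrop) :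
    (x * y).modulus = x.modulus + y.modulus := by
  change (SignedTrop.mul x y).modulus = _
  cases x <;> cases y <;> simp [SignedTrop.modulus, SignedTrop.mul]

theorem SignedTrop.sgn_mul (x y : SignedTrop) : (x * y).sgn = x.sgn * y.sgn := by
  change (SignedTrop.mul x y).sgn = _
  cases x <;> cases y <;> simp [SignedTrop.sgn, SignedTrop.mul]

theorem val_mul (x y : PuiseuxSeries) : val (x * y) = val x + val y := by
  rcases eq_or_ne x 0 with rfl | hx
  · simp [val_zero]
  rcases eq_or_ne y 0 with rfl | hy
  · simp [val_zero]
  rw [val_of_ne hx, val_of_ne hy, val_of_ne (mul_ne_zero hx hy)]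
  have hx' : ofLex x.1 ≠ 0 := fun h => hx (Subtype.ext h)
  have hy' : ofLex y.1 ≠ 0 := fun h => hy (Subtype.ext h)
  have : (ofLex (x * y).1).order = (ofLex x.1).order + (ofLex y.1).order :=
    HahnSeries.order_mul hx' hy'
  rw [this]
  rfl

theorem sval_mul (x y : PuiseuxSeries) : sval (x * y) = sval x * sval y := by
  apply SignedTrop.ext_modulus_sgn
  · rw [SignedTrop.modulus_mul]; exact val_mul x y
  · rw [SignedTrop.sgn_mul, sval_sgn, sval_sgn, sval_sgn, sign_mul]

theorem sval_one : sval 1 = 1 := by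
  apply SignedTrop.ext_modulus_sgn
  · have : val (1 : PuiseuxSeries) = 0 := by
      rw [val_of_ne one_ne_zero]
      have : (ofLex (1 : PuiseuxSeries).1).order = 0 := HahnSeries.order_one
      rw [this]; rfl
    exact this
  · rw [sval_sgn, sign_one]; rfl

theorem val_one : val 1 = 0 := by rw [val, sval_one]; rfl

/-- The signed valuation as a monoid homomorphism. -/
noncomputable def svalHom : PuiseuxSeries →* SignedTrop where
  toFun := sval
  map_one' := sval_one
  map_mul' := sval_mul

theorem val_neg (x : PuiseuxSeries) : val (-x) = val x := by
  rcases eq_or_ne x 0 with rfl | hx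
  · simp
  rw [val_of_ne hx, val_of_ne (neg_ne_zero.2 hx)]
  have : (ofLex (-x).1).order = (ofLex x.1).order := HahnSeries.order_neg
  rw [this]

theorem val_abs (x : PuiseuxSeries) : val |x| = val x := by
  rcases abs_choice x with h | h <;> rw [h]
  exact val_neg x

/-- A term of larger valuation dominates a sum. -/
theorem sval_add_of_lt {x y : PuiseuxSeries} (h : val x < val y) : sval (x + y) = sval y := by
  have hy : y ≠ 0 := by rintro rfl; rw [val_zero] at h; exact not_lt_bot h
  have hy' : ofLex y.1 ≠ 0 := fun h => hy (Subtype.ext h)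
  have hlt : (ofLex y.1).orderTop < (ofLex x.1).orderTop := by
    rcases eq_or_ne x 0 with rfl | hx
    · have : (ofLex (0 : PuiseuxSeries).1) = 0 := rfl
      rw [this, HahnSeries.orderTop_zero]
      exact lt_top_iff_ne_top.2 (HahnSeries.orderTop_ne_top.2 hy')
    · have hx' : ofLex x.1 ≠ 0 := fun h => hx (Subtype.ext h)
      rw [val_of_ne hx, val_of_ne hy, WithBot.coe_lt_coe] at h
      rw [← HahnSeries.order_eq_orderTop_of_ne_zero hx',
        ← HahnSeries.order_eq_orderTop_of_ne_zero hy', WithTop.coe_lt_coe]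
      exact h
  have e : ofLex (x + y).1 = ofLex x.1 + ofLex y.1 := rfl
  have ho := HahnSeries.orderTop_add_eq_right hlt
  have hl := HahnSeries.leadingCoeff_add_eq_right hlt
  rw [← e] at ho hl
  have hxy : ofLex (x + y).1 ≠ 0 := by
    rw [← HahnSeries.orderTop_ne_top, ho]; exact HahnSeries.orderTop_ne_top.2 hy'
  have hxy' : x + y ≠ 0 := fun h => hxy (by rw [h]; rfl)
  rw [← HahnSeries.order_eq_orderTop_of_ne_zero hxy,
    ← HahnSeries.order_eq_orderTop_of_ne_zero hy', WithTop.coe_inj] at ho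
  have hpos : 0 < x + y ↔ 0 < y := by
    have h1 : 0 < (x + y).1 ↔ 0 < y.1 := by
      rw [← HahnSeries.leadingCoeff_pos_iff, ← HahnSeries.leadingCoeff_pos_iff, hl]
    exact h1
  unfold sval
  rw [ho]
  simp only [hxy', hy, hpos, if_false]

theorem val_mono {x y : PuiseuxSeries} (hx : 0 ≤ x) (hxy : x ≤ y) : val x ≤ val y := by
  by_contra! h
  have h1 : sval (-y + x) = sval x := sval_add_of_lt (by rwa [val_neg])
  have h2 := congrArg SignedTrop.sgn h1
  rw [sval_sgn, sval_sgn] at h2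
  have hx' : x ≠ 0 := by rintro rfl; rw [val_zero] at h; exact not_lt_bot h
  rw [sign_pos (lt_of_le_of_ne hx hx'.symm), sign_eq_one_iff] at h2
  linarith

theorem val_two : val 2 = 0 := by
  apply le_antisymm
  · by_contra! h
    have h0 : val (-2 : PuiseuxSeries) = val 2 := val_neg 2
    have h1 : sval (1 + (-2)) = sval (-2 : PuiseuxSeries) :=
      sval_add_of_lt (by rwa [val_neg, val_one])
    have h2 : val (1 + (-2) : PuiseuxSeries) = val (-2 : PuiseuxSeries) := by rw [val, h1, val]
    rw [h0, show (1 + (-2) : PuiseuxSeries) = -1 by norm_num, val_neg, val_one] at h2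
    exact h.ne h2
  · rw [← val_one]; exact val_mono zero_le_one one_le_two

/-- No cancellation occurs between the leading terms of nonnegative series. -/
theorem val_add_of_nonneg {x y : PuiseuxSeries} (hx : 0 ≤ x) (hy : 0 ≤ y) :
    val (x + y) = val x ⊔ val y := by
  apply le_antisymm
  · have key : ∀ z w : PuiseuxSeries, 0 ≤ z → z ≤ w → val (z + w) ≤ val w := fun z w hz hzw => by
      calc val (z + w) ≤ val (2 * w) := val_mono (by linarith) (by linarith)
        _ = val w := by rw [val_mul, val_two, zero_add]
    rcases le_total x y with h | h
    · exact (key x y hx h).trans le_sup_right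
    · rw [add_comm]; exact (key y x hy h).trans le_sup_left
  · exact sup_le (val_mono hx (by linarith)) (val_mono hy (by linarith))

theorem val_add_le (x y : PuiseuxSeries) : val (x + y) ≤ val x ⊔ val y := by
  rw [← val_abs x, ← val_abs y, ← val_add_of_nonneg (abs_nonneg _) (abs_nonneg _), ← val_abs]
  exact val_mono (abs_nonneg _) (abs_add_le _ _)

theorem val_sum_of_nonneg {ι : Type*} (s : Finset ι) (f : ι → PuiseuxSeries)
    (h : ∀ i ∈ s, 0 ≤ f i) : val (∑ i ∈ s, f i) = s.sup fun i => val (f i) := by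
  classical
  induction s using Finset.induction_on with
  | empty => simp [val_zero]
  | insert a s ha ih =>
    rw [Finset.sum_insert ha, Finset.sup_insert, val_add_of_nonneg, ih]
    · exact fun i hi => h i (Finset.mem_insert_of_mem hi)
    · exact h a (Finset.mem_insert_self _ _)
    · exact Finset.sum_nonneg fun i hi => h i (Finset.mem_insert_of_mem hi)

theorem val_sum_lt {ι : Type*} (s : Finset ι) (f : ι → PuiseuxSeries) {c : WithBot ℝ}
    (hc : c ≠ ⊥) (h : ∀ i ∈ s, val (f i) < c) : val (∑ i ∈ s, f i) < c := by
  classical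
  induction s using Finset.induction_on with
  | empty => simpa [val_zero] using bot_lt_iff_ne_bot.2 hc
  | insert a s ha ih =>
    rw [Finset.sum_insert ha]
    exact (val_add_le _ _).trans_lt (sup_lt_iff.2 ⟨h a (Finset.mem_insert_self _ _),
      ih fun i hi => h i (Finset.mem_insert_of_mem hi)⟩)

theorem val_sum_le {ι : Type*} (s : Finset ι) (f : ι → PuiseuxSeries) {c : WithBot ℝ}
    (h : ∀ i ∈ s, val (f i) ≤ c) : val (∑ i ∈ s, f i) ≤ c := by
  classical
  induction s using Finset.induction_on with
  | empty => simp [val_zero]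
  | insert a s ha ih =>
    rw [Finset.sum_insert ha]
    exact (val_add_le _ _).trans (sup_le (h a (Finset.mem_insert_self _ _))
      (ih fun i hi => h i (Finset.mem_insert_of_mem hi)))

/-- A term whose valuation exceeds that of all the others gives its signed valuation to the sum. -/
theorem sval_sum_of_dominant {ι : Type*} (s : Finset ι) (f : ι → PuiseuxSeries) {a : ι}
    (ha : a ∈ s) (h0 : val (f a) ≠ ⊥) (h : ∀ i ∈ s, i ≠ a → val (f i) < val (f a)) :
    sval (∑ i ∈ s, f i) = sval (f a) := by
  classical
  rw [← Finset.sum_erase_add s f ha]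
  exact sval_add_of_lt (val_sum_lt _ _ h0 fun i hi =>
    h i (Finset.mem_of_mem_erase hi) (Finset.ne_of_mem_erase hi))

/-- The monomial `r t^α`. -/
noncomputable def mono (α r : ℝ) : PuiseuxSeries :=
  ⟨toLex (HahnSeries.single (OrderDual.toDual α) r), IsPuiseux.single _ _⟩

theorem mono_ne_zero {α r : ℝ} (hr : r ≠ 0) : mono α r ≠ 0 := fun h => by
  have h1 : (HahnSeries.single (OrderDual.toDual α) r) = 0 := congrArg (fun z => ofLex z.1) h
  exact hr (by simpa using h1)

theorem mono_zero (α : ℝ) : mono α 0 = 0 := by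
  apply Subtype.ext
  change toLex (HahnSeries.single (OrderDual.toDual α) (0 : ℝ)) = 0
  rw [HahnSeries.single_eq_zero]; rfl

theorem mono_pos {α r : ℝ} (hr : 0 < r) : 0 < mono α r := by
  have : 0 < (mono α r).1 := by
    rw [← HahnSeries.leadingCoeff_pos_iff]
    change 0 < (HahnSeries.single (OrderDual.toDual α) r).leadingCoeff
    rwa [HahnSeries.leadingCoeff_of_single]
  exact this

theorem mono_mul (α β r s : ℝ) : mono α r * mono β s = mono (α + β) (r * s) := by
  apply Subtype.ext
  change toLex (HahnSeries.single (OrderDual.toDual α) r * HahnSeries.single (OrderDual.toDual β) s)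
    = toLex (HahnSeries.single (OrderDual.toDual (α + β)) (r * s))
  rw [HahnSeries.single_mul_single]; rfl

theorem mono_add (α r s : ℝ) : mono α (r + s) = mono α r + mono α s := by
  apply Subtype.ext
  change toLex (HahnSeries.single (OrderDual.toDual α) (r + s)) = toLex
    (HahnSeries.single (OrderDual.toDual α) r + HahnSeries.single (OrderDual.toDual α) s)
  rw [HahnSeries.single_add]

theorem mono_neg (α r : ℝ) : mono α (-r) = -mono α r := by
  rw [eq_neg_iff_add_eq_zero, ← mono_add, neg_add_cancel, mono_zero]

/-- The real constants form a subring of the Puiseux series. -/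
noncomputable def constHom : ℝ →+* PuiseuxSeries where
  toFun := mono 0
  map_one' := rfl
  map_mul' x y := by rw [mono_mul, add_zero]
  map_zero' := mono_zero 0
  map_add' := mono_add 0

theorem val_mono_of_ne {α r : ℝ} (hr : r ≠ 0) : val (mono α r) = α := by
  rw [val_of_ne (mono_ne_zero hr)]
  change ((OrderDual.ofDual (HahnSeries.single (OrderDual.toDual α) r).order : ℝ) : WithBot ℝ) = α
  rw [HahnSeries.order_single hr]; rfl

theorem sval_mono_pos {α r : ℝ} (hr : 0 < r) : sval (mono α r) = SignedTrop.pos α := by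
  apply SignedTrop.ext_modulus_sgn
  · exact val_mono_of_ne hr.ne'
  · rw [sval_sgn, sign_pos (mono_pos hr)]; rfl

theorem sval_mono_neg {α r : ℝ} (hr : r < 0) : sval (mono α r) = SignedTrop.neg α := by
  apply SignedTrop.ext_modulus_sgn
  · exact val_mono_of_ne hr.ne
  · rw [sval_sgn, ← neg_neg r, mono_neg, sign_neg (neg_lt_zero.2 (mono_pos (by linarith)))]; rfl

/-- Every signed tropical number is a signed valuation. -/
theorem exists_sval_eq (x : SignedTrop) : ∃ y, sval y = x := by
  cases x with
  | zero => exact ⟨0, by simp [sval]⟩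
  | pos a => exact ⟨mono a 1, sval_mono_pos one_pos⟩
  | neg a => exact ⟨mono a (-1), sval_mono_neg (by norm_num)⟩

/-- A series of nonpositive valuation is a real constant, its residue, up to a series of negative
valuation. -/
theorem exists_residue {x : PuiseuxSeries} (h : val x ≤ 0) : ∃ r : ℝ, val (x - mono 0 r) < 0 := by
  refine ⟨(ofLex x.1).coeff 0, ?_⟩
  set r := (ofLex x.1).coeff 0 with hr
  set y := x - mono 0 r with hy
  rcases eq_or_ne y 0 with h0 | h0
  · rw [h0, val_zero]; exact WithBot.bot_lt_coe 0
  have hle : val y ≤ 0 := by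
    rw [hy, sub_eq_add_neg]
    refine (val_add_le _ _).trans (sup_le h ?_)
    rw [val_neg]
    rcases eq_or_ne r 0 with h1 | h1
    · rw [h1, mono_zero, val_zero]; exact bot_le
    · rw [val_mono_of_ne h1]; exact le_refl _
  refine lt_of_le_of_ne hle fun he => ?_
  have h2 : (ofLex y.1).coeff (ofLex y.1).order ≠ 0 := fun h =>
    h0 (Subtype.ext (HahnSeries.coeff_order_eq_zero.1 h))
  rw [val_of_ne h0] at he
  have h3 : (ofLex y.1).order = 0 := WithBot.coe_injective he
  rw [h3] at h2
  apply h2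
  have : ofLex y.1 = ofLex x.1 - HahnSeries.single 0 r := rfl
  rw [this, HahnSeries.coeff_sub, HahnSeries.coeff_single_same, hr, sub_self]

/-! ### Positive solutions of systems without cycles -/

/-- If every row of `N` has a positive and a negative entry, and no square submatrix of `N` has two
transversals without zero entries, then no nontrivial combination of the rows is nonnegative.
Otherwise, starting from a row of the combination, one moves on forever to a column where its
contribution is negative, and then to a row whose contribution in this column is positive; the
resulting cycle carries two transversals. -/
theorem eq_zero_of_vecMul_nonneg {E C : Type*} [Fintype E] (N : Matrix E C ℝ)
    (hpos : ∀ i, ∃ c, 0 < N i c) (hneg : ∀ i, ∃ c, N i c < 0)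
    (hcyc : ∀ (p : ℕ) (f : Fin p ↪ E) (g : Fin p ↪ C) (σ : Equiv.Perm (Fin p)),
      (∀ i, N (f i) (g i) ≠ 0) → (∀ i, N (f i) (g (σ i)) ≠ 0) → σ = 1)
    (y : E → ℝ) (hy : ∀ c, 0 ≤ ∑ i, y i * N i c) : y = 0 := by
  classical
  by_contra hne
  obtain ⟨i₀, hi₀⟩ : ∃ i, y i ≠ 0 := by
    by_contra! h
    exact hne (funext h)
  -- `φ` goes from a row to a column where its contribution is negative, `γ` from such a column to
  -- a row whose contribution is positive
  let S := {i // y i ≠ 0}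
  have hφ : ∀ i : S, ∃ c, y i.1 * N i.1 c < 0 := by
    rintro ⟨i, hi⟩
    rcases lt_or_gt_of_ne hi with h | h
    · obtain ⟨c, hc⟩ := hpos i
      exact ⟨c, mul_neg_of_neg_of_pos h hc⟩
    · obtain ⟨c, hc⟩ := hneg i
      exact ⟨c, mul_neg_of_pos_of_neg h hc⟩
  have hγ : ∀ c, (∃ i : S, y i.1 * N i.1 c < 0) → ∃ i : S, 0 < y i.1 * N i.1 c := by
    rintro c ⟨i, hi⟩
    by_contra! h
    have : ∑ i, y i * N i c < 0 := by
      refine Finset.sum_neg' (fun j _ => ?_) ⟨i.1, Finset.mem_univ _, hi⟩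
      by_cases hj : y j = 0
      · simp [hj]
      · exact h ⟨j, hj⟩
    exact absurd (hy c) (not_le.2 this)
  choose φ hφ using hφ
  choose γ hγ using hγ
  let h : S → S := fun i => γ (φ i) ⟨i, hφ i⟩
  have hh : ∀ i i', φ i = φ i' → h i = h i' := fun i i' e => by simp only [h, e]
  -- on its periodic points, `h = γ ∘ φ` is a permutation, which must be trivial
  let P := Function.periodicPts h
  have hbij : Set.BijOn h P P := Function.bijOn_periodicPts h
  have hPne : P.Nonempty := by
    obtain ⟨a, b, hab, he⟩ := Finite.exists_ne_map_eq_of_infinite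
      (fun k : ℕ => h^[k] (⟨i₀, hi₀⟩ : S))
    wlog hlt : a < b generalizing a b
    · exact this b a hab.symm he.symm (lt_of_le_of_ne (not_lt.1 hlt) hab.symm)
    refine ⟨h^[a] ⟨i₀, hi₀⟩, Function.mk_mem_periodicPts (n := b - a) (by omega) ?_⟩
    change h^[b - a] _ = _
    rw [← Function.iterate_add_apply, Nat.sub_add_cancel hlt.le]
    exact he.symm
  let τ : Equiv.Perm P := hbij.equiv h
  have hτ : ∀ i : P, (τ i).1 = h i.1 := fun i => rfl
  let e := Fintype.equivFin P
  let f : Fin (Fintype.card P) ↪ E :=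
    ⟨fun i => (e.symm i).1.1, fun i j hij => e.symm.injective (Subtype.ext (Subtype.ext hij))⟩
  let g : Fin (Fintype.card P) ↪ C :=
    ⟨fun i => φ (e.symm i).1, fun i j hij => by
      apply e.symm.injective
      apply τ.injective
      apply Subtype.ext
      rw [hτ, hτ]
      exact hh _ _ hij⟩
  let σ : Equiv.Perm (Fin (Fintype.card P)) := (e.symm.trans τ.symm).trans e
  have hσ : σ = 1 := by
    refine hcyc _ f g σ (fun i => ?_) (fun i => ?_)
    · exact (mul_ne_zero_iff.1 (hφ (e.symm i).1).ne).2
    · have h1 : (e.symm (σ i)) = τ.symm (e.symm i) := by simp [σ]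
      have h2 := hγ (φ (τ.symm (e.symm i)).1) ⟨_, hφ _⟩
      have h3 : γ (φ (τ.symm (e.symm i)).1) ⟨_, hφ _⟩ = (e.symm i).1 := by
        have := hτ (τ.symm (e.symm i))
        rw [Equiv.apply_symm_apply] at this
        exact this.symm
      rw [h3] at h2
      change N (e.symm i).1.1 (φ (e.symm (σ i)).1) ≠ 0
      rw [h1]
      exact (mul_ne_zero_iff.1 h2.ne').2
  obtain ⟨i, hi⟩ := hPne
  have h1 : τ ⟨i, hi⟩ = ⟨i, hi⟩ := by
    have h2 : σ (e (τ ⟨i, hi⟩)) = e ⟨i, hi⟩ := by simp [σ]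
    rw [hσ] at h2
    exact e.injective h2
  have h2 : h i = i := congrArg Subtype.val h1
  have h3 := hγ (φ i) ⟨i, hφ i⟩
  have h4 : γ (φ i) ⟨i, hφ i⟩ = i := h2
  rw [h4] at h3
  exact lt_asymm h3 (hφ i)

/-- If no nontrivial combination of the rows of `N` is nonnegative, the rows are independent, and
the kernel contains a positive vector. -/
theorem exists_rightInverse_and_pos_ker {E C : Type*} [Fintype E] [Fintype C] [DecidableEq E]
    (N : Matrix E C ℝ) (hN : ∀ y : E → ℝ, (∀ c, 0 ≤ ∑ i, y i * N i c) → y = 0) :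
    (∃ W : Matrix C E ℝ, N * W = 1) ∧ ∃ c : C → ℝ, (∀ j, 0 < c j) ∧ N *ᵥ c = 0 := by
  classical
  have lin : ∀ (f : (E → ℝ) →ₗ[ℝ] ℝ) (w : E → ℝ), f w = ∑ i, w i * f (Pi.single i 1) := by
    intro f w
    conv_lhs => rw [← Finset.univ_sum_single w]
    rw [map_sum]
    refine Finset.sum_congr rfl fun i _ => ?_
    rw [← smul_eq_mul, ← map_smul, ← Pi.single_smul', smul_eq_mul, mul_one]
  have zero : ∀ f : (E → ℝ) →ₗ[ℝ] ℝ, (∀ c, 0 ≤ f fun i => N i c) → f = 0 := by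
    intro f hf
    have h := hN (fun i => f (Pi.single i 1)) fun c => by
      have := hf c
      rw [lin f] at this
      simpa [mul_comm] using this
    ext i
    simpa using congrFun h i
  have hsurj : Function.Surjective N.mulVecLin := by
    rw [← LinearMap.range_eq_top]
    by_contra h
    obtain ⟨f, hf0, hf⟩ := Submodule.exists_le_ker_of_lt_top _ (lt_top_iff_ne_top.2 h)
    refine hf0 (zero f fun c => le_of_eq ?_)
    have : N.mulVecLin (Pi.single c 1) ∈ LinearMap.ker f := hf ⟨_, rfl⟩
    have h2 : N.mulVecLin (Pi.single c 1) = fun i => N i c := by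
      rw [Matrix.mulVecLin_apply, Matrix.mulVec_single_one]; rfl
    rw [h2, LinearMap.mem_ker] at this
    exact this.symm
  refine ⟨Matrix.mulVec_surjective_iff_exists_right_inverse.1 hsurj, ?_⟩
  -- the image of the open positive orthant is open and convex; were `0` not in it, a separating
  -- functional would be a nonnegative combination of the rows
  let U : Set (C → ℝ) := Set.pi Set.univ fun _ => Set.Ioi 0
  have hU : IsOpen U := isOpen_set_pi Set.finite_univ fun _ _ => isOpen_Ioi
  have hUc : Convex ℝ U := convex_pi fun _ _ => convex_Ioi 0
  by_contra! hno
  have h0 : (0 : E → ℝ) ∉ N.mulVecLin '' U := by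
    rintro ⟨c, hc, hc0⟩
    exact hno c (fun j => hc j (Set.mem_univ j)) hc0
  obtain ⟨f, hf⟩ := geometric_hahn_banach_point_open (hUc.linear_image N.mulVecLin)
    (LinearMap.isOpenMap_of_finiteDimensional N.mulVecLin hsurj U hU) h0
  rw [map_zero] at hf
  have hf' : ∀ c ∈ U, 0 < f (N.mulVecLin c) := fun c hc => hf _ ⟨c, hc, rfl⟩
  have hf0 : (f : (E → ℝ) →ₗ[ℝ] ℝ) = 0 := by
    refine zero _ fun c => ?_
    by_contra! hneg
    have hcl : Pi.single c 1 ∈ closure U := by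
      rw [closure_pi_set]
      intro j _
      rw [closure_Ioi]
      by_cases hj : j = c
      · subst hj; simp
      · simp [hj]
    have hcont : Continuous fun w => f (N.mulVecLin w) :=
      f.continuous.comp (LinearMap.continuous_of_finiteDimensional _)
    have hmem := map_mem_closure hcont hcl (t := Set.Ioi 0) fun w hw => hf' w hw
    rw [closure_Ioi] at hmem
    have h2 : N.mulVecLin (Pi.single c 1) = fun i => N i c := by
      rw [Matrix.mulVecLin_apply, Matrix.mulVec_single_one]; rfl
    rw [h2] at hmem
    exact absurd hneg (not_lt.2 hmem)
  have h1 := hf' (fun _ => 1) fun _ _ => Set.mem_Ioi.2 one_pos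
  have h2 : f (N.mulVecLin fun _ => 1) = 0 := congrArg (fun g => g (N.mulVecLin fun _ => 1)) hf0
  rw [h2] at h1
  exact lt_irrefl _ h1

/-! ### Lifting solutions from the residue field -/

theorem val_sub_lt {x y : PuiseuxSeries} {c : WithBot ℝ} (hx : val x < c) (hy : val y < c) :
    val (x - y) < c := by
  rw [sub_eq_add_neg]
  exact (val_add_le _ _).trans_lt (sup_lt_iff.2 ⟨hx, by rwa [val_neg]⟩)

theorem val_const_le (r : ℝ) : val (constHom r) ≤ 0 := by
  change val (mono 0 r) ≤ 0
  rcases eq_or_ne r 0 with h1 | h1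
  · rw [h1, mono_zero, val_zero]; exact bot_le
  · rw [val_mono_of_ne h1]; exact le_refl _

/-- A perturbation of the identity by infinitesimals preserves upper bounds on valuations. -/
theorem val_lt_of_perturbation {E : Type*} [Fintype E] (η : Matrix E E PuiseuxSeries)
    (hη : ∀ i j, val (η i j) < 0) (z e : E → PuiseuxSeries)
    (hz : ∀ i, z i + (η *ᵥ z) i = e i) {c : WithBot ℝ} (hc : c ≠ ⊥) (he : ∀ i, val (e i) < c) :
    ∀ i, val (z i) < c := by
  intro i₀
  have : Nonempty E := ⟨i₀⟩
  obtain ⟨i, hi⟩ := Finite.exists_max fun i => val (z i)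
  refine (hi i₀).trans_lt ?_
  by_contra! hle
  have hne : val (z i) ≠ ⊥ := fun h => hc (le_bot_iff.1 (h ▸ hle))
  have h1 : z i = e i - (η *ᵥ z) i := by rw [← hz i]; ring
  have h2 : val (z i) < val (z i) := by
    conv_lhs => rw [h1]
    refine val_sub_lt ((he i).trans_le hle) (val_sum_lt _ _ hne fun j _ => ?_)
    rw [val_mul]
    calc val (η i j) + val (z j) ≤ val (η i j) + val (z i) := add_le_add le_rfl (hi j)
      _ < 0 + val (z i) := by
        obtain ⟨r, hr⟩ := WithBot.ne_bot_iff_exists.1 hne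
        rw [← hr]
        exact WithBot.add_lt_add_right WithBot.coe_ne_bot (hη i j)
      _ = val (z i) := zero_add _
  exact lt_irrefl _ h2

/-- A positive solution of the residual system extends to a solution over the Puiseux series, when
the residual matrix has independent rows. -/
theorem exists_ker_lift {E C : Type*} [Fintype E] [Fintype C] [DecidableEq E]
    (S : Matrix E C PuiseuxSeries) (N : Matrix E C ℝ)
    (hS : ∀ i j, val (S i j - mono 0 (N i j)) < 0) (W : Matrix C E ℝ) (hW : N * W = 1)
    (c : C → ℝ) (hc : N *ᵥ c = 0) :
    ∃ x : C → PuiseuxSeries, S *ᵥ x = 0 ∧ ∀ j, val (x j - mono 0 (c j)) < 0 := by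
  have h0 : (0 : WithBot ℝ) ≠ ⊥ := WithBot.coe_ne_bot
  let N' := N.map constHom
  let W' := W.map constHom
  let c' : C → PuiseuxSeries := fun j => constHom (c j)
  have hNW : N' * W' = 1 := by
    rw [← Matrix.map_mul, hW]; simp
  have hNc : N' *ᵥ c' = 0 := by
    have := RingHom.map_mulVec constHom N c
    ext1 i
    refine (this i).symm.trans ?_
    rw [hc]; simp
  have small : ∀ (i : E) (v : C → PuiseuxSeries), (∀ j, val (v j) ≤ 0) →
      val (((S - N') *ᵥ v) i) < 0 := by
    intro i v hv
    refine val_sum_lt _ _ h0 fun j _ => ?_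
    rw [val_mul]
    calc val ((S - N') i j) + val (v j) ≤ val ((S - N') i j) + 0 := add_le_add le_rfl (hv j)
      _ < 0 := by rw [add_zero]; exact hS i j
  let η := (S - N') * W'
  have hη : ∀ i j, val (η i j) < 0 := fun i j => small i (fun k => W' k j) fun k => val_const_le _
  have hSW : S * W' = 1 + η := by
    simp only [η, Matrix.sub_mul, hNW]; abel
  have key : ∀ z : E → PuiseuxSeries, ∀ i, ((S * W') *ᵥ z) i = z i + (η *ᵥ z) i := fun z i => by
    rw [hSW, Matrix.add_mulVec, Matrix.one_mulVec]; rfl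
  have hdet : (S * W').det ≠ 0 := by
    intro hd
    obtain ⟨z, hz0, hz⟩ := Matrix.exists_mulVec_eq_zero_iff.2 hd
    apply hz0
    ext1 i
    by_contra hzi
    exact lt_irrefl _ (val_lt_of_perturbation η hη z 0 (fun i => by rw [← key, hz])
      (c := val (z i)) (fun h => hzi (val_eq_bot.1 h))
      (fun j => by
        simp only [Pi.zero_apply, val_zero]
        exact bot_lt_iff_ne_bot.2 fun h => hzi (val_eq_bot.1 h)) i)
  let e := S *ᵥ c'
  have he : ∀ i, val (e i) < 0 := fun i => by
    have h1 := small i c' fun j => val_const_le _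
    rw [Matrix.sub_mulVec, hNc, sub_zero] at h1
    exact h1
  -- correct the constant vector `c` within the image of the right inverse `W`, as `S * W` is a
  -- perturbation of the identity
  let z := (S * W')⁻¹ *ᵥ e
  have hz : (S * W') *ᵥ z = e := by
    simp only [z, Matrix.mulVec_mulVec]
    rw [Matrix.mul_nonsing_inv _ (isUnit_iff_ne_zero.2 hdet), Matrix.one_mulVec]
  have hzv := val_lt_of_perturbation η hη z e (fun i => by rw [← key, hz]) h0 he
  refine ⟨c' - W' *ᵥ z, ?_, fun j => ?_⟩
  · rw [Matrix.mulVec_sub, Matrix.mulVec_mulVec, hz, sub_self]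
  · have h1 : (c' - W' *ᵥ z) j - mono 0 (c j) = -((W' *ᵥ z) j) := by
      change constHom (c j) - (W' *ᵥ z) j - constHom (c j) = _
      ring
    rw [h1, val_neg]
    refine val_sum_lt _ _ h0 fun k _ => ?_
    rw [val_mul]
    calc val (W' j k) + val (z k) ≤ 0 + val (z k) := add_le_add (val_const_le _) le_rfl
      _ < 0 := by rw [zero_add]; exact hzv k

/-! ### Tropical points lift to Puiseux points -/

section Lifting

variable {m n : ℕ}

theorem SignedTrop.modulus_eq_sup (x : SignedTrop) : x.modulus = x.posPart ⊔ x.negPart := by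
  cases x <;> simp [SignedTrop.posPart, SignedTrop.negPart, SignedTrop.modulus]

theorem SignedTrop.posPart_eq {x : SignedTrop} (h : x.posPart ≠ ⊥) :
    x.posPart = x.modulus ∧ x.sgn = 1 := by
  cases x <;> simp_all [SignedTrop.posPart, SignedTrop.sgn, SignedTrop.modulus]

theorem SignedTrop.negPart_eq {x : SignedTrop} (h : x.negPart ≠ ⊥) :
    x.negPart = x.modulus ∧ x.sgn = -1 := by
  cases x <;> simp_all [SignedTrop.negPart, SignedTrop.sgn, SignedTrop.modulus]

/-- The matrix `(A b)`. -/
abbrev augment {R : Type*} (A : Matrix (Fin m) (Fin n) R) (b : Fin m → R) :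
    Matrix (Fin m) (Fin n ⊕ Fin 1) R :=
  Matrix.fromCols A (Matrix.replicateCol (Fin 1) b)

theorem tropLHS_eq (A : Matrix (Fin m) (Fin n) SignedTrop) (b : Fin m → SignedTrop) (i : Fin m)
    (x : Fin n → WithBot ℝ) : tropLHS A b i x = Finset.univ.sup fun c : Fin n ⊕ Fin 1 =>
      (augment A b i c).posPart + (Sum.elim x 0 c : WithBot ℝ) := by
  rw [← Finset.univ_disjSum_univ, Finset.sup_disjSum]
  simp [tropLHS]

theorem tropRHS_eq (A : Matrix (Fin m) (Fin n) SignedTrop) (b : Fin m → SignedTrop) (i : Fin m)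
    (x : Fin n → WithBot ℝ) : tropRHS A b i x = Finset.univ.sup fun c : Fin n ⊕ Fin 1 =>
      (augment A b i c).negPart + (Sum.elim x 0 c : WithBot ℝ) := by
  rw [← Finset.univ_disjSum_univ, Finset.sup_disjSum]
  simp [tropRHS]

/-- The entries of a strongly non-degenerate matrix are not `-∞`. -/
theorem StronglyNondegenerate.modulus_ne_bot {ι κ : Type*} {M : Matrix ι κ SignedTrop}
    (h : StronglyNondegenerate M) (i : ι) (j : κ) : (M i j).modulus ≠ ⊥ := by
  obtain ⟨σ, hσ, -⟩ := h 1 ⟨fun _ => i, fun _ _ _ => Subsingleton.elim _ _⟩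
    ⟨fun _ => j, fun _ _ _ => Subsingleton.elim _ _⟩
  rwa [permWeight, Fin.sum_univ_one] at hσ

/-- In a generic matrix, at most one transversal has its entries reaching prescribed upper bounds
of the form `μ i - ξ j`. -/
theorem IsGeneric.eq_of_tight {p : ℕ} {M : Matrix (Fin p) (Fin p) SignedTrop} (h : IsGeneric M)
    (μ ξ : Fin p → ℝ) (hle : ∀ i j, (M i j).modulus ≤ ((μ i - ξ j : ℝ) : WithBot ℝ))
    {σ : Equiv.Perm (Fin p)}
    (hσ : ∀ i, (M i (σ i)).modulus = ((μ i - ξ (σ i) : ℝ) : WithBot ℝ))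
    {τ : Equiv.Perm (Fin p)}
    (hτ : ∀ i, (M i (τ i)).modulus = ((μ i - ξ (τ i) : ℝ) : WithBot ℝ)) : σ = τ := by
  have hsum : ∀ ρ : Equiv.Perm (Fin p), ∑ i, ((μ i - ξ (ρ i) : ℝ) : WithBot ℝ)
      = ((∑ i, μ i - ∑ i, ξ i : ℝ) : WithBot ℝ) := fun ρ => by
    rw [← WithBot.coe_sum, Finset.sum_sub_distrib, Equiv.sum_comp ρ ξ]
  obtain ⟨ρ, -, hρ⟩ := h
  have key : ∀ σ : Equiv.Perm (Fin p),
      (∀ i, (M i (σ i)).modulus = ((μ i - ξ (σ i) : ℝ) : WithBot ℝ)) → σ = ρ := by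
    intro σ hσ
    by_contra hne
    have h1 := hρ σ hne
    have h2 : permWeight M ρ ≤ permWeight M σ := by
      unfold permWeight
      rw [Finset.sum_congr rfl fun i _ => hσ i, hsum σ, ← hsum ρ]
      exact Finset.sum_le_sum fun i _ => hle i (ρ i)
    exact absurd h1 (not_lt.2 h2)
  rw [key σ hσ, key τ hτ]

/-- Let the entries of `A` and `b` be the signed valuations of those of `A'` and `b'`. If `(A b)`
is strongly non-degenerate, every tropical point `x` is the valuation of a nonnegative point
satisfying with equality all the inequalities that `x` satisfies with equality. -/
theorem exists_lift {A : Matrix (Fin m) (Fin n) SignedTrop} {b : Fin m → SignedTrop}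
    (hAb : StronglyNondegenerate (augment A b))
    {A' : Matrix (Fin m) (Fin n) PuiseuxSeries} {b' : Fin m → PuiseuxSeries}
    (hA : ∀ i j, sval (A' i j) = A i j) (hb : ∀ i, sval (b' i) = b i) (x : Fin n → WithBot ℝ) :
    ∃ x' : Fin n → PuiseuxSeries, (∀ j, 0 ≤ x' j) ∧ (∀ j, val (x' j) = x j) ∧
      ∀ i, tropLHS A b i x = tropRHS A b i x → A' i ⬝ᵥ x' + b' i = 0 := by
  classical
  let M := augment A b
  let M' := augment A' b'
  have hM : ∀ i c, sval (M' i c) = M i c := by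
    rintro i (j | j)
    · exact hA i j
    · exact hb i
  -- the constant term is treated as one more column, with coordinate `0`
  let X : Fin n ⊕ Fin 1 → WithBot ℝ := Sum.elim x 0
  have hX1 : X (Sum.inr 0) ≠ ⊥ := WithBot.coe_ne_bot
  let E := {i // tropLHS A b i x = tropRHS A b i x}
  let C := {c // X c ≠ ⊥}
  let ξ : Fin n ⊕ Fin 1 → ℝ := fun c => (X c).unbotD 0
  have hξ : ∀ c, X c ≠ ⊥ → X c = ξ c := fun c hc => by
    obtain ⟨r, hr⟩ := WithBot.ne_bot_iff_exists.1 hc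
    simp only [ξ, ← hr, WithBot.unbotD_coe]
  -- the common value of the two sides of an equality is attained by a positive and by a negative
  -- coefficient, and bounds the modulus of all the terms
  have hrow : ∀ i : E, ∃ μ : ℝ, (∀ c, (M i.1 c).modulus + X c ≤ μ) ∧
      (∃ c, (M i.1 c).sgn = 1 ∧ (M i.1 c).modulus + X c = μ) ∧
      (∃ c, (M i.1 c).sgn = -1 ∧ (M i.1 c).modulus + X c = μ) := by
    rintro ⟨i, hi⟩
    have hle : ∀ c, (M i c).modulus + X c ≤ tropLHS A b i x := fun c => by
      rw [SignedTrop.modulus_eq_sup]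
      rcases le_total (M i c).posPart (M i c).negPart with h | h
      · rw [sup_eq_right.2 h, hi, tropRHS_eq]
        exact Finset.le_sup (f := fun c => (M i c).negPart + X c) (Finset.mem_univ c)
      · rw [sup_eq_left.2 h, tropLHS_eq]
        exact Finset.le_sup (f := fun c => (M i c).posPart + X c) (Finset.mem_univ c)
    have hne : tropLHS A b i x ≠ ⊥ := by
      intro h
      have h1 := hle (Sum.inr 0)
      rw [h, le_bot_iff, WithBot.add_eq_bot] at h1
      exact h1.elim (hAb.modulus_ne_bot i _) hX1
    obtain ⟨μ, hμ⟩ := WithBot.ne_bot_iff_exists.1 hne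
    have huniv : (Finset.univ : Finset (Fin n ⊕ Fin 1)).Nonempty := ⟨Sum.inr 0, Finset.mem_univ _⟩
    refine ⟨μ, fun c => hμ ▸ hle c, ?_, ?_⟩
    · obtain ⟨c, -, hc⟩ := Finset.exists_mem_eq_sup _ huniv fun c => (M i c).posPart + X c
      rw [← tropLHS_eq A b i x, ← hμ] at hc
      have h1 : (M i c).posPart ≠ ⊥ := fun h => by
        rw [h, WithBot.bot_add] at hc; exact WithBot.coe_ne_bot hc
      exact ⟨c, (SignedTrop.posPart_eq h1).2, by rw [← (SignedTrop.posPart_eq h1).1, hc]⟩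
    · obtain ⟨c, -, hc⟩ := Finset.exists_mem_eq_sup _ huniv fun c => (M i c).negPart + X c
      rw [← tropRHS_eq A b i x, ← hi, ← hμ] at hc
      have h1 : (M i c).negPart ≠ ⊥ := fun h => by
        rw [h, WithBot.bot_add] at hc; exact WithBot.coe_ne_bot hc
      exact ⟨c, (SignedTrop.negPart_eq h1).2, by rw [← (SignedTrop.negPart_eq h1).1, hc]⟩
  choose μ hμle hμpos hμneg using hrow
  -- after rescaling, the dominant terms of the equalities are those of valuation `0`
  let S : Matrix E C PuiseuxSeries := fun i c => M' i.1 c.1 * mono (ξ c.1 - μ i) 1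
  have hSval : ∀ i c, val (S i c) = (M i.1 c.1).modulus + ((ξ c.1 - μ i : ℝ) : WithBot ℝ) :=
    fun i c => by
      simp only [S]
      rw [val_mul, val_mono_of_ne one_ne_zero, ← hM, val]
  have hSsgn : ∀ i c, SignType.sign (S i c) = (M i.1 c.1).sgn := fun i c => by
    simp only [S]
    rw [sign_mul, sign_pos (mono_pos one_pos), mul_one, ← hM, sval_sgn]
  have hmod : ∀ (i : E) (c : C), ∃ r : ℝ, (M i.1 c.1).modulus = r := fun i c => by
    obtain ⟨r, hr⟩ := WithBot.ne_bot_iff_exists.1 (hAb.modulus_ne_bot i.1 c.1)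
    exact ⟨r, hr.symm⟩
  have hSle : ∀ i c, val (S i c) ≤ 0 := fun i c => by
    obtain ⟨r, hr⟩ := hmod i c
    have h1 := hμle i c.1
    rw [hξ c.1 c.2, hr, ← WithBot.coe_add, WithBot.coe_le_coe] at h1
    rw [hSval, hr, ← WithBot.coe_add, ← WithBot.coe_zero, WithBot.coe_le_coe]
    linarith
  choose N hN using fun i c => exists_residue (hSle i c)
  -- an entry of the residue matrix `N` is nonzero exactly where the maximum of the row is attained,
  -- and then has the sign of the coefficient
  have hdom : ∀ i c, N i c ≠ 0 → sval (S i c) = sval (mono 0 (N i c)) := fun i c h => by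
    have h1 := sval_add_of_lt (x := S i c - mono 0 (N i c)) (y := mono 0 (N i c))
      (by rw [val_mono_of_ne h]; exact hN i c)
    rwa [sub_add_cancel] at h1
  have hNne : ∀ i c, val (S i c) = 0 → N i c ≠ 0 := fun i c h h0 => by
    have h1 := hN i c
    rw [h0, mono_zero, sub_zero, h] at h1
    exact lt_irrefl _ h1
  have htight : ∀ (i : E) (c : C), (M i.1 c.1).modulus + X c.1 = μ i → N i c ≠ 0 :=
    fun i c h => by
      obtain ⟨r, hr⟩ := hmod i c
      apply hNne
      rw [hξ c.1 c.2, hr, ← WithBot.coe_add, WithBot.coe_inj] at h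
      rw [hSval, hr, ← WithBot.coe_add, ← WithBot.coe_zero, WithBot.coe_inj]
      linarith
  have hattained : ∀ (i : E) (c : Fin n ⊕ Fin 1), (M i.1 c).modulus + X c = μ i → X c ≠ ⊥ :=
    fun i c h h0 => by rw [h0, WithBot.add_bot] at h; exact WithBot.coe_ne_bot h.symm
  have hsign : ∀ i c, N i c ≠ 0 → SignType.sign (mono 0 (N i c)) = (M i.1 c.1).sgn :=
    fun i c h => by
      rw [← hSsgn, ← sval_sgn, ← sval_sgn, hdom i c h]
  have hpos : ∀ i, ∃ c, 0 < N i c := fun i => by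
    obtain ⟨c, hs, hc⟩ := hμpos i
    have h0 := htight i ⟨c, hattained i c hc⟩ hc
    have h1 := hsign i ⟨c, hattained i c hc⟩ h0
    refine ⟨⟨c, hattained i c hc⟩, lt_of_le_of_ne ?_ h0.symm⟩
    by_contra! hlt
    rw [hs, sign_eq_one_iff] at h1
    have h2 := mono_pos (α := 0) (neg_pos.2 hlt)
    rw [mono_neg] at h2
    linarith
  have hneg : ∀ i, ∃ c, N i c < 0 := fun i => by
    obtain ⟨c, hs, hc⟩ := hμneg i
    have h0 := htight i ⟨c, hattained i c hc⟩ hc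
    have h1 := hsign i ⟨c, hattained i c hc⟩ h0
    refine ⟨⟨c, hattained i c hc⟩, lt_of_le_of_ne ?_ h0⟩
    by_contra! hlt
    rw [hs, sign_eq_neg_one_iff] at h1
    exact lt_asymm (mono_pos hlt) h1
  have hcyc : ∀ (p : ℕ) (f : Fin p ↪ E) (g : Fin p ↪ C) (σ : Equiv.Perm (Fin p)),
      (∀ i, N (f i) (g i) ≠ 0) → (∀ i, N (f i) (g (σ i)) ≠ 0) → σ = 1 := by
    intro p f g σ h1 h2
    have hle : ∀ (i : E) (c : C), (M i.1 c.1).modulus ≤ ((μ i - ξ c.1 : ℝ) : WithBot ℝ) := fun i c => by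
      obtain ⟨r, hr⟩ := hmod i c
      have h1 := hμle i c.1
      rw [hξ c.1 c.2, hr, ← WithBot.coe_add, WithBot.coe_le_coe] at h1
      rw [hr, WithBot.coe_le_coe]
      linarith
    have heq : ∀ (i : E) (c : C), N i c ≠ 0 → (M i.1 c.1).modulus = ((μ i - ξ c.1 : ℝ) : WithBot ℝ) :=
      fun i c h => by
        obtain ⟨r, hr⟩ := hmod i c
        have h1 : val (S i c) = 0 := by
          rw [val, hdom i c h]; exact val_mono_of_ne h
        rw [hSval, hr, ← WithBot.coe_add, ← WithBot.coe_zero, WithBot.coe_inj] at h1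
        rw [hr, WithBot.coe_inj]
        linarith
    exact (hAb p (f.trans (Function.Embedding.subtype _))
      (g.trans (Function.Embedding.subtype _))).eq_of_tight (fun i => μ (f i))
      (fun i => ξ (g i).1) (fun i j => hle _ _) (fun i => heq _ _ (h2 i))
      (τ := 1) (fun i => heq _ _ (h1 i))
  obtain ⟨⟨W, hW⟩, c, hc, hNc⟩ := exists_rightInverse_and_pos_ker N
    (eq_zero_of_vecMul_nonneg N hpos hneg hcyc)
  obtain ⟨z, hSz, hz⟩ := exists_ker_lift S N hN W hW c hNc
  have hzs : ∀ j, sval (z j) = sval (mono 0 (c j)) := fun j => by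
    have h1 := sval_add_of_lt (x := z j - mono 0 (c j)) (y := mono 0 (c j))
      (by rw [val_mono_of_ne (hc j).ne']; exact hz j)
    rwa [sub_add_cancel] at h1
  have hzval : ∀ j, val (z j) = 0 := fun j => by
    rw [val, hzs]; exact val_mono_of_ne (hc j).ne'
  have hzpos : ∀ j, 0 < z j := fun j => by
    have h1 := congrArg SignedTrop.sgn (hzs j)
    rwa [sval_sgn, sval_sgn, sign_pos (mono_pos (hc j)), sign_eq_one_iff] at h1
  let Y : Fin n ⊕ Fin 1 → PuiseuxSeries := fun c =>
    if h : X c ≠ ⊥ then z ⟨c, h⟩ * mono (ξ c) 1 else 0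
  have hYnn : ∀ c, 0 ≤ Y c := fun c => by
    simp only [Y]
    split_ifs
    · exact (mul_pos (hzpos _) (mono_pos one_pos)).le
    · exact le_rfl
  have hYval : ∀ c, val (Y c) = X c := fun c => by
    simp only [Y]
    split_ifs with h
    · rw [val_mul, hzval, zero_add, val_mono_of_ne one_ne_zero, ← hξ c h]
    · rw [val_zero, not_not.1 h]
  have hYker : ∀ i : E, ∑ c, M' i.1 c * Y c = 0 := fun i => by
    have h1 : ∑ c, M' i.1 c * Y c = ∑ c : C, M' i.1 c.1 * Y c.1 := by
      rw [← Finset.sum_subtype (Finset.univ.filter fun c => X c ≠ ⊥) (by simp)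
        fun c => M' i.1 c * Y c]
      refine (Finset.sum_filter_of_ne (p := fun c => X c ≠ ⊥) fun c _ h h0 => h ?_).symm
      have h1 := hYval c
      rw [h0, val_eq_bot] at h1
      rw [h1, mul_zero]
    rw [h1]
    have h2 : ∀ c : C, M' i.1 c.1 * Y c.1 = mono (μ i) 1 * (S i c * z c) := fun c => by
      have h3 : mono (ξ c.1) 1 = mono (μ i) 1 * mono (ξ c.1 - μ i) 1 := by
        rw [mono_mul]; congr 1 <;> ring
      simp only [Y, S]
      rw [dif_pos c.2, h3]
      ring
    rw [Finset.sum_congr rfl fun c _ => h2 c, ← Finset.mul_sum]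
    have h4 := congrFun hSz i
    simp only [Matrix.mulVec, dotProduct, Pi.zero_apply] at h4
    rw [h4, mul_zero]
  -- normalize the last coordinate to `1`
  let y := Y (Sum.inr 0)
  have hy : val y = 0 := hYval _
  have hy0 : y ≠ 0 := fun h => by rw [h, val_zero] at hy; exact WithBot.bot_ne_coe hy
  have hypos : 0 < y := lt_of_le_of_ne (hYnn _) hy0.symm
  refine ⟨fun j => Y (Sum.inl j) / y, fun j => div_nonneg (hYnn _) hypos.le, fun j => ?_,
    fun i hi => ?_⟩
  · have h1 : val (Y (Sum.inl j) / y * y) = x j := by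
      rw [div_mul_cancel₀ _ hy0]; exact hYval _
    rwa [val_mul, hy, add_zero] at h1
  · have h1 := hYker ⟨i, hi⟩
    rw [Fintype.sum_sum_type] at h1
    have h2 : (∑ j, A' i j * Y (Sum.inl j)) + b' i * y = 0 := by
      simpa [M', Matrix.fromCols, y] using h1
    have h3 : A' i ⬝ᵥ (fun j => Y (Sum.inl j) / y) = (∑ j, A' i j * Y (Sum.inl j)) / y := by
      simp only [dotProduct, mul_div_assoc', Finset.sum_div]
    rw [h3, div_add' _ _ _ hy0, h2, zero_div]

end Lifting

/-! ### Minors and reduced costs -/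

section Minors

variable {R : Type*} [CommRing R] {m n p q : ℕ}

theorem orderEmbOfFin_erase {α : Type*} [LinearOrder α] (S : Finset α) (hS : S.card = p + 1)
    (a : Fin (p + 1)) (h : (S.erase (S.orderEmbOfFin hS a)).card = p) (c : Fin p) :
    (S.erase (S.orderEmbOfFin hS a)).orderEmbOfFin h c = S.orderEmbOfFin hS (a.succAbove c) := by
  refine (congrFun (Finset.orderEmbOfFin_unique h
    (f := fun c => S.orderEmbOfFin hS (a.succAbove c)) (fun c => ?_) ?_) c).symm
  · rw [Finset.mem_erase]
    exact ⟨fun h => Fin.succAbove_ne a c ((S.orderEmbOfFin hS).injective h),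
      Finset.orderEmbOfFin_mem _ _ _⟩
  · exact (S.orderEmbOfFin hS).strictMono.comp (Fin.strictMono_succAbove a)

theorem card_filter_le_orderEmbOfFin {α : Type*} [LinearOrder α] (S : Finset α) (hS : S.card = p)
    (a : Fin p) : (S.filter (· ≤ S.orderEmbOfFin hS a)).card = a.val + 1 := by
  have : S.filter (· ≤ S.orderEmbOfFin hS a)
      = (Finset.Iic a).map (S.orderEmbOfFin hS).toEmbedding := by
    ext x
    simp only [Finset.mem_filter, Finset.mem_map, Finset.mem_Iic, RelEmbedding.coe_toEmbedding]
    constructor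
    · rintro ⟨hx, hle⟩
      rw [← Finset.mem_coe, ← Finset.range_orderEmbOfFin S hS] at hx
      obtain ⟨c, rfl⟩ := hx
      exact ⟨c, (S.orderEmbOfFin hS).le_iff_le.1 hle, rfl⟩
    · rintro ⟨c, hc, rfl⟩
      exact ⟨Finset.orderEmbOfFin_mem _ _ _, (S.orderEmbOfFin hS).le_iff_le.2 hc⟩
  rw [this, Finset.card_map, Fin.card_Iic]

theorem exists_orderEmbOfFin_eq {α : Type*} [LinearOrder α] {S : Finset α} (hS : S.card = p)
    {x : α} (hx : x ∈ S) : ∃ a, S.orderEmbOfFin hS a = x := by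
  rw [← Finset.mem_coe, ← Finset.range_orderEmbOfFin S hS] at hx
  exact hx

theorem sum_orderEmbOfFin {α : Type*} [LinearOrder α] (S : Finset α) (hS : S.card = p)
    (F : α → R) : ∑ x ∈ S, F x = ∑ a, F (S.orderEmbOfFin hS a) := by
  conv_lhs => rw [← Finset.map_orderEmbOfFin_univ S hS]
  rw [Finset.sum_map]
  rfl

theorem orderEmbOfFin_insert_last {α : Type*} [LinearOrder α] {S : Finset α} {r : α}
    (hr : ∀ x ∈ S, x < r) (h : (insert r S).card = p + 1) :
    (insert r S).orderEmbOfFin h (Fin.last p) = r := by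
  obtain ⟨a, ha⟩ := exists_orderEmbOfFin_eq h (Finset.mem_insert_self r S)
  have h1 : r ≤ (insert r S).orderEmbOfFin h (Fin.last p) := by
    conv_lhs => rw [← ha]
    exact ((insert r S).orderEmbOfFin h).monotone (Fin.le_last a)
  rcases Finset.mem_insert.1 (Finset.orderEmbOfFin_mem (insert r S) h (Fin.last p)) with h2 | h2
  · exact h2
  · exact absurd h1 (not_le.2 (hr _ h2))

theorem liftRows_card (I : Finset (Fin m)) : (liftRows I).card = I.card := Finset.card_map _

theorem lt_natAdd_of_mem_liftRows {I : Finset (Fin m)} (r : Fin 2) {x : Fin (m + 2)}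
    (hx : x ∈ liftRows I) : x < Fin.natAdd m r := by
  obtain ⟨i, -, rfl⟩ := Finset.mem_map.1 hx
  rw [Fin.lt_def]
  simp only [Fin.val_natAdd]
  exact lt_of_lt_of_le i.2 (Nat.le_add_right _ _)

theorem natAdd_notMem_liftRows (I : Finset (Fin m)) (r : Fin 2) :
    Fin.natAdd m r ∉ liftRows I := fun h => lt_irrefl _ (lt_natAdd_of_mem_liftRows r h)

theorem orderEmbOfFin_liftRows (I : Finset (Fin m)) (h : I.card = p)
    (h' : (liftRows I).card = p) (a : Fin p) :
    (liftRows I).orderEmbOfFin h' a = Fin.castAdd 2 (I.orderEmbOfFin h a) := by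
  refine (congrFun (Finset.orderEmbOfFin_unique h'
    (f := fun a => Fin.castAdd 2 (I.orderEmbOfFin h a)) (fun c => ?_) ?_) a).symm
  · exact Finset.mem_map_of_mem _ (Finset.orderEmbOfFin_mem _ _ _)
  · exact (Fin.strictMono_castAdd 2).comp (I.orderEmbOfFin h).strictMono

/-- The `(K × L)`-minor of a matrix, with rows and columns in increasing order. -/
noncomputable def minor (M : Matrix (Fin p) (Fin q) R) (K : Finset (Fin p)) (L : Finset (Fin q)) :
    R :=
  if h : K.card = L.card then
    (M.submatrix (K.orderEmbOfFin h) (L.orderEmbOfFin rfl)).det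
  else 0

theorem minor_eq (M : Matrix (Fin p) (Fin q) R) {K : Finset (Fin p)} {L : Finset (Fin q)} {k : ℕ}
    (hK : K.card = k) (hL : L.card = k) :
    minor M K L = (M.submatrix (K.orderEmbOfFin hK) (L.orderEmbOfFin hL)).det := by
  subst hL
  rw [minor, dif_pos hK]

/-- The minors whose quotients by the minor of the basis are, up to sign, the reduced costs of the
additional row `r`: these are the values of the polynomials `Q_l` and `R_l`. -/
noncomputable def costMinor (M : Matrix (Fin (m + 2)) (Fin n) R) (B : Finset (Fin m ⊕ Fin n))
    (r : Fin 2) : Fin m ⊕ Fin n → R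
  | Sum.inl i => minor M (insert (Fin.natAdd m r) (liftRows (B.toLeft.erase i))) B.toRightᶜ
  | Sum.inr j => minor M (insert (Fin.natAdd m r) (liftRows B.toLeft)) (insert j B.toRightᶜ)

/-- The minor `I × Jᶜ` of the basis `I ⊎ J`, equal up to sign to the determinant of its rows. -/
noncomputable def basisMinor (M : Matrix (Fin (m + 2)) (Fin n) R) (B : Finset (Fin m ⊕ Fin n)) :
    R :=
  minor M (liftRows B.toLeft) B.toRightᶜ

/-- The exponent of `-1` in the sign relating reduced costs and minors. Unlike `costSign`, it gives
this sign in any commutative ring. -/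
def costExp (B : Finset (Fin m ⊕ Fin n)) : Fin m ⊕ Fin n → ℕ
  | Sum.inl i => B.toLeft.card + (B.toLeft.filter (· ≤ i)).card
  | Sum.inr j => B.toLeft.card + 1 + ((insert j B.toRightᶜ).filter (· ≤ j)).card

theorem costSign_eq (B : Finset (Fin m ⊕ Fin n)) (l : Fin m ⊕ Fin n) :
    costSign B l = (-1) ^ costExp B l := by
  cases l <;> rfl

theorem card_toRight_compl {B : Finset (Fin m ⊕ Fin n)} (hB : B.card = n) :
    (B.toRightᶜ).card = B.toLeft.card := by
  have h1 := Finset.card_toLeft_add_card_toRight (u := B)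
  rw [Finset.card_compl, Fintype.card_fin]
  omega

theorem sum_sumType {α β : Type*} (B : Finset (α ⊕ β)) (F : α ⊕ β → R) :
    ∑ l ∈ B, F l = ∑ i ∈ B.toLeft, F (Sum.inl i) + ∑ j ∈ B.toRight, F (Sum.inr j) := by
  conv_lhs => rw [← Finset.toLeft_disjSum_toRight (u := B)]
  rw [Finset.sum_disjSum]

/-- Replacing a row of a submatrix, or removing it and inserting the new row at another place,
gives the same determinant up to sign. -/
theorem det_updateRow_submatrix {ρ κ : Type*} (M : Matrix ρ κ R) (f f' : Fin (p + 1) → ρ)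
    (g : Fin (p + 1) → κ) (a a' : Fin (p + 1))
    (h : ∀ c, f (a.succAbove c) = f' (a'.succAbove c)) :
    ((M.submatrix f g).updateRow a fun c => M (f' a') (g c)).det
      = (-1) ^ (a.val + a'.val) * (M.submatrix f' g).det := by
  rw [Matrix.det_succ_row _ a, Matrix.det_succ_row (M.submatrix f' g) a', Finset.mul_sum]
  refine Finset.sum_congr rfl fun c _ => ?_
  have h1 : ((M.submatrix f g).updateRow a fun c => M (f' a') (g c)).submatrix a.succAbove
      c.succAbove = (M.submatrix f' g).submatrix a'.succAbove c.succAbove := by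
    ext i j
    simp [h]
  rw [h1, Matrix.updateRow_self, Matrix.submatrix_apply]
  have h2 : ((-1 : R) ^ (a.val + a'.val)) * (-1) ^ (a'.val + c.val) = (-1) ^ (a.val + c.val) := by
    rw [← pow_add, show a.val + a'.val + (a'.val + c.val) = (a.val + c.val) + 2 * a'.val by ring,
      pow_add, pow_mul]
    simp
  rw [← h2]
  ring

/-- Cramer's rule for reduced costs: if the rows of the basis `B` of the matrix consisting of the
first rows of `M` and of the identity, combined with coefficients `y`, give `d` times one of the
last two rows of `M`, then `y` is proportional to the signed minors. -/
theorem basisMinor_mul (M : Matrix (Fin (m + 2)) (Fin n) R) {B : Finset (Fin m ⊕ Fin n)}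
    (hB : B.card = n) (r : Fin 2) (y : Fin m ⊕ Fin n → R) (d : R)
    (hy : ∀ j, ∑ l ∈ B, Sum.elim (fun i => M (Fin.castAdd 2 i)) (1 : Matrix (Fin n) (Fin n) R) l j
      * y l = d * M (Fin.natAdd m r) j) {l : Fin m ⊕ Fin n} (hl : l ∈ B) :
    basisMinor M B * y l = d * ((-1) ^ costExp B l * costMinor M B r l) := by
  have hJ := card_toRight_compl hB
  set I := B.toLeft with hI
  set L := B.toRightᶜ with hL
  have hsum : ∀ c ∈ L, ∑ i ∈ I, y (Sum.inl i) * M (Fin.castAdd 2 i) c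
      = d * M (Fin.natAdd m r) c := fun c hc => by
    rw [← hy c, sum_sumType]
    have h1 : ∑ j ∈ B.toRight, Sum.elim (fun i => M (Fin.castAdd 2 i))
        (1 : Matrix (Fin n) (Fin n) R) (Sum.inr j) c * y (Sum.inr j) = 0 := by
      refine Finset.sum_eq_zero fun j hj => ?_
      have : j ≠ c := by rintro rfl; exact Finset.mem_compl.1 hc hj
      change (1 : Matrix (Fin n) (Fin n) R) j c * _ = 0
      rw [Matrix.one_apply_ne this, zero_mul]
    rw [h1, add_zero]
    exact Finset.sum_congr rfl fun i _ => mul_comm _ _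
  rcases l with i | j
  -- in the minor of the basis, replace the row `i` by `d` times the additional row
  · have hi : i ∈ I := Finset.mem_toLeft.2 hl
    obtain ⟨p, hp⟩ : ∃ p, I.card = p + 1 :=
      Nat.exists_eq_succ_of_ne_zero (Finset.card_ne_zero_of_mem hi)
    obtain ⟨a, rfl⟩ := exists_orderEmbOfFin_eq hp hi
    set i := I.orderEmbOfFin hp a
    have hEcard : (I.erase i).card = p := by rw [Finset.card_erase_of_mem hi, hp]; rfl
    have hE' : (liftRows (I.erase i)).card = p := by rw [liftRows_card, hEcard]
    let K := insert (Fin.natAdd m r) (liftRows (I.erase i))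
    have hK : K.card = p + 1 := by
      rw [Finset.card_insert_of_notMem (natAdd_notMem_liftRows _ _), hE']
    have hlast : K.orderEmbOfFin hK (Fin.last p) = Fin.natAdd m r :=
      orderEmbOfFin_insert_last (fun x hx => lt_natAdd_of_mem_liftRows r hx) hK
    have hKe : K.erase (Fin.natAdd m r) = liftRows (I.erase i) :=
      Finset.erase_insert (natAdd_notMem_liftRows _ _)
    have hsucc : ∀ c, Fin.castAdd 2 (I.orderEmbOfFin hp (a.succAbove c))
        = K.orderEmbOfFin hK ((Fin.last p).succAbove c) := fun c => by
      rw [← orderEmbOfFin_erase K hK (Fin.last p) (by rw [hlast, hKe, hE']),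
        ← orderEmbOfFin_erase I hp a hEcard]
      simp only [hlast, hKe]
      rw [orderEmbOfFin_liftRows _ hEcard]
    have hdet := det_updateRow_submatrix M (fun a => Fin.castAdd 2 (I.orderEmbOfFin hp a))
      (K.orderEmbOfFin hK) (L.orderEmbOfFin (hJ.trans hp)) a (Fin.last p) hsucc
    rw [hlast, ← minor_eq M hK (hJ.trans hp)] at hdet
    set N := M.submatrix (fun a => Fin.castAdd 2 (I.orderEmbOfFin hp a))
      (L.orderEmbOfFin (hJ.trans hp)) with hN
    have hP : basisMinor M B = N.det := by
      rw [basisMinor, minor_eq M (by rw [liftRows_card, hp]) (hJ.trans hp)]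
      congr 1
      ext b c
      simp only [hN, Matrix.submatrix_apply]
      rw [orderEmbOfFin_liftRows _ hp]
    have hrow : (fun c => d * M (Fin.natAdd m r) (L.orderEmbOfFin (hJ.trans hp) c))
        = ∑ b, y (Sum.inl (I.orderEmbOfFin hp b)) • N b := by
      ext c
      rw [← hsum _ (Finset.orderEmbOfFin_mem _ _ _), sum_orderEmbOfFin I hp, Finset.sum_apply]
      rfl
    have h1 := Matrix.det_updateRow_sum N a fun b => y (Sum.inl (I.orderEmbOfFin hp b))
    rw [← hrow] at h1
    have h2 := Matrix.det_updateRow_smul N a d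
      fun c => M (Fin.natAdd m r) (L.orderEmbOfFin (hJ.trans hp) c)
    have h3 : (d • fun c => M (Fin.natAdd m r) (L.orderEmbOfFin (hJ.trans hp) c))
      = fun c => d * M (Fin.natAdd m r) (L.orderEmbOfFin (hJ.trans hp) c) := rfl
    rw [h3, h1, hdet, smul_eq_mul] at h2
    have hexp : ((-1 : R)) ^ costExp B (Sum.inl i) = (-1) ^ (a.val + (Fin.last p).val) := by
      have h4 : (B.toLeft.filter (· ≤ i)).card = a.val + 1 :=
        card_filter_le_orderEmbOfFin I hp a
      simp only [costExp]
      rw [h4, ← hI, hp, Fin.val_last, show p + 1 + (a.val + 1) = a.val + p + 2 by ring, pow_add]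
      simp
    rw [hP, mul_comm, h2, hexp]
    rfl
  -- in the minor with the additional row and the column `j`, subtract from the additional row the
  -- combination of the rows of `I`, which leaves a multiple of the `j`-th unit row
  · have hj : j ∈ B.toRight := Finset.mem_toRight.2 hl
    have hjL : j ∉ L := fun h => Finset.mem_compl.1 h hj
    let p := I.card
    have hp : I.card = p := rfl
    have hI' : (liftRows I).card = p := liftRows_card I
    let K := insert (Fin.natAdd m r) (liftRows I)
    have hK : K.card = p + 1 := by
      rw [Finset.card_insert_of_notMem (natAdd_notMem_liftRows _ _), hI']
    let L' := insert j L
    have hL' : L'.card = p + 1 := by rw [Finset.card_insert_of_notMem hjL, hJ]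
    obtain ⟨a, ha⟩ := exists_orderEmbOfFin_eq hL' (Finset.mem_insert_self j L)
    have hL'e : L'.erase j = L := Finset.erase_insert hjL
    have hlast : K.orderEmbOfFin hK (Fin.last p) = Fin.natAdd m r :=
      orderEmbOfFin_insert_last (fun x hx => lt_natAdd_of_mem_liftRows r hx) hK
    have hKe : K.erase (Fin.natAdd m r) = liftRows I :=
      Finset.erase_insert (natAdd_notMem_liftRows _ _)
    have hKs : ∀ c, K.orderEmbOfFin hK ((Fin.last p).succAbove c)
        = Fin.castAdd 2 (I.orderEmbOfFin hp c) := fun c => by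
      rw [← orderEmbOfFin_erase K hK (Fin.last p) (by rw [hlast, hKe, hI'])]
      simp only [hlast, hKe]
      rw [orderEmbOfFin_liftRows _ hp]
    have hLs : ∀ c, L'.orderEmbOfFin hL' (a.succAbove c) = L.orderEmbOfFin hJ c := fun c => by
      rw [← orderEmbOfFin_erase L' hL' a (by rw [ha, hL'e, hJ])]
      simp only [ha, hL'e]
    set N := M.submatrix (K.orderEmbOfFin hK) (L'.orderEmbOfFin hL') with hN
    let w : Fin (p + 1) → R := Pi.single a (y (Sum.inr j))
    let co : Fin (p + 1) → R := (Fin.last p).insertNth 0 fun b =>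
      y (Sum.inl (I.orderEmbOfFin hp b))
    have hrow : (d • N (Fin.last p)) = w + ∑ b, co b • N b := by
      ext c
      have h1 : (∑ b, co b • N b) c
          = ∑ i ∈ I, y (Sum.inl i) * M (Fin.castAdd 2 i) (L'.orderEmbOfFin hL' c) := by
        rw [Finset.sum_apply, Fin.sum_univ_succAbove _ (Fin.last p), sum_orderEmbOfFin I hp]
        simp only [co, Fin.insertNth_apply_same, Fin.insertNth_apply_succAbove, Pi.smul_apply,
          smul_eq_mul, zero_mul, zero_add, hN, Matrix.submatrix_apply, hKs]
      rw [Pi.add_apply, h1]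
      simp only [Pi.smul_apply, smul_eq_mul, hN, Matrix.submatrix_apply, hlast]
      rcases Fin.eq_self_or_eq_succAbove a c with rfl | ⟨c', rfl⟩
      · simp only [w, Pi.single_eq_same]
        rw [ha, ← hy j, sum_sumType, add_comm]
        congr 1
        · rw [Finset.sum_eq_single_of_mem j hj]
          · change (1 : Matrix (Fin n) (Fin n) R) j j * _ = _
            rw [Matrix.one_apply_eq, one_mul]
          · intro b _ hb
            change (1 : Matrix (Fin n) (Fin n) R) b j * _ = 0
            rw [Matrix.one_apply_ne hb, zero_mul]
        · exact Finset.sum_congr rfl fun i _ => mul_comm _ _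
      · rw [hLs, hsum _ (Finset.orderEmbOfFin_mem _ _ _)]
        simp [w]
    have h1 : (N.updateRow (Fin.last p) (d • N (Fin.last p))).det = d * N.det := by
      rw [Matrix.det_updateRow_smul, Matrix.updateRow_eq_self]
    rw [hrow, Matrix.det_updateRow_add, Matrix.det_updateRow_sum] at h1
    have h2 : co (Fin.last p) = 0 := Fin.insertNth_apply_same _ _ _
    rw [h2, zero_smul, add_zero, Matrix.det_succ_row _ (Fin.last p),
      Finset.sum_eq_single_of_mem a (Finset.mem_univ a)] at h1
    swap
    · intro c _ hc
      simp [w, Pi.single_eq_of_ne hc]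
    have h3 : ((N.updateRow (Fin.last p) w).submatrix (Fin.last p).succAbove a.succAbove).det
        = basisMinor M B := by
      rw [basisMinor, minor_eq M hI' hJ]
      congr 1
      ext b c
      rw [Matrix.submatrix_apply, Matrix.updateRow_ne (Fin.succAbove_ne _ _), hN,
        Matrix.submatrix_apply, Matrix.submatrix_apply, hKs, hLs, orderEmbOfFin_liftRows _ hp]
    rw [h3, Matrix.updateRow_self] at h1
    have h4 : costMinor M B r (Sum.inr j) = N.det := minor_eq M hK hL'
    have h6 : costExp B (Sum.inr j) = p + 1 + (a.val + 1) := by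
      have h5 := card_filter_le_orderEmbOfFin L' hL' a
      rw [ha] at h5
      rw [← h5]
      rfl
    have h7 : ((-1 : R)) ^ (p + 1 + (a.val + 1)) = (-1) ^ (p + a.val) := by
      rw [show p + 1 + (a.val + 1) = p + a.val + 2 by ring, pow_add]; simp
    have h8 : ((-1 : R)) ^ (p + a.val) * (-1) ^ (p + a.val) = 1 := by
      rw [← mul_pow]; simp
    rw [h4, h6, h7, mul_left_comm, ← h1]
    simp only [w, Pi.single_eq_same, Fin.val_last]
    rw [← mul_assoc, ← mul_assoc, h8, one_mul, mul_comm]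

theorem det_submatrix_equiv_equiv {α β : Type*} [Fintype α] [Fintype β] [DecidableEq α]
    [DecidableEq β] (e₁ e₂ : α ≃ β) (C : Matrix β β R) :
    (C.submatrix e₁ e₂).det = C.det ∨ (C.submatrix e₁ e₂).det = -C.det := by
  have h1 : C.submatrix e₁ e₂ = (C.submatrix (e₂.symm.trans e₁) id).submatrix e₂ e₂ := by
    ext i j; simp
  have h2 : (C.submatrix (e₂.symm.trans e₁) id).det
      = ((Equiv.Perm.sign (e₂.symm.trans e₁) : ℤ) : R) * C.det := Matrix.det_permute _ _
  rw [h1, Matrix.det_submatrix_equiv_self, h2]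
  rcases Int.units_eq_one_or (Equiv.Perm.sign (e₂.symm.trans e₁)) with h | h <;> rw [h] <;> simp

/-- The determinant of a square matrix made of rows of `M` and of rows of the identity is, up to
sign, a minor of `M`. -/
theorem det_rows_eq_minor (M : Matrix (Fin p) (Fin n) R) (ρ : Fin n → Fin p ⊕ Fin n)
    (hρ : Function.Injective ρ) :
    (Finset.univ.image ρ).toLeft.card = ((Finset.univ.image ρ).toRightᶜ).card ∧
    let μ := minor M (Finset.univ.image ρ).toLeft (Finset.univ.image ρ).toRightᶜ
    let D := (Matrix.of fun a => Sum.elim M (1 : Matrix (Fin n) (Fin n) R) (ρ a)).det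
    D = μ ∨ D = -μ := by
  set B := Finset.univ.image ρ with hB
  have hBn : B.card = n := by rw [hB, Finset.card_image_of_injective _ hρ]; simp
  have hcard := card_toRight_compl hBn
  refine ⟨hcard.symm, ?_⟩
  intro μ D
  set L := B.toRightᶜ with hL
  let k := B.toLeft.card
  have hk : B.toLeft.card = k := rfl
  let S := {j // j ∈ B.toRight}
  have hS : Fintype.card (Fin k ⊕ S) = Fintype.card (Fin n) := by
    have := Finset.card_toLeft_add_card_toRight (u := B)
    rw [Fintype.card_sum, Fintype.card_fin, Fintype.card_fin, Fintype.card_coe]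
    omega
  have hex : ∀ s : Fin k ⊕ S, ∃ a, ρ a = Sum.map (B.toLeft.orderEmbOfFin hk) Subtype.val s := by
    intro s
    have : Sum.map (B.toLeft.orderEmbOfFin hk) Subtype.val s ∈ B := by
      rcases s with b | j
      · exact Finset.mem_toLeft.1 (Finset.orderEmbOfFin_mem B.toLeft hk b)
      · exact Finset.mem_toRight.1 j.2
    obtain ⟨a, -, ha⟩ := Finset.mem_image.1 this
    exact ⟨a, ha⟩
  choose f hf using hex
  have hfi : Function.Injective f := fun s s' h => by
    have h1 := hf s
    rw [h, hf s'] at h1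
    exact (Function.Injective.sumMap (B.toLeft.orderEmbOfFin hk).injective
      Subtype.val_injective h1).symm
  let e₁ : Fin k ⊕ S ≃ Fin n :=
    Equiv.ofBijective f ((Fintype.bijective_iff_injective_and_card f).2 ⟨hfi, hS⟩)
  let g : Fin k ⊕ S → Fin n := Sum.elim (L.orderEmbOfFin hcard) Subtype.val
  have hne : ∀ b, ∀ j : S, L.orderEmbOfFin hcard b ≠ j.1 := fun b j h =>
    Finset.mem_compl.1 (Finset.orderEmbOfFin_mem L hcard b) (h ▸ j.2)
  have hgi : Function.Injective g :=
    Function.Injective.sumElim (L.orderEmbOfFin hcard).injective Subtype.val_injective hne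
  let e₂ : Fin k ⊕ S ≃ Fin n :=
    Equiv.ofBijective g ((Fintype.bijective_iff_injective_and_card g).2 ⟨hgi, hS⟩)
  set C : Matrix (Fin n) (Fin n) R :=
    Matrix.of fun a => Sum.elim M (1 : Matrix (Fin n) (Fin n) R) (ρ a) with hC
  -- with the columns of `Jᶜ` first, the rows of the identity make the matrix block triangular
  have hblocks : C.submatrix e₁ e₂ = Matrix.fromBlocks
      (M.submatrix (B.toLeft.orderEmbOfFin hk) (L.orderEmbOfFin hcard))
      (M.submatrix (B.toLeft.orderEmbOfFin hk) Subtype.val) 0 1 := by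
    have he₁ : ∀ s, ρ (e₁ s) = Sum.map (B.toLeft.orderEmbOfFin hk) Subtype.val s := hf
    ext s t
    simp only [Matrix.submatrix_apply, hC, Matrix.of_apply, he₁]
    rcases s with b | j <;> rcases t with b' | j'
    · rfl
    · rfl
    · have h1 : e₂ (Sum.inl b') = L.orderEmbOfFin hcard b' := rfl
      change (1 : Matrix (Fin n) (Fin n) R) j.1 (e₂ (Sum.inl b')) = 0
      rw [h1, Matrix.one_apply_ne (hne b' j).symm]
    · have h1 : e₂ (Sum.inr j') = j'.1 := rfl
      change (1 : Matrix (Fin n) (Fin n) R) j.1 (e₂ (Sum.inr j')) = (1 : Matrix S S R) j j'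
      rw [h1, Matrix.one_apply, Matrix.one_apply]
      exact if_congr Subtype.ext_iff.symm rfl rfl
  have hdet : (C.submatrix e₁ e₂).det = μ := by
    rw [hblocks, Matrix.det_fromBlocks_zero₂₁, Matrix.det_one, mul_one]
    exact (minor_eq M hk hcard).symm
  rcases det_submatrix_equiv_equiv e₁ e₂ C with h | h
  · left; rw [← hdet, h]
  · right; rw [← hdet, h, neg_neg]

/-- Replacing two rows of a square matrix by combinations of its rows multiplies the determinant by
a minor of order two of the coefficients. -/
theorem det_updateRow_updateRow_vecMul {ι : Type*} [Fintype ι] [DecidableEq ι] (C : Matrix ι ι R)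
    {k l : ι} (hkl : k ≠ l) (y z : ι → R) :
    ((C.updateRow k (y ᵥ* C)).updateRow l (z ᵥ* C)).det = (y k * z l - y l * z k) * C.det := by
  have hone : ∀ (k : ι) (y : ι → R), ((1 : Matrix ι ι R).updateRow k y).det = y k := by
    intro k y
    have h1 := Matrix.det_updateRow_sum (1 : Matrix ι ι R) k y
    have h2 : ∑ i, y i • (1 : Matrix ι ι R) i = y := by
      ext j
      simp [Finset.sum_apply, Matrix.one_apply]
    rw [h2] at h1
    simpa using h1
  have hW : ((1 : Matrix ι ι R).updateRow k y |>.updateRow l z).det = y k * z l - y l * z k := by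
    have h1 : z = ∑ j, z j • (Pi.single j 1 : ι → R) := by
      ext i
      simp [Finset.sum_apply, Pi.single_apply]
    have h2 : ((1 : Matrix ι ι R).updateRow k y |>.updateRow l z).det
        = ∑ j, z j * ((1 : Matrix ι ι R).updateRow k y |>.updateRow l (Pi.single j 1)).det := by
      have h3 := (Matrix.detRowAlternating (R := R) (n := ι)).toMultilinearMap.map_update_sum
        (t := Finset.univ) (i := l) (g := fun j => z j • (Pi.single j 1 : ι → R))
        (m := (1 : Matrix ι ι R).updateRow k y)
      rw [← h1] at h3
      refine h3.trans (Finset.sum_congr rfl fun j _ => ?_)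
      exact Matrix.det_updateRow_smul _ _ _ _
    have hself : ∀ j : ι, (1 : Matrix ι ι R) j = Pi.single j 1 := fun j => by
      ext i; simp [Matrix.one_apply, Pi.single_apply, eq_comm]
    rw [h2, Finset.sum_eq_add_of_mem l k (Finset.mem_univ _) (Finset.mem_univ _) hkl.symm]
    · have h4 : ((1 : Matrix ι ι R).updateRow k y |>.updateRow l (Pi.single l 1))
          = (1 : Matrix ι ι R).updateRow k y := by
        conv_rhs => rw [← Matrix.updateRow_eq_self ((1 : Matrix ι ι R).updateRow k y) l]
        rw [Matrix.updateRow_ne hkl.symm, hself]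
      have h5 : ((1 : Matrix ι ι R).updateRow k y |>.updateRow l (Pi.single k 1))
          = ((1 : Matrix ι ι R).updateRow l y).submatrix (Equiv.swap k l) id := by
        ext i j
        rw [Matrix.submatrix_apply]
        by_cases hil : i = l
        · subst hil
          rw [Matrix.updateRow_self, Equiv.swap_apply_right, Matrix.updateRow_ne hkl, hself]
          rfl
        · rw [Matrix.updateRow_ne hil]
          by_cases hik : i = k
          · subst hik
            rw [Matrix.updateRow_self, Equiv.swap_apply_left, Matrix.updateRow_self]
            rfl
          · rw [Matrix.updateRow_ne hik, Equiv.swap_apply_of_ne_of_ne hik hil,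
              Matrix.updateRow_ne hil]
            rfl
      rw [h4, hone, h5, Matrix.det_permute, Equiv.Perm.sign_swap hkl, hone]
      simp
      ring
    · intro j _ hj
      have h6 : ((1 : Matrix ι ι R).updateRow k y |>.updateRow l (Pi.single j 1)).det = 0 := by
        refine Matrix.det_zero_of_row_eq hj.1 ?_
        rw [Matrix.updateRow_self, Matrix.updateRow_ne hj.1, Matrix.updateRow_ne hj.2, hself]
      rw [h6, mul_zero]
  have h7 : ((C.updateRow k (y ᵥ* C)).updateRow l (z ᵥ* C))
      = ((1 : Matrix ι ι R).updateRow k y |>.updateRow l z) * C := by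
    rw [Matrix.updateRow_mul, Matrix.updateRow_mul, Matrix.one_mul]
  rw [h7, Matrix.det_mul, hW]

end Minors

/-! ### A Plücker relation for the comparison of ratios -/

section Pluecker

variable {R : Type*} [CommRing R] [IsDomain R] {m n : ℕ}

/-- The rows of a basis, as rows of the matrix with two additional rows. -/
def liftConstraint : Fin m ⊕ Fin n → Fin (m + 2) ⊕ Fin n :=
  Sum.map (Fin.castAdd 2) id

theorem liftConstraint_injective :
    Function.Injective (liftConstraint : Fin m ⊕ Fin n → Fin (m + 2) ⊕ Fin n) :=
  Function.Injective.sumMap (Fin.castAdd_injective m 2) Function.injective_id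

theorem liftConstraint_ne (l : Fin m ⊕ Fin n) (r : Fin 2) :
    liftConstraint l ≠ Sum.inl (Fin.natAdd m r) := by
  rcases l with i | j
  · intro h
    have h1 : Fin.castAdd 2 i = Fin.natAdd m r := Sum.inl_injective h
    have h2 := congrArg Fin.val h1
    simp only [Fin.val_castAdd, Fin.val_natAdd] at h2
    omega
  · intro h; cases h

theorem injective_update {α β : Type*} [DecidableEq α] {f : α → β} (hf : Function.Injective f)
    {a : α} {b : β} (hb : b ∉ Set.range f) : Function.Injective (Function.update f a b) := by
  intro x y h
  by_cases hx : x = a <;> by_cases hy : y = a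
  · rw [hx, hy]
  · rw [hx, Function.update_self, Function.update_of_ne hy] at h
    exact absurd ⟨y, h.symm⟩ hb
  · rw [hy, Function.update_self, Function.update_of_ne hx] at h
    exact absurd ⟨x, h⟩ hb
  · rw [Function.update_of_ne hx, Function.update_of_ne hy] at h
    exact hf h

/-- Three-term Plücker relation: the difference of products of minors whose sign compares the
ratios of reduced costs is, up to sign, the product of the minor of the basis by the minor obtained
by exchanging the two elements of the basis for the two additional rows. -/
theorem costMinor_sub_eq (M : Matrix (Fin (m + 2)) (Fin n) R) {B : Finset (Fin m ⊕ Fin n)}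
    (hB : B.card = n) (hP : basisMinor M B ≠ 0) {k l : Fin m ⊕ Fin n} (hk : k ∈ B) (hl : l ∈ B)
    (hkl : k ≠ l) :
    ∃ (K : Finset (Fin (m + 2))) (L : Finset (Fin n)), K.card = L.card ∧
      (∀ a ∈ K, (∃ i, Sum.inl i ∈ B ∧ a = Fin.castAdd 2 i) ∨ ∃ r, a = Fin.natAdd m r) ∧
      let T := costMinor M B 0 k * costMinor M B 1 l - costMinor M B 0 l * costMinor M B 1 k
      (T = basisMinor M B * minor M K L ∨ T = -(basisMinor M B * minor M K L)) := by
  classical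
  let e := B.equivFinOfCardEq hB
  let ρ : Fin n → Fin (m + 2) ⊕ Fin n := fun a => liftConstraint (e.symm a).1
  have hρ : Function.Injective ρ := fun a b h =>
    e.symm.injective (Subtype.ext (liftConstraint_injective h))
  let C : Matrix (Fin n) (Fin n) R := Matrix.of fun a => Sum.elim M (1 : Matrix (Fin n) (Fin n) R)
    (ρ a)
  let k' := e ⟨k, hk⟩
  let l' := e ⟨l, hl⟩
  have hkl' : k' ≠ l' := fun h => hkl (congrArg Subtype.val (e.injective h))
  let u : Fin 2 → Fin n → R := fun r => M (Fin.natAdd m r)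
  let d := C.det
  -- the coordinates of the additional rows in the basis, multiplied by its determinant `d`
  let Y : Fin 2 → Fin n → R := fun r => u r ᵥ* C.adjugate
  have hY : ∀ r, Y r ᵥ* C = d • u r := fun r => by
    simp only [Y, Matrix.vecMul_vecMul, Matrix.adjugate_mul]
    rw [Matrix.vecMul_smul, Matrix.vecMul_one]
  -- Cramer's rule for the two cost vectors
  have hcost : ∀ r, ∀ a : B, basisMinor M B * Y r (e a)
      = d * ((-1) ^ costExp B a.1 * costMinor M B r a.1) := by
    intro r a
    let y : Fin m ⊕ Fin n → R := fun l => if h : l ∈ B then Y r (e ⟨l, h⟩) else 0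
    have hy : ∀ b : B, y b.1 = Y r (e b) := fun b => by simp only [y]; rw [dif_pos b.2]
    have h1 : ∀ j, ∑ l ∈ B, Sum.elim (fun i => M (Fin.castAdd 2 i))
        (1 : Matrix (Fin n) (Fin n) R) l j * y l = d * M (Fin.natAdd m r) j := by
      intro j
      have h2 : d * M (Fin.natAdd m r) j = ∑ a, Y r a * C a j := (congrFun (hY r) j).symm
      rw [h2, ← Finset.sum_coe_sort B, ← Equiv.sum_comp e]
      refine Finset.sum_congr rfl fun b _ => ?_
      rw [hy, mul_comm]
      congr 1
      have h3 : C (e b) = Sum.elim M (1 : Matrix (Fin n) (Fin n) R) (liftConstraint b.1) := by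
        change Sum.elim M (1 : Matrix (Fin n) (Fin n) R) (liftConstraint (e.symm (e b)).1) = _
        rw [Equiv.symm_apply_apply]
      rw [h3]
      rcases b.1 with i | j <;> rfl
    rw [← hy a]
    exact basisMinor_mul M hB r y d h1 a.2
  let D := ((C.updateRow k' (u 0)).updateRow l' (u 1)).det
  have hD : d * d * D = (Y 0 k' * Y 1 l' - Y 0 l' * Y 1 k') * d := by
    have h1 := det_updateRow_updateRow_vecMul C hkl' (Y 0) (Y 1)
    rw [hY, hY, Matrix.det_updateRow_smul, Matrix.updateRow_comm _ hkl',
      Matrix.det_updateRow_smul, Matrix.updateRow_comm _ hkl'.symm] at h1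
    rw [mul_assoc]
    exact h1
  have hdP : d = basisMinor M B ∨ d = -basisMinor M B := by
    have h1 := (det_rows_eq_minor M ρ hρ).2
    have h2 : (Finset.univ.image ρ).toLeft = liftRows B.toLeft := by
      ext x
      simp only [Finset.mem_toLeft, Finset.mem_image, Finset.mem_univ, true_and, liftRows,
        Finset.mem_map]
      constructor
      · rintro ⟨a, ha⟩
        rcases h3 : (e.symm a) with ⟨i | j, hb⟩
        · simp only [ρ, h3] at ha
          exact ⟨i, hb, Sum.inl_injective ha⟩
        · simp only [ρ, h3] at ha
          cases ha
      · rintro ⟨i, hi, rfl⟩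
        refine ⟨e ⟨Sum.inl i, hi⟩, ?_⟩
        simp only [ρ, Equiv.symm_apply_apply]
        rfl
    have h3 : (Finset.univ.image ρ).toRight = B.toRight := by
      ext x
      simp only [Finset.mem_toRight, Finset.mem_image, Finset.mem_univ, true_and]
      constructor
      · rintro ⟨a, ha⟩
        rcases h3 : (e.symm a) with ⟨i | j, hb⟩
        · simp only [ρ, h3] at ha
          cases ha
        · simp only [ρ, h3] at ha
          obtain rfl : j = x := Sum.inr_injective ha
          exact hb
      · intro hx
        refine ⟨e ⟨Sum.inr x, hx⟩, ?_⟩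
        simp only [ρ, Equiv.symm_apply_apply]
        rfl
    rw [h2, h3] at h1
    exact h1
  let ρ' : Fin n → Fin (m + 2) ⊕ Fin n :=
    Function.update (Function.update ρ k' (Sum.inl (Fin.natAdd m 0))) l' (Sum.inl (Fin.natAdd m 1))
  have h01 : (Sum.inl (Fin.natAdd m 0) : Fin (m + 2) ⊕ Fin n) ≠ Sum.inl (Fin.natAdd m 1) :=
    fun h => by
      have h2 := congrArg Fin.val (Sum.inl_injective h)
      simp at h2
  have hρ' : Function.Injective ρ' := by
    refine injective_update ?_ ?_
    · refine injective_update hρ ?_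
      rintro ⟨a, ha⟩
      exact liftConstraint_ne _ _ ha
    · rintro ⟨a, ha⟩
      by_cases hak : a = k'
      · subst hak
        rw [Function.update_self] at ha
        exact h01 ha
      · rw [Function.update_of_ne hak] at ha
        exact liftConstraint_ne _ _ ha
  obtain ⟨hcard, hmin⟩ := det_rows_eq_minor M ρ' hρ'
  have hD' : (Matrix.of fun a => Sum.elim M (1 : Matrix (Fin n) (Fin n) R) (ρ' a)).det = D := by
    congr 1
    ext a j
    simp only [Matrix.of_apply, ρ']
    by_cases hal : a = l'
    · subst hal
      rw [Function.update_self, Matrix.updateRow_self]; rfl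
    · rw [Function.update_of_ne hal, Matrix.updateRow_ne hal]
      by_cases hak : a = k'
      · subst hak
        rw [Function.update_self, Matrix.updateRow_self]; rfl
      · rw [Function.update_of_ne hak, Matrix.updateRow_ne hak]; rfl
  refine ⟨_, _, hcard, ?_, ?_⟩
  · intro a ha
    rw [Finset.mem_toLeft, Finset.mem_image] at ha
    obtain ⟨b, -, hb⟩ := ha
    by_cases hbl : b = l'
    · subst hbl
      simp only [ρ', Function.update_self] at hb
      exact Or.inr ⟨1, (Sum.inl_injective hb).symm⟩
    · by_cases hbk : b = k'
      · subst hbk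
        simp only [ρ', Function.update_of_ne hbl, Function.update_self] at hb
        exact Or.inr ⟨0, (Sum.inl_injective hb).symm⟩
      · simp only [ρ', Function.update_of_ne hbl, Function.update_of_ne hbk] at hb
        rcases h3 : (e.symm b) with ⟨i | j, hi⟩
        · simp only [ρ, h3] at hb
          exact Or.inl ⟨i, hi, (Sum.inl_injective hb).symm⟩
        · simp only [ρ, h3] at hb
          cases hb
  · intro T
    set P := basisMinor M B with hPdef
    set μ := minor M (Finset.univ.image ρ').toLeft (Finset.univ.image ρ').toRightᶜ
    have hd0 : d ≠ 0 := by rcases hdP with h | h <;> rw [h] <;> simpa using hP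
    have hk0 := hcost 0 ⟨k, hk⟩
    have hk1 := hcost 1 ⟨k, hk⟩
    have hl0 := hcost 0 ⟨l, hl⟩
    have hl1 := hcost 1 ⟨l, hl⟩
    have hT : P * P * (Y 0 k' * Y 1 l' - Y 0 l' * Y 1 k')
        = d * d * ((-1) ^ costExp B k * (-1) ^ costExp B l) * T := by
      have h1 : P * P * (Y 0 k' * Y 1 l' - Y 0 l' * Y 1 k')
          = (P * Y 0 k') * (P * Y 1 l') - (P * Y 0 l') * (P * Y 1 k') := by ring
      rw [h1, hk0, hk1, hl0, hl1]
      simp only [T]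
      ring
    have hs : ∀ N : ℕ, ((-1 : R)) ^ N = 1 ∨ ((-1 : R)) ^ N = -1 := neg_one_pow_eq_or R
    have hsq : P * P = d * d := by rcases hdP with h | h <;> rw [h]; ring
    have h2 : P * P * (d * d * D) = P * P * (((-1) ^ costExp B k * (-1) ^ costExp B l) * T * d) := by
      rw [hD]
      calc _ = P * P * (Y 0 k' * Y 1 l' - Y 0 l' * Y 1 k') * d := by ring
        _ = _ := by rw [hT, hsq]; ring
    have h3 := mul_left_cancel₀ (mul_ne_zero hP hP) h2
    have h4 : d * D = ((-1) ^ costExp B k * (-1) ^ costExp B l) * T := by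
      apply mul_left_cancel₀ hd0
      rw [← mul_assoc, h3]; ring
    have h5 : T = ((-1) ^ costExp B k * (-1) ^ costExp B l) * (d * D) := by
      rw [h4]
      rcases hs (costExp B k) with h | h <;> rcases hs (costExp B l) with h' | h' <;>
        rw [h, h'] <;> ring
    rw [hD'] at hmin
    rw [h5]
    rcases hs (costExp B k) with h | h <;> rcases hs (costExp B l) with h' | h' <;>
      rcases hdP with h'' | h'' <;> rcases hmin with h''' | h''' <;> rw [h, h', h'', h'''] <;>
      first
        | (left; ring1)
        | (right; ring1)

end Pluecker

/-! ### Dominant monomials -/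

section Dominance

theorem WithBot.add_lt_add_of_lt_of_le_of_ne_bot {a b c d : WithBot ℝ} (h : a < b) (h' : c ≤ d)
    (hd : d ≠ ⊥) : a + c < b + d := by
  obtain ⟨r, rfl⟩ := WithBot.ne_bot_iff_exists.1 hd
  exact (add_le_add le_rfl h').trans_lt (WithBot.add_lt_add_right WithBot.coe_ne_bot h)

theorem val_pow (x : PuiseuxSeries) (k : ℕ) : val (x ^ k) = k • val x := by
  induction k with
  | zero => rw [pow_zero, zero_smul, val_one]
  | succ k ih => rw [pow_succ, val_mul, ih, succ_nsmul]

theorem val_prod {ι : Type*} (s : Finset ι) (f : ι → PuiseuxSeries) :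
    val (∏ i ∈ s, f i) = ∑ i ∈ s, val (f i) := by
  classical
  induction s using Finset.induction_on with
  | empty => simp [val_one]
  | insert a s ha ih => rw [Finset.prod_insert ha, Finset.sum_insert ha, val_mul, ih]

theorem exists_val_sum_le {ι : Type*} {s : Finset ι} (hs : s.Nonempty) (f : ι → PuiseuxSeries) :
    ∃ i ∈ s, val (∑ i ∈ s, f i) ≤ val (f i) := by
  obtain ⟨i, hi, h⟩ := Finset.exists_max_image s (fun i => val (f i)) hs
  exact ⟨i, hi, val_sum_le s f h⟩

variable {ι : Type} {P Q : MvPolynomial ι PuiseuxSeries} {x : ι → SignedTrop} {α β : ι →₀ ℕ}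

/-- The modulus of the tropical value at `x` of the monomial of exponent `α`, with coefficient
`1`. -/
noncomputable def monomialModulus (x : ι → SignedTrop) (α : ι →₀ ℕ) : WithBot ℝ :=
  α.sum fun i e => e • (x i).modulus

theorem monomialModulus_add (x : ι → SignedTrop) (α β : ι →₀ ℕ) :
    monomialModulus x (α + β) = monomialModulus x α + monomialModulus x β :=
  Finsupp.sum_add_index' (fun _ => zero_smul _ _) fun _ _ _ => add_smul _ _ _

theorem termModulus_eq (P : MvPolynomial ι PuiseuxSeries) (x : ι → SignedTrop) (α : ι →₀ ℕ) :
    termModulus P x α = val (P.coeff α) + monomialModulus x α := rfl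

theorem IsDominant.lt (h : IsDominant P x α) (hβ : β ≠ α) :
    termModulus P x β < termModulus P x α := by
  by_cases hs : β ∈ P.support
  · exact h.2.2 β hs hβ
  · rw [MvPolynomial.notMem_support_iff] at hs
    rw [termModulus_eq, hs, val_zero, WithBot.bot_add]
    exact bot_lt_iff_ne_bot.2 h.2.1

theorem IsDominant.le (h : IsDominant P x α) (β : ι →₀ ℕ) :
    termModulus P x β ≤ termModulus P x α := by
  rcases eq_or_ne β α with rfl | hβ
  · exact le_rfl
  · exact (h.lt hβ).le

theorem IsDominant.neg (h : IsDominant P x α) : IsDominant (-P) x α := by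
  have h1 : ∀ β, termModulus (-P) x β = termModulus P x β := fun β => by
    rw [termModulus_eq, termModulus_eq, MvPolynomial.coeff_neg, val_neg]
  refine ⟨?_, ?_, fun β hβ => ?_⟩
  · rw [MvPolynomial.support_neg]; exact h.1
  · rw [h1]; exact h.2.1
  · rw [MvPolynomial.support_neg] at hβ
    rw [h1, h1]; exact h.2.2 β hβ

/-- The product of the dominant terms of `P` and `Q` is not cancelled in `P * Q`, and it dominates
all the other terms. -/
theorem IsDominant.mul (hP : IsDominant P x α) (hQ : IsDominant Q x β) :
    IsDominant (P * Q) x (α + β) := by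
  classical
  set c := termModulus P x α + termModulus Q x β with hc
  have hc0 : c ≠ ⊥ := by
    rw [hc, Ne, WithBot.add_eq_bot, not_or]; exact ⟨hP.2.1, hQ.2.1⟩
  have hterm : ∀ a b, val (P.coeff a * Q.coeff b) + monomialModulus x (a + b)
      = termModulus P x a + termModulus Q x b := fun a b => by
    rw [val_mul, monomialModulus_add, termModulus_eq, termModulus_eq]
    exact add_add_add_comm _ _ _ _
  have hlt : ∀ a b, (a, b) ≠ (α, β) → termModulus P x a + termModulus Q x b < c := by
    intro a b hab
    by_cases ha : a = α
    · have hb : b ≠ β := fun h => hab (by rw [ha, h])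
      rw [add_comm, hc, add_comm (termModulus P x α)]
      exact WithBot.add_lt_add_of_lt_of_le_of_ne_bot (hQ.lt hb) (hP.le a) hP.2.1
    · exact WithBot.add_lt_add_of_lt_of_le_of_ne_bot (hP.lt ha) (hQ.le b) hQ.2.1
  have hcoeff : val ((P * Q).coeff (α + β)) = val (P.coeff α * Q.coeff β) := by
    rw [MvPolynomial.coeff_mul, val, val]
    congr 1
    refine sval_sum_of_dominant _ (fun ab : (ι →₀ ℕ) × (ι →₀ ℕ) => P.coeff ab.1 * Q.coeff ab.2)
      (a := (α, β)) (Finset.HasAntidiagonal.mem_antidiagonal.2 rfl) ?_ ?_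
    · intro h0
      apply hc0
      rw [hc, ← hterm, h0, WithBot.bot_add]
    · rintro ⟨a, b⟩ hab hne
      have h1 := hlt a b hne
      rw [← hterm, hc, ← hterm] at h1
      rw [Finset.HasAntidiagonal.mem_antidiagonal] at hab
      simp only at hab
      rw [hab] at h1
      exact lt_of_add_lt_add_right h1
  have hval : termModulus (P * Q) x (α + β) = c := by
    rw [termModulus_eq, hcoeff, hterm]
  refine ⟨?_, by rwa [hval], fun γ _ hγ => ?_⟩
  · rw [MvPolynomial.mem_support_iff]
    intro h0
    rw [termModulus_eq, h0, val_zero, WithBot.bot_add] at hval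
    exact hc0 hval.symm
  · rw [hval, termModulus_eq, MvPolynomial.coeff_mul]
    obtain ⟨⟨a, b⟩, hab, hle⟩ := exists_val_sum_le (s := Finset.HasAntidiagonal.antidiagonal γ)
      ⟨(0, γ), Finset.HasAntidiagonal.mem_antidiagonal.2 (zero_add γ)⟩ fun ab => P.coeff ab.1 * Q.coeff ab.2
    rw [Finset.HasAntidiagonal.mem_antidiagonal] at hab
    simp only at hab hle
    refine (add_le_add hle le_rfl).trans_lt ?_
    rw [← hab, hterm]
    refine hlt a b fun h => hγ ?_
    rw [← hab, (Prod.mk.inj h).1, (Prod.mk.inj h).2]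

/-- The valuation of the value of a term is its tropical modulus. -/
theorem val_term (P : MvPolynomial ι PuiseuxSeries) {x' : ι → PuiseuxSeries}
    (hx : ∀ i, sval (x' i) = x i) (β : ι →₀ ℕ) :
    val (P.coeff β * ∏ i ∈ β.support, x' i ^ β i) = termModulus P x β := by
  rw [val_mul, val_prod, termModulus_eq]
  congr 1
  refine Finset.sum_congr rfl fun i _ => ?_
  rw [val_pow, val, hx]

theorem IsDominant.sval_eval_eq_term (h : IsDominant P x α) {x' : ι → PuiseuxSeries}
    (hx : ∀ i, sval (x' i) = x i) :
    sval (MvPolynomial.eval x' P) = sval (P.coeff α * ∏ i ∈ α.support, x' i ^ α i) := by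
  rw [MvPolynomial.eval_eq]
  exact sval_sum_of_dominant _ _ h.1 (by rw [val_term P hx]; exact h.2.1)
    (fun β hβ hne => by rw [val_term P hx, val_term P hx]; exact h.2.2 β hβ hne)

theorem IsDominant.eval_ne_zero (h : IsDominant P x α) {x' : ι → PuiseuxSeries}
    (hx : ∀ i, sval (x' i) = x i) : MvPolynomial.eval x' P ≠ 0 := by
  intro h0
  have h1 := congrArg SignedTrop.modulus (h.sval_eval_eq_term hx)
  rw [h0] at h1
  refine h.2.1 ?_
  rw [← val_term P hx]
  exact h1.symm.trans val_zero

/-- At signed valuations, a tropical polynomial with a dominant monomial takes the signed valuation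
of the value of the polynomial. -/
theorem IsDominant.sval_eval (h : IsDominant P x α) {x' : ι → PuiseuxSeries}
    (hx : ∀ i, sval (x' i) = x i) : sval (MvPolynomial.eval x' P) = tropEval P x := by
  have hex : ∃ α, IsDominant P x α := ⟨α, h⟩
  rw [tropEval, dif_pos hex, hex.choose_spec.sval_eval_eq_term hx, sval_mul]
  generalize hex.choose = γ
  congr 1
  have h1 := map_prod svalHom (fun i => x' i ^ γ i) γ.support
  refine h1.trans (Finset.prod_congr rfl fun i _ => ?_)
  rw [map_pow]
  change sval (x' i) ^ γ i = _
  rw [hx]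

end Dominance

/-! ### Genericity of minors -/

section Genericity

variable {p q : ℕ}

/-- The matrix of formal variables. -/
noncomputable def variableMatrix (p q : ℕ) :
    Matrix (Fin p) (Fin q) (MvPolynomial (Fin p × Fin q) PuiseuxSeries) :=
  Matrix.of fun i j => MvPolynomial.X (i, j)

theorem map_minor {R S : Type*} [CommRing R] [CommRing S] (φ : R →+* S)
    (M : Matrix (Fin p) (Fin q) R) (K : Finset (Fin p)) (L : Finset (Fin q)) :
    φ (minor M K L) = minor (M.map φ) K L := by
  unfold minor
  split_ifs with h
  · rw [RingHom.map_det]; rfl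
  · exact map_zero φ

/-- A minor of the matrix of variables has a dominant monomial at every matrix whose corresponding
submatrix is generic. -/
theorem exists_isDominant_minor {K : Finset (Fin p)} {L : Finset (Fin q)} (h : K.card = L.card)
    (x : Fin p × Fin q → SignedTrop)
    (hx : IsGeneric (Matrix.of fun i j => x (K.orderEmbOfFin h i, L.orderEmbOfFin rfl j))) :
    ∃ α, IsDominant (minor (variableMatrix p q) K L) x α := by
  classical
  set f := K.orderEmbOfFin h
  set g := L.orderEmbOfFin rfl
  set G := Matrix.of fun i j => x (f i, g j) with hG
  -- distinct permutations contribute distinct monomials, with coefficient `1` or `-1`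
  let e : Equiv.Perm (Fin L.card) → (Fin p × Fin q →₀ ℕ) := fun σ =>
    ∑ i, Finsupp.single (f i, g (σ i)) 1
  have hinj : Function.Injective e := by
    intro σ τ hστ
    ext1 i
    have h1 : e σ (f i, g (σ i)) ≠ 0 := by
      simp only [e, Finsupp.finsetSum_apply]
      intro h0
      have h2 := Finset.sum_eq_zero_iff.1 h0 i (Finset.mem_univ i)
      rw [Finsupp.single_eq_same] at h2
      exact one_ne_zero h2
    rw [hστ] at h1
    simp only [e, Finsupp.finsetSum_apply] at h1
    obtain ⟨i', -, hi'⟩ := Finset.exists_ne_zero_of_sum_ne_zero h1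
    rw [Finsupp.single_apply] at hi'
    have h3 : (f i', g (τ i')) = (f i, g (σ i)) := by
      by_contra hne
      rw [if_neg hne] at hi'
      exact hi' rfl
    have h4 : i' = i := f.injective (Prod.mk.inj h3).1
    rw [← h4]
    have h5 : g (τ i') = g (σ i') := by rw [(Prod.mk.inj h3).2, h4]
    exact (g.injective h5).symm
  have hweight : ∀ σ, monomialModulus x (e σ) = permWeight G σ := fun σ => by
    let φ : (Fin p × Fin q →₀ ℕ) →+ WithBot ℝ :=
      ⟨⟨monomialModulus x, Finsupp.sum_zero_index⟩, monomialModulus_add x⟩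
    have h1 : φ (e σ) = ∑ i, φ (Finsupp.single (f i, g (σ i)) 1) := map_sum φ _ _
    refine h1.trans (Finset.sum_congr rfl fun i _ => ?_)
    change monomialModulus x (Finsupp.single (f i, g (σ i)) 1) = _
    have h2 := Finsupp.sum_single_index (a := (f i, g (σ i))) (b := 1)
      (h := fun i e => e • (x i).modulus) (zero_smul ℕ _)
    exact h2.trans (one_smul ℕ _)
  have hdet : minor (variableMatrix p q) K L
      = ∑ σ : Equiv.Perm (Fin L.card), MvPolynomial.monomial (e σ)
        (((Equiv.Perm.sign σ : ℤ) : PuiseuxSeries)) := by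
    rw [minor_eq _ h rfl, ← Matrix.det_transpose, Matrix.det_apply']
    refine Finset.sum_congr rfl fun σ _ => ?_
    have h1 : ∏ i, ((variableMatrix p q).submatrix f g)ᵀ (σ i) i
        = MvPolynomial.monomial (e σ) (1 : PuiseuxSeries) := by
      rw [MvPolynomial.monomial_sum_one]
      rfl
    rw [h1]
    have h2 : ((Equiv.Perm.sign σ : ℤ) : MvPolynomial (Fin p × Fin q) PuiseuxSeries)
        = MvPolynomial.C ((Equiv.Perm.sign σ : ℤ) : PuiseuxSeries) := by simp
    rw [h2, MvPolynomial.C_mul_monomial, mul_one]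
  have hcoeff : ∀ σ, (minor (variableMatrix p q) K L).coeff (e σ)
      = ((Equiv.Perm.sign σ : ℤ) : PuiseuxSeries) := fun σ => by
    rw [hdet, MvPolynomial.coeff_sum, Finset.sum_eq_single_of_mem σ (Finset.mem_univ σ)]
    · rw [MvPolynomial.coeff_monomial, if_pos rfl]
    · intro τ _ hne
      rw [MvPolynomial.coeff_monomial, if_neg fun h => hne (hinj h)]
  have hval : ∀ σ, termModulus (minor (variableMatrix p q) K L) x (e σ) = permWeight G σ :=
    fun σ => by
      rw [termModulus_eq, hcoeff, hweight]
      rcases Int.units_eq_one_or (Equiv.Perm.sign σ) with h | h <;> rw [h] <;>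
        simp [val_neg, val_one]
  obtain ⟨σ, hσ, hmax⟩ := hx
  refine ⟨e σ, ?_, by rwa [hval], fun β hβ hne => ?_⟩
  · rw [MvPolynomial.mem_support_iff, hcoeff]
    rcases Int.units_eq_one_or (Equiv.Perm.sign σ) with h | h <;> rw [h] <;> simp
  · rw [MvPolynomial.mem_support_iff, hdet, MvPolynomial.coeff_sum] at hβ
    obtain ⟨τ, -, hτ⟩ := Finset.exists_ne_zero_of_sum_ne_zero hβ
    rw [MvPolynomial.coeff_monomial] at hτ
    have h1 : e τ = β := by
      by_contra h
      rw [if_neg h] at hτ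
      exact hτ rfl
    rw [← h1, hval, hval]
    exact hmax τ fun h => hne (by rw [← h1, h])

theorem IsGeneric.of_submatrix_row {G : Matrix (Fin p) (Fin p) SignedTrop}
    (e : Equiv.Perm (Fin p)) (h : IsGeneric (G.submatrix e id)) : IsGeneric G := by
  have hw : ∀ σ, permWeight (G.submatrix e id) σ = permWeight G (e.symm.trans σ) := fun σ => by
    unfold permWeight
    rw [← Equiv.sum_comp e (fun i => (G i ((e.symm.trans σ) i)).modulus)]
    refine Finset.sum_congr rfl fun i _ => ?_
    simp
  obtain ⟨σ, hσ, hmax⟩ := h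
  refine ⟨e.symm.trans σ, by rwa [← hw], fun τ hτ => ?_⟩
  have h1 : τ = e.symm.trans (e.trans τ) := by ext; simp
  rw [h1, ← hw, ← hw]
  refine hmax _ fun h => hτ ?_
  rw [h1, h]

/-- A matrix is generic as soon as all the permutations of maximal weight fix the first row, and
the matrix obtained by removing the first row and column is generic. -/
theorem IsGeneric.of_succ {G : Matrix (Fin (p + 1)) (Fin (p + 1)) SignedTrop}
    (hG : IsGeneric (G.submatrix Fin.succ Fin.succ)) (h0 : (G 0 0).modulus ≠ ⊥)
    (hlt : ∀ σ τ : Equiv.Perm (Fin (p + 1)), σ 0 ≠ 0 → τ 0 = 0 → permWeight G σ < permWeight G τ) :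
    IsGeneric G := by
  have hw : ∀ e : Equiv.Perm (Fin p), permWeight G (Equiv.Perm.decomposeFin.symm (0, e))
      = (G 0 0).modulus + permWeight (G.submatrix Fin.succ Fin.succ) e := fun e => by
    rw [permWeight, Fin.sum_univ_succ, Equiv.Perm.decomposeFin_symm_apply_zero]
    congr 1
  obtain ⟨e, he, hmax⟩ := hG
  refine ⟨Equiv.Perm.decomposeFin.symm (0, e), ?_, fun τ hτ => ?_⟩
  · rw [hw, Ne, WithBot.add_eq_bot, not_or]
    exact ⟨h0, he⟩
  · by_cases hτ0 : τ 0 = 0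
    · obtain ⟨⟨c, e'⟩, rfl⟩ := Equiv.Perm.decomposeFin.symm.surjective τ
      rw [Equiv.Perm.decomposeFin_symm_apply_zero] at hτ0
      subst hτ0
      have hne : e' ≠ e := by rintro rfl; exact hτ rfl
      rw [hw, hw, add_comm, add_comm (G 0 0).modulus]
      exact WithBot.add_lt_add_of_lt_of_le_of_ne_bot (hmax e' hne) le_rfl h0
    · exact hlt _ _ hτ0 (Equiv.Perm.decomposeFin_symm_apply_zero _ _)

end Genericity

/-! ### Dominance for the minors of the pivoting rule -/

section Stack

variable {m n p : ℕ}

theorem StronglyNondegenerate.fst {A : Matrix (Fin m) (Fin n) SignedTrop} {b : Fin m → SignedTrop}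
    (h : StronglyNondegenerate (augment A b)) : StronglyNondegenerate A := fun p f g =>
  h p f (g.trans Function.Embedding.inl)

theorem modulus_pow (x : SignedTrop) (k : ℕ) : (x ^ k).modulus = k • x.modulus := by
  induction k with
  | zero => rw [pow_zero, zero_smul]; rfl
  | succ k ih => rw [pow_succ, SignedTrop.modulus_mul, ih, succ_nsmul]

/-- The objective vector `(ε, ε^{⊙2}, …, ε^{⊙n})`. -/
noncomputable def tropObjective (n : ℕ) (ε : ℝ) : Fin n → SignedTrop := fun j =>
  SignedTrop.pos ε ^ (j.val + 1)

theorem modulus_tropObjective (ε : ℝ) (j : Fin n) :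
    (tropObjective n ε j).modulus = (((j.val + 1 : ℕ) * ε : ℝ) : WithBot ℝ) := by
  rw [tropObjective, modulus_pow]
  change (j.val + 1) • ((ε : ℝ) : WithBot ℝ) = _
  rw [← WithBot.coe_nsmul, nsmul_eq_mul]

/-- Adding the objective vector as first row to a submatrix of `A` keeps it generic: as `ε` is
very negative, the objective row is matched to the first column. -/
theorem isGeneric_objective_row {A : Matrix (Fin m) (Fin n) SignedTrop} {ε : ℝ}
    (hA : StronglyNondegenerate A)
    (hε : ∀ i j i' j', (ε : WithBot ℝ) + n • (A i' j').modulus < n • (A i j).modulus)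
    (ρ : Fin p ↪ Fin m) (g : Fin (p + 1) ↪o Fin n)
    (G : Matrix (Fin (p + 1)) (Fin (p + 1)) SignedTrop)
    (hG0 : ∀ j, G 0 j = tropObjective n ε (g j)) (hGs : ∀ i j, G (Fin.succ i) j = A (ρ i) (g j)) :
    IsGeneric G := by
  have hreal : ∀ i j, ∃ r : ℝ, (A i j).modulus = r := fun i j => by
    obtain ⟨r, hr⟩ := WithBot.ne_bot_iff_exists.1 (hA.modulus_ne_bot i j)
    exact ⟨r, hr.symm⟩
  choose a ha using hreal
  have hε' : ∀ i j i' j', ε + n * a i' j' < n * a i j := fun i j i' j' => by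
    have h1 := hε i j i' j'
    rw [ha, ha, ← WithBot.coe_nsmul, ← WithBot.coe_nsmul, ← WithBot.coe_add, WithBot.coe_lt_coe,
      nsmul_eq_mul, nsmul_eq_mul] at h1
    exact h1
  apply IsGeneric.of_succ
  · have h1 : G.submatrix Fin.succ Fin.succ
        = A.submatrix ρ ((Fin.succEmb p).trans g.toEmbedding) := by
      ext i j; exact hGs i j.succ
    rw [h1]
    exact hA p ρ _
  · rw [hG0, modulus_tropObjective]; exact WithBot.coe_ne_bot
  · intro σ τ hσ hτ
    have hw : ∀ σ : Equiv.Perm (Fin (p + 1)), permWeight G σ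
        = ((((g (σ 0)).val + 1 : ℕ) * ε + ∑ i, a (ρ i) (g (σ (Fin.succ i))) : ℝ) : WithBot ℝ) :=
      fun σ => by
        rw [permWeight, Fin.sum_univ_succ, hG0, modulus_tropObjective, WithBot.coe_add,
          WithBot.coe_sum]
        congr 1
        refine Finset.sum_congr rfl fun i _ => ?_
        rw [hGs, ha]
    rw [hw, hw, WithBot.coe_lt_coe, hτ]
    have hp : 0 < p := by
      rcases Nat.eq_zero_or_pos p with rfl | h
      · exact absurd (Fin.eq_zero (σ 0)) hσ
      · exact h
    have hpn : p + 1 ≤ n := by simpa using Fintype.card_le_of_embedding g.toEmbedding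
    have hn : (0 : ℝ) < n := by exact_mod_cast (by omega : 0 < n)
    have hlt : g 0 < g (σ 0) := g.strictMono (Fin.pos_iff_ne_zero.2 hσ)
    have hε0 : ε < 0 := by
      have := hε' (ρ ⟨0, hp⟩) (g 0) (ρ ⟨0, hp⟩) (g 0)
      linarith
    have h1 : (((g (σ 0)).val + 1 : ℕ) : ℝ) * ε ≤ ((g 0).val + 1 : ℕ) * ε + ε := by
      have h2 : (((g 0).val + 1 : ℕ) : ℝ) + 1 ≤ ((g (σ 0)).val + 1 : ℕ) := by
        have : (g 0).val < (g (σ 0)).val := hlt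
        exact_mod_cast (by omega : (g 0).val + 1 + 1 ≤ (g (σ 0)).val + 1)
      nlinarith
    -- each of the `p ≤ n` other rows gains less than `-ε / n` by being matched differently, which
    -- does not make up for the loss of at least `-ε` in the objective row
    have h2 : ∑ i, (a (ρ i) (g (σ (Fin.succ i))) - a (ρ i) (g (τ (Fin.succ i))))
        < ∑ _i : Fin p, (-ε / n) := by
      have : Nonempty (Fin p) := ⟨⟨0, hp⟩⟩
      refine Finset.sum_lt_sum_of_nonempty Finset.univ_nonempty fun i _ => ?_
      rw [lt_div_iff₀ hn]
      have := hε' (ρ i) (g (τ (Fin.succ i))) (ρ i) (g (σ (Fin.succ i)))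
      nlinarith
    rw [Finset.sum_const, Finset.card_univ, Fintype.card_fin, nsmul_eq_mul,
      Finset.sum_sub_distrib] at h2
    have h3 : (p : ℝ) * (-ε / n) ≤ -ε := by
      rw [mul_div_assoc', div_le_iff₀ hn]
      have : (p : ℝ) ≤ n := by exact_mod_cast (by omega : p ≤ n)
      nlinarith
    linarith

theorem stack_castAdd (A : Matrix (Fin m) (Fin n) SignedTrop) (u v : Fin n → SignedTrop)
    (i : Fin m) (j : Fin n) : stack A u v (Fin.castAdd 2 i, j) = A i j :=
  congrFun (Fin.append_left A ![u, v] i) j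

theorem stack_natAdd_zero (A : Matrix (Fin m) (Fin n) SignedTrop) (u v : Fin n → SignedTrop)
    (j : Fin n) : stack A u v (Fin.natAdd m 0, j) = u j :=
  congrFun (Fin.append_right A ![u, v] 0) j

theorem stack_natAdd_one (A : Matrix (Fin m) (Fin n) SignedTrop) (u v : Fin n → SignedTrop)
    (j : Fin n) : stack A u v (Fin.natAdd m 1, j) = v j :=
  congrFun (Fin.append_right A ![u, v] 1) j

/-- The minors of the matrix with rows `A`, the objective vector and `A k` have a dominant
monomial, provided that they do not involve the row `A k` twice. -/
theorem exists_isDominant_stack {A : Matrix (Fin m) (Fin n) SignedTrop} {ε : ℝ}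
    (hA : StronglyNondegenerate A)
    (hε : ∀ i j i' j', (ε : WithBot ℝ) + n • (A i' j').modulus < n • (A i j).modulus)
    (k : Fin m) {K : Finset (Fin (m + 2))} {L : Finset (Fin n)} (h : K.card = L.card)
    (hk : Fin.castAdd 2 k ∉ K ∨ Fin.natAdd m 1 ∉ K) :
    ∃ α, IsDominant (minor (variableMatrix (m + 2) n) K L) (stack A (tropObjective n ε) (A k))
      α := by
  refine exists_isDominant_minor h _ ?_
  -- the row of `A` which a row of `K`, if it is not the objective vector, stands for
  let ρ : Fin (m + 2) → Fin m := Fin.append id fun _ => k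
  have hρ : ∀ a, a ≠ Fin.natAdd m 0 → ∀ j,
      stack A (tropObjective n ε) (A k) (a, j) = A (ρ a) j := by
    intro a
    induction a using Fin.addCases with
    | left i =>
      intro _ j
      rw [stack_castAdd]; simp [ρ]
    | right r =>
      intro hr j
      have h1 : r = 1 := by
        rcases Fin.exists_fin_two.1 ⟨r, rfl⟩ with h | h
        · exact absurd (by rw [h]) hr
        · exact h
      rw [h1, stack_natAdd_one]
      simp [ρ]
  have hinj : ∀ a ∈ K, ∀ b ∈ K, a ≠ Fin.natAdd m 0 → b ≠ Fin.natAdd m 0 → ρ a = ρ b → a = b := by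
    have h1 : ∀ r : Fin 2, Fin.natAdd m r ≠ Fin.natAdd m 0 → r = 1 := by
      intro r hr
      rcases Fin.exists_fin_two.1 ⟨r, rfl⟩ with h | h
      · exact absurd (by rw [h]) hr
      · exact h
    intro a
    induction a using Fin.addCases with
    | left i =>
      intro ha b
      induction b using Fin.addCases with
      | left i' =>
        intro _ _ _ h
        simp only [ρ, Fin.append_left, id] at h
        rw [h]
      | right r =>
        intro hb _ hr h
        simp only [ρ, Fin.append_left, Fin.append_right, id] at h
        rw [h1 r hr] at hb
        rw [h] at ha
        exact absurd hk (by simp [ha, hb])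
    | right r =>
      intro ha b
      induction b using Fin.addCases with
      | left i =>
        intro hb hr _ h
        simp only [ρ, Fin.append_left, Fin.append_right, id] at h
        rw [h1 r hr] at ha
        rw [← h] at hb
        exact absurd hk (by simp [ha, hb])
      | right r' =>
        intro _ hr hr' _
        rw [h1 r hr, h1 r' hr']
  set f := K.orderEmbOfFin h with hf
  set g := L.orderEmbOfFin rfl
  have hfK : ∀ i, f i ∈ K := fun i => Finset.orderEmbOfFin_mem _ _ _
  by_cases h0 : Fin.natAdd m 0 ∈ K
  · obtain ⟨p, hp⟩ : ∃ p, L.card = p + 1 := by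
      rw [← h]; exact Nat.exists_eq_succ_of_ne_zero (Finset.card_ne_zero_of_mem h0)
    obtain ⟨i₀, hi₀⟩ := exists_orderEmbOfFin_eq h h0
    rw [← hf] at hi₀
    clear_value f g
    generalize L.card = c at *
    subst hp
    have hne : ∀ i, f (i₀.succAbove i) ≠ Fin.natAdd m 0 := fun i h => by
      rw [← hi₀] at h
      exact Fin.succAbove_ne i₀ i (f.injective h)
    refine IsGeneric.of_submatrix_row i₀.cycleRange.symm ?_
    refine isGeneric_objective_row hA hε ⟨fun i => ρ (f (i₀.succAbove i)), fun i j hij => ?_⟩ g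
      _ (fun j => ?_) (fun i j => ?_)
    · exact Fin.succAbove_right_injective (f.injective
        (hinj _ (hfK _) _ (hfK _) (hne i) (hne j) hij))
    · simp only [Matrix.submatrix_apply, Matrix.of_apply, Fin.cycleRange_symm_zero, hi₀, id]
      exact stack_natAdd_zero _ _ _ _
    · simp only [Matrix.submatrix_apply, Matrix.of_apply, Fin.cycleRange_symm_succ, id]
      exact hρ _ (hne i) _
  · have hne : ∀ i, f i ≠ Fin.natAdd m 0 := fun i h => h0 (h ▸ hfK i)
    have h1 : (Matrix.of fun i j => stack A (tropObjective n ε) (A k) (f i, g j))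
        = A.submatrix (fun i => ρ (f i)) g := by
      ext i j; exact hρ _ (hne i) _
    rw [h1]
    exact hA _ ⟨fun i => ρ (f i), fun i j hij =>
      f.injective (hinj _ (hfK _) _ (hfK _) (hne i) (hne j) hij)⟩ g.toEmbedding

end Stack

/-! ### Bases and reduced costs over an ordered field -/

section Bases

variable {F : Type} [Field F] {m n : ℕ}

/-- The normal vectors of the constraints. -/
def constraintRow (A : Matrix (Fin m) (Fin n) F) : Fin m ⊕ Fin n → Fin n → F :=
  Sum.elim A (1 : Matrix (Fin n) (Fin n) F)

/-- The slack of a constraint at a point: the left-hand side of the constraint, written as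
`slack ≥ 0`. -/
def slack (A : Matrix (Fin m) (Fin n) F) (b : Fin m → F) (l : Fin m ⊕ Fin n) (x : Fin n → F) : F :=
  constraintRow A l ⬝ᵥ x + Sum.elim b 0 l

/-- The normal vectors of the constraints in `B` form a basis of the space: there are `n` of them,
and no nonzero vector is orthogonal to all of them. -/
def IsRowBasis (A : Matrix (Fin m) (Fin n) F) (B : Finset (Fin m ⊕ Fin n)) : Prop :=
  B.card = n ∧ ∀ d, (∀ l ∈ B, constraintRow A l ⬝ᵥ d = 0) → d = 0

variable {A : Matrix (Fin m) (Fin n) F} {b : Fin m → F} {B : Finset (Fin m ⊕ Fin n)}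

theorem constraintRow_inr (j : Fin n) (x : Fin n → F) :
    constraintRow A (Sum.inr j) ⬝ᵥ x = x j := by
  change (1 : Matrix (Fin n) (Fin n) F) j ⬝ᵥ x = x j
  have h : (1 : Matrix (Fin n) (Fin n) F) j = Pi.single j 1 := by
    ext i; simp [Matrix.one_apply, Pi.single_apply, eq_comm]
  rw [h, single_one_dotProduct]

theorem slack_inl (i : Fin m) (x : Fin n → F) : slack A b (Sum.inl i) x = A i ⬝ᵥ x + b i := rfl

theorem slack_inr (j : Fin n) (x : Fin n → F) : slack A b (Sum.inr j) x = x j := by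
  change _ + (0 : F) = _
  rw [constraintRow_inr, add_zero]

theorem slack_add_smul (l : Fin m ⊕ Fin n) (x d : Fin n → F) (t : F) :
    slack A b l (x + t • d) = slack A b l x + t * (constraintRow A l ⬝ᵥ d) := by
  rw [slack, slack, dotProduct_add, dotProduct_smul, smul_eq_mul]
  ring

theorem slack_sub (l : Fin m ⊕ Fin n) (x y : Fin n → F) :
    slack A b l y - slack A b l x = constraintRow A l ⬝ᵥ (y - x) := by
  rw [slack, slack, dotProduct_sub]
  ring

theorem IsReducedCost.dotProduct_eq {c : Fin n → F} {y : Fin m ⊕ Fin n → F}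
    (h : IsReducedCost A c B y) (x : Fin n → F) :
    c ⬝ᵥ x = ∑ l ∈ B, y l * (constraintRow A l ⬝ᵥ x) := by
  have h1 : ∀ j, c j = ∑ l ∈ B, constraintRow A l j * y l := fun j => (h.2 j).symm
  simp only [dotProduct, h1, Finset.sum_mul, Finset.mul_sum]
  rw [Finset.sum_comm]
  exact Finset.sum_congr rfl fun l _ => Finset.sum_congr rfl fun j _ => by ring

theorem isReducedCost_of_dotProduct {c : Fin n → F} {y : Fin m ⊕ Fin n → F}
    (h0 : ∀ l ∉ B, y l = 0)
    (h : ∀ x : Fin n → F, c ⬝ᵥ x = ∑ l ∈ B, y l * (constraintRow A l ⬝ᵥ x)) :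
    IsReducedCost A c B y := by
  refine ⟨h0, fun j => ?_⟩
  have h1 := h (Pi.single j 1)
  rw [dotProduct_single_one] at h1
  rw [h1]
  refine Finset.sum_congr rfl fun l _ => ?_
  rw [dotProduct_single_one, mul_comm]
  rfl

/-- The square matrix of the rows of a basis. -/
noncomputable def rowMatrix (A : Matrix (Fin m) (Fin n) F) {B : Finset (Fin m ⊕ Fin n)}
    (hB : B.card = n) : Matrix (Fin n) (Fin n) F :=
  Matrix.of fun a => constraintRow A ((B.equivFinOfCardEq hB).symm a).1

theorem card_exchange {α : Type*} [DecidableEq α] {B : Finset α} {p q : α} (hp : p ∉ B)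
    (hq : q ∈ B) : (insert p (B.erase q)).card = B.card := by
  rw [Finset.card_insert_of_notMem fun h => hp (Finset.mem_of_mem_erase h),
    Finset.card_erase_of_mem hq]
  exact Nat.sub_add_cancel (Finset.card_pos.2 ⟨q, hq⟩)

theorem IsRowBasis.isUnit_det (h : IsRowBasis A B) : IsUnit (rowMatrix A h.1).det := by
  rw [isUnit_iff_ne_zero]
  intro h0
  obtain ⟨d, hd0, hd⟩ := Matrix.exists_mulVec_eq_zero_iff.2 h0
  refine hd0 (h.2 d fun l hl => ?_)
  have h1 := congrFun hd (B.equivFinOfCardEq h.1 ⟨l, hl⟩)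
  simpa [rowMatrix, Matrix.mulVec] using h1

/-- The direction of the edge leaving the constraint `q` of a basis. -/
theorem IsRowBasis.exists_direction (h : IsRowBasis A B) {q : Fin m ⊕ Fin n} (hq : q ∈ B) :
    ∃ d : Fin n → F, constraintRow A q ⬝ᵥ d = 1 ∧ ∀ l ∈ B, l ≠ q → constraintRow A l ⬝ᵥ d = 0 := by
  let e := B.equivFinOfCardEq h.1
  let d := (rowMatrix A h.1)⁻¹ *ᵥ Pi.single (e ⟨q, hq⟩) 1
  have hd : rowMatrix A h.1 *ᵥ d = Pi.single (e ⟨q, hq⟩) 1 := by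
    simp only [d, Matrix.mulVec_mulVec, Matrix.mul_nonsing_inv _ h.isUnit_det, Matrix.one_mulVec]
  have hl : ∀ l (hl : l ∈ B), constraintRow A l ⬝ᵥ d
      = (Pi.single (e ⟨q, hq⟩) 1 : Fin n → F) (e ⟨l, hl⟩) := fun l hl => by
    rw [← hd]
    simp [rowMatrix, Matrix.mulVec, e]
  refine ⟨d, by rw [hl q hq, Pi.single_eq_same], fun l hlB hne => ?_⟩
  rw [hl l hlB, Pi.single_eq_of_ne]
  exact fun h => hne (congrArg Subtype.val (e.injective h))

theorem IsRowBasis.exists_isReducedCost (h : IsRowBasis A B) (c : Fin n → F) :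
    ∃ y, IsReducedCost A c B y := by
  choose! d hd1 hd0 using fun q (hq : q ∈ B) => h.exists_direction hq
  refine ⟨fun l => if l ∈ B then c ⬝ᵥ d l else 0, isReducedCost_of_dotProduct
    (fun l hl => if_neg hl) fun x => ?_⟩
  have hx : x = ∑ l ∈ B, (constraintRow A l ⬝ᵥ x) • d l := by
    rw [← sub_eq_zero]
    refine h.2 _ fun q hq => ?_
    rw [dotProduct_sub, dotProduct_sum, Finset.sum_eq_single_of_mem q hq, dotProduct_smul,
      hd1 q hq, smul_eq_mul, mul_one, sub_self]
    intro l hl hne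
    rw [dotProduct_smul, hd0 l hl q hq hne.symm, smul_zero]
  conv_lhs => rw [hx]
  rw [dotProduct_sum]
  refine Finset.sum_congr rfl fun l hl => ?_
  rw [dotProduct_smul, if_pos hl, smul_eq_mul, mul_comm]

/-- The reduced cost at `q` is the variation of the cost along the edge leaving `q`. -/
theorem IsReducedCost.apply_eq {c : Fin n → F} {y : Fin m ⊕ Fin n → F}
    (h : IsReducedCost A c B y) {q : Fin m ⊕ Fin n} (hq : q ∈ B) {d : Fin n → F}
    (hd1 : constraintRow A q ⬝ᵥ d = 1) (hd0 : ∀ l ∈ B, l ≠ q → constraintRow A l ⬝ᵥ d = 0) :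
    c ⬝ᵥ d = y q := by
  rw [h.dotProduct_eq, Finset.sum_eq_single_of_mem q hq, hd1, mul_one]
  intro l hl hne
  rw [hd0 l hl hne, mul_zero]

theorem IsRowBasis.reducedCost_unique (h : IsRowBasis A B) {c : Fin n → F}
    {y y' : Fin m ⊕ Fin n → F} (hy : IsReducedCost A c B y) (hy' : IsReducedCost A c B y') :
    y = y' := by
  ext q
  by_cases hq : q ∈ B
  · obtain ⟨d, hd1, hd0⟩ := h.exists_direction hq
    rw [← hy.apply_eq hq hd1 hd0, hy'.apply_eq hq hd1 hd0]
  · rw [hy.1 q hq, hy'.1 q hq]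

theorem IsReducedCost.sub_smul {c c' : Fin n → F} {y y' : Fin m ⊕ Fin n → F}
    (h : IsReducedCost A c B y) (h' : IsReducedCost A c' B y') (t : F) :
    IsReducedCost A (c - t • c') B (y - t • y') := by
  refine isReducedCost_of_dotProduct (fun l hl => ?_) fun x => ?_
  · simp [h.1 l hl, h'.1 l hl]
  · rw [sub_dotProduct, smul_dotProduct, h.dotProduct_eq, h'.dotProduct_eq, smul_eq_mul,
      Finset.mul_sum, ← Finset.sum_sub_distrib]
    refine Finset.sum_congr rfl fun l _ => ?_
    simp only [Pi.sub_apply, Pi.smul_apply, smul_eq_mul]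
    ring

/-- A cost vector whose reduced cost at `q` vanishes has the same reduced costs after `q` is
exchanged for another constraint. -/
theorem IsReducedCost.exchange {c : Fin n → F} {w : Fin m ⊕ Fin n → F}
    (h : IsReducedCost A c B w) {q : Fin m ⊕ Fin n} (hq : q ∈ B) (hw : w q = 0)
    {p : Fin m ⊕ Fin n} (hp : p ∉ B) : IsReducedCost A c (insert p (B.erase q)) w := by
  refine isReducedCost_of_dotProduct (fun l hl => ?_) fun x => ?_
  · rw [Finset.mem_insert, Finset.mem_erase, not_or, not_and_or, not_not] at hl
    rcases hl.2 with rfl | h1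
    · exact hw
    · exact h.1 l h1
  · rw [Finset.sum_insert fun h => hp (Finset.mem_of_mem_erase h), h.1 p hp, zero_mul, zero_add,
      h.dotProduct_eq, ← Finset.add_sum_erase _ _ hq, hw, zero_mul, zero_add]

/-- Reduced costs after exchanging `q` for a constraint `p` of reduced costs `z`. -/
theorem IsReducedCost.pivot {c : Fin n → F} {y z : Fin m ⊕ Fin n → F} {p q : Fin m ⊕ Fin n}
    (h : IsReducedCost A c B y) (hz : IsReducedCost A (constraintRow A p) B z) (hq : q ∈ B)
    (hp : p ∉ B) (hzq : z q ≠ 0) :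
    IsReducedCost A c (insert p (B.erase q))
      (Function.update (y - (y q / z q) • z) p (y q / z q)) := by
  set t := y q / z q
  have hw : (y - t • z) q = 0 := by
    simp only [Pi.sub_apply, Pi.smul_apply, smul_eq_mul, t]
    rw [div_mul_cancel₀ _ hzq, sub_self]
  have h1 := (h.sub_smul hz t).exchange hq hw hp
  have hp' : p ∉ B.erase q := fun h => hp (Finset.mem_of_mem_erase h)
  refine isReducedCost_of_dotProduct (fun l hl => ?_) fun x => ?_
  · have hlp : l ≠ p := fun h => hl (h ▸ Finset.mem_insert_self _ _)
    rw [Function.update_of_ne hlp]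
    exact h1.1 l hl
  · have h2 := h1.dotProduct_eq x
    have h3 : (y - t • z) p = 0 := by simp [h.1 p hp, hz.1 p hp]
    rw [Finset.sum_insert hp', h3, zero_mul, zero_add, sub_dotProduct, smul_dotProduct,
      sub_eq_iff_eq_add] at h2
    rw [Finset.sum_insert hp', Function.update_self, h2, add_comm, smul_eq_mul]
    congr 1
    refine Finset.sum_congr rfl fun l hl => ?_
    have hlp : l ≠ p := by rintro rfl; exact hp' hl
    rw [Function.update_of_ne hlp]

/-- The points activating a basis except one constraint form a line. -/
theorem IsRowBasis.eq_add_smul {B : Finset (Fin m ⊕ Fin n)} (h : IsRowBasis A B)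
    {q : Fin m ⊕ Fin n} {d : Fin n → F} (hd1 : constraintRow A q ⬝ᵥ d = 1)
    (hd0 : ∀ l ∈ B, l ≠ q → constraintRow A l ⬝ᵥ d = 0) {x y : Fin n → F}
    (hx : ∀ l ∈ B, slack A b l x = 0) (hy : ∀ l ∈ B.erase q, slack A b l y = 0) :
    y = x + slack A b q y • d := by
  rw [← sub_eq_zero]
  refine h.2 _ fun l hl => ?_
  have h1 : y - (x + slack A b q y • d) = (y - x) - slack A b q y • d := by abel
  rw [h1, dotProduct_sub, ← slack_sub (b := b), hx l hl, dotProduct_smul]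
  by_cases hlq : l = q
  · subst hlq
    rw [hd1]; simp
  · rw [hd0 l hl hlq, hy l (Finset.mem_erase.2 ⟨hlq, hl⟩)]; simp

theorem rowBasis_point_unique {B : Finset (Fin m ⊕ Fin n)} (h : IsRowBasis A B) {x y : Fin n → F}
    (hx : ∀ l ∈ B, slack A b l x = 0) (hy : ∀ l ∈ B, slack A b l y = 0) : x = y := by
  rw [← sub_eq_zero]
  refine h.2 _ fun l hl => ?_
  rw [← slack_sub (b := b), hx l hl, hy l hl, sub_self]

end Bases

section Order

variable {F : Type} [Field F] [LinearOrder F] {m n : ℕ} {A : Matrix (Fin m) (Fin n) F}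
  {b : Fin m → F} {ε : F}

/-- The objective vector `(ε, ε², …, εⁿ)`. -/
def objective (n : ℕ) (ε : F) : Fin n → F := fun j => ε ^ (j.val + 1)

theorem sat_iff {l : Fin m ⊕ Fin n} {x : Fin n → F} :
    (classicalPCBC A b ε).sat l x ↔ 0 ≤ slack A b l x := by
  rcases l with i | j
  · rfl
  · rw [slack_inr]; rfl

theorem active_iff {l : Fin m ⊕ Fin n} {x : Fin n → F} :
    (classicalPCBC A b ε).active l x ↔ slack A b l x = 0 := by
  rcases l with i | j
  · rfl
  · rw [slack_inr]; rfl

theorem mem_polyhedron_iff {k : ℕ} {x : Fin n → F} :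
    x ∈ (classicalPCBC A b ε).polyhedron k ↔ ∀ l, PCBCData.Among k l → 0 ≤ slack A b l x :=
  forall_congr' fun _ => imp_congr_right fun _ => sat_iff

theorem mem_face_iff {k : ℕ} {B : Finset (Fin m ⊕ Fin n)} {x : Fin n → F} :
    x ∈ (classicalPCBC A b ε).face k B ↔
      (∀ l, PCBCData.Among k l → 0 ≤ slack A b l x) ∧ ∀ l ∈ B, slack A b l x = 0 :=
  and_congr mem_polyhedron_iff (forall_congr' fun _ => imp_congr_right fun _ => active_iff)

theorem rule_unfold {k : Fin m} {B : Finset (Fin m ⊕ Fin n)} {out : Option (Fin m ⊕ Fin n)} :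
    (classicalPCBC A b ε).rule k B out ↔ shadowVertexRule A (objective n ε) (A k) B out := Iff.rfl

end Order

/-! ### The classical procedure on nondegenerate data -/

section ClassicalProcedure

variable {F : Type} [Field F] [LinearOrder F] {m n : ℕ}

/-- The nondegeneracy conditions under which the shadow-vertex rule is deterministic and makes
progress: all sets of `n` constraints are bases, no point activates more than `n` constraints, the
objective has positive entries and nonzero reduced costs, and the ratios minimized by the rule are
distinct. -/
structure ClassicalNondegenerate (A : Matrix (Fin m) (Fin n) F) (b : Fin m → F) (u : Fin n → F) :
    Prop where
  rowBasis : ∀ B : Finset (Fin m ⊕ Fin n), B.card = n → IsRowBasis A B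
  simple : ∀ B : Finset (Fin m ⊕ Fin n), B.card = n → ∀ x, (∀ l ∈ B, slack A b l x = 0) →
    ∀ l ∉ B, slack A b l x ≠ 0
  objective_pos : ∀ j, 0 < u j
  cost_ne : ∀ (_ : Fin m) (B : Finset (Fin m ⊕ Fin n)), B.card = n → ∀ y, IsReducedCost A u B y →
    ∀ l ∈ B, y l ≠ 0
  ratio_ne : ∀ (k : Fin m) (B : Finset (Fin m ⊕ Fin n)), B.card = n →
    (∀ l ∈ B, PCBCData.Among k l) → ∀ y z, IsReducedCost A u B y → IsReducedCost A (A k) B z →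
    ∀ l ∈ B, ∀ l' ∈ B, l ≠ l' → y l * z l' ≠ y l' * z l

variable {A : Matrix (Fin m) (Fin n) F} {b : Fin m → F} {ε : F}

theorem among_mono {k k' : ℕ} (h : k ≤ k') {l : Fin m ⊕ Fin n} (hl : PCBCData.Among k l) :
    PCBCData.Among k' l := by
  rcases l with i | j
  · exact lt_of_lt_of_le hl h
  · trivial

theorem not_among_self (k : Fin m) : ¬ PCBCData.Among k (Sum.inl k : Fin m ⊕ Fin n) :=
  lt_irrefl k.val

theorem among_succ {k : Fin m} {l : Fin m ⊕ Fin n} (h : PCBCData.Among (k.val + 1) l) :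
    PCBCData.Among k l ∨ l = Sum.inl k := by
  rcases l with i | j
  · have h1 : i.val < k.val + 1 := h
    rcases Nat.lt_succ_iff_lt_or_eq.1 h1 with h2 | h2
    · exact Or.inl h2
    · exact Or.inr (by rw [Fin.ext h2])
  · exact Or.inl trivial

/-- The invariant of the procedure. Outside of the simplex method, the current basic point is
optimal for the objective. During the simplex method, it is optimal for a combination of the
objective and of the violated inequality. When the procedure has returned, the answer is correct. -/
def Invariant (A : Matrix (Fin m) (Fin n) F) (b : Fin m → F) (ε : F) :
    Config m n (Fin n → F) → Prop
  | .loop k B x _ => k ≤ m ∧ B.card = n ∧ (∀ l ∈ B, PCBCData.Among k l) ∧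
      x ∈ (classicalPCBC A b ε).face k B ∧
      ∃ y, IsReducedCost A (objective n ε) B y ∧ ∀ l ∈ B, 0 < y l
  | .simplex k B x _ => B.card = n ∧ (∀ l ∈ B, PCBCData.Among k l) ∧
      x ∈ (classicalPCBC A b ε).face k B ∧ slack A b (Sum.inl k) x < 0 ∧
      ∃ y z t, IsReducedCost A (objective n ε) B y ∧ IsReducedCost A (A k) B z ∧ 0 ≤ t ∧
        ∀ l ∈ B, 0 ≤ y l - t * z l
  | .halt ans _ => ans = Answer.empty ↔ (classicalPCBC A b ε).polyhedron m = ∅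

theorem invariant_start (hnd : ClassicalNondegenerate A b (objective n ε)) :
    Invariant A b ε (classicalPCBC A b ε).start := by
  refine ⟨Nat.zero_le _, by simp, fun l hl => ?_, mem_face_iff.2 ⟨fun l hl => ?_, fun l hl => ?_⟩,
    fun l => Sum.elim 0 (objective n ε) l, isReducedCost_of_dotProduct (fun l hl => ?_)
      fun x => ?_, fun l hl => ?_⟩
  · obtain ⟨j, -, rfl⟩ := Finset.mem_map.1 hl
    trivial
  · rcases l with i | j
    · exact absurd hl (Nat.not_lt_zero _)
    · rw [slack_inr]; exact le_rfl
  · obtain ⟨j, -, rfl⟩ := Finset.mem_map.1 hl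
    exact slack_inr j _
  · rcases l with i | j
    · rfl
    · exact absurd (Finset.mem_map_of_mem _ (Finset.mem_univ j)) hl
  · rw [Finset.sum_map]
    refine Finset.sum_congr rfl fun j _ => ?_
    change _ = objective n ε j * (constraintRow A (Sum.inr j) ⬝ᵥ x)
    rw [constraintRow_inr]
  · obtain ⟨j, -, rfl⟩ := Finset.mem_map.1 hl
    exact hnd.objective_pos j

variable [IsStrictOrderedRing F]

/-- The data of a pivot of the simplex method at the basic point `x` of basis `B`, with leaving
variable `q`: `y` and `z` are the reduced costs of the objective and of the inequality `k`, and `d`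
is the direction of the edge leaving `q`. By the choice of `q`, the reduced costs of the objective
minus `y q / z q` times the inequality `k` are nonnegative. -/
structure PivotData (A : Matrix (Fin m) (Fin n) F) (b : Fin m → F) (ε : F) (k : Fin m)
    (B : Finset (Fin m ⊕ Fin n)) (x : Fin n → F) (q : Fin m ⊕ Fin n) (y z : Fin m ⊕ Fin n → F)
    (d : Fin n → F) : Prop where
  hy : IsReducedCost A (objective n ε) B y
  hz : IsReducedCost A (A k) B z
  hq : q ∈ B
  yq : 0 < y q
  zq : 0 < z q
  nonneg : ∀ l ∈ B, 0 ≤ y l - y q / z q * z l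
  hd1 : constraintRow A q ⬝ᵥ d = 1
  hd0 : ∀ l ∈ B, l ≠ q → constraintRow A l ⬝ᵥ d = 0
  hvd : A k ⬝ᵥ d = z q
  line : ∀ y', y' ∈ (classicalPCBC A b ε).face k (B.erase q) →
    ∃ t : F, 0 ≤ t ∧ y' = x + t • d

theorem Invariant.pivotData (hnd : ClassicalNondegenerate A b (objective n ε)) {k : Fin m}
    {B : Finset (Fin m ⊕ Fin n)} {x : Fin n → F} {N : ℕ}
    (h : Invariant A b ε (.simplex k B x N)) {q : Fin m ⊕ Fin n}
    (hrule : (classicalPCBC A b ε).rule k B (some q)) : ∃ y z d, PivotData A b ε k B x q y z d := by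
  obtain ⟨hB, hBk, hx, -, y₀, z₀, t, hy₀, hz₀, ht, hnn⟩ := h
  have hbas := hnd.rowBasis B hB
  obtain ⟨y, z, hy, hz, ⟨hq, hyq, hzq⟩, hmin⟩ := rule_unfold.1 hrule
  obtain rfl := hbas.reducedCost_unique hy₀ hy
  obtain rfl := hbas.reducedCost_unique hz₀ hz
  obtain ⟨d, hd1, hd0⟩ := hbas.exists_direction hq
  refine ⟨y₀, z₀, d, hy, hz, hq, hyq, hzq, fun l hl => ?_, hd1, hd0, hz.apply_eq hq hd1 hd0,
    fun y' hy' => ?_⟩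
  · have h1 := hnn l hl
    have h2 := hnn q hq
    have htle : t ≤ y₀ q / z₀ q := by rw [le_div_iff₀ hzq]; linarith
    rcases lt_or_ge 0 (z₀ l) with hzl | hzl
    · have hyl : 0 < y₀ l := by
        refine lt_of_le_of_ne ?_ (hnd.cost_ne k B hB y₀ hy l hl).symm
        have := mul_nonneg ht hzl.le
        linarith
      have h3 := hmin l hl hyl hzl
      rw [le_div_iff₀ hzl] at h3
      linarith
    · nlinarith
  · rw [mem_face_iff] at hy' hx
    exact ⟨slack A b q y', hy'.1 q (hBk q hq), hbas.eq_add_smul hd1 hd0 hx.2 hy'.2⟩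

/-- A pivot does not reach the violated inequality if the latter is not active on the edge. -/
theorem PivotData.pivot_lt {k : Fin m} {B : Finset (Fin m ⊕ Fin n)} {x : Fin n → F}
    {q : Fin m ⊕ Fin n} {y z : Fin m ⊕ Fin n → F} {d : Fin n → F}
    (h : PivotData A b ε k B x q y z d) (hx : x ∈ (classicalPCBC A b ε).face k B)
    (hlt : slack A b (Sum.inl k) x < 0)
    (hno : ¬ ∃ y ∈ (classicalPCBC A b ε).face k (B.erase q),
      (classicalPCBC A b ε).active (Sum.inl k) y) {t : F}
    (hface : x + t • d ∈ (classicalPCBC A b ε).face k (B.erase q)) :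
    slack A b (Sum.inl k) (x + t • d) < 0 := by
  by_contra! hge
  have hvd : constraintRow A (Sum.inl k) ⬝ᵥ d = z q := h.hvd
  rw [slack_add_smul, hvd] at hge
  set s := -slack A b (Sum.inl k) x / z q with hs
  have hs0 : 0 < s := div_pos (by linarith) h.zq
  have hst : s ≤ t := by rw [hs, div_le_iff₀ h.zq]; linarith
  rw [mem_face_iff] at hx hface
  refine hno ⟨x + s • d, mem_face_iff.2 ⟨fun l hl => ?_, fun l hl => ?_⟩, active_iff.2 ?_⟩
  · have h1 := hx.1 l hl
    have h2 := hface.1 l hl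
    rw [slack_add_smul] at h2 ⊢
    rcases le_or_gt 0 (constraintRow A l ⬝ᵥ d) with h3 | h3
    · have := mul_nonneg hs0.le h3
      linarith
    · nlinarith
  · have hl' := Finset.mem_erase.1 hl
    rw [slack_add_smul, hx.2 l hl'.2, h.hd0 l hl'.2 hl'.1, mul_zero, add_zero]
  · rw [slack_add_smul, hvd, hs, div_mul_cancel₀ _ h.zq.ne']
    ring

/-- In the case `infeasible`, the reduced costs of the violated inequality are nonpositive, so that
its maximum over the polyhedron is attained at the current point. -/
theorem Invariant.step (hnd : ClassicalNondegenerate A b (objective n ε))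
    {c c' : Config m n (Fin n → F)} (h : Invariant A b ε c)
    (hs : (classicalPCBC A b ε).Step c c') : Invariant A b ε c' := by
  cases hs with
  | finish k hk B x N =>
    obtain ⟨-, -, -, hx, -⟩ := h
    subst hk
    refine ⟨nofun, fun h => ?_⟩
    exact absurd hx.1 (by rw [h]; exact Set.notMem_empty x)
  | keep k hk B x N hsat =>
    obtain ⟨-, hB, hBk, hx, hy⟩ := h
    refine ⟨hk, hB, fun l hl => among_mono (Nat.le_succ k) (hBk l hl), ?_, hy⟩
    rw [mem_face_iff] at hx ⊢
    refine ⟨fun l hl => ?_, hx.2⟩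
    rcases among_succ (k := ⟨k, hk⟩) hl with h1 | rfl
    · exact hx.1 l h1
    · exact sat_iff.1 hsat
  | enter k hk B x N hsat =>
    obtain ⟨-, hB, hBk, hx, y, hy, hpos⟩ := h
    obtain ⟨z, hz⟩ := (hnd.rowBasis B hB).exists_isReducedCost (A ⟨k, hk⟩)
    refine ⟨hB, hBk, hx, ?_, y, z, 0, hy, hz, le_rfl, fun l hl => ?_⟩
    · rw [sat_iff, not_le] at hsat
      exact hsat
    · rw [zero_mul, sub_zero]; exact (hpos l hl).le
  | infeasible k B x N hrule =>
    obtain ⟨hB, hBk, hx, hlt, y₀, z₀, t, hy₀, hz₀, ht, hnn⟩ := h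
    have hbas := hnd.rowBasis B hB
    obtain ⟨y, z, hy, hz, hno⟩ := rule_unfold.1 hrule
    obtain rfl := hbas.reducedCost_unique hy₀ hy
    obtain rfl := hbas.reducedCost_unique hz₀ hz
    refine ⟨fun _ => ?_, fun _ => rfl⟩
    rw [Set.eq_empty_iff_forall_notMem]
    intro x' hx'
    rw [mem_polyhedron_iff] at hx'
    rw [mem_face_iff] at hx
    have hz_nonpos : ∀ l ∈ B, z₀ l ≤ 0 := fun l hl => by
      by_contra! hzl
      refine hno l hl ⟨lt_of_le_of_ne ?_ (hnd.cost_ne k B hB y₀ hy l hl).symm, hzl⟩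
      have h1 := hnn l hl
      have := mul_nonneg ht hzl.le
      linarith
    have h1 : slack A b (Sum.inl k) x' - slack A b (Sum.inl k) x
        = ∑ l ∈ B, z₀ l * (constraintRow A l ⬝ᵥ (x' - x)) := by
      rw [slack_sub]
      exact hz.dotProduct_eq _
    have h2 : ∑ l ∈ B, z₀ l * (constraintRow A l ⬝ᵥ (x' - x)) ≤ 0 := by
      refine Finset.sum_nonpos fun l hl => ?_
      rw [← slack_sub (b := b), hx.2 l hl, sub_zero]
      refine mul_nonpos_of_nonpos_of_nonneg (hz_nonpos l hl) (hx' l ?_)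
      exact among_mono k.2.le (hBk l hl)
    have h3 := hx' (Sum.inl k) k.2
    linarith
  | hit k B x N q hrule x' hx' hact =>
    obtain ⟨y, z, d, hp⟩ := h.pivotData hnd hrule
    obtain ⟨hB, hBk, -⟩ := h
    have hkB : (Sum.inl k : Fin m ⊕ Fin n) ∉ B := fun h => not_among_self k (hBk _ h)
    have hcard : (insert (Sum.inl k) (B.erase q)).card = n := by
      rw [card_exchange hkB hp.hq, hB]
    have hcost := hp.hy.pivot (p := Sum.inl k) hp.hz hp.hq hkB hp.zq.ne'
    refine ⟨k.2, hcard, fun l hl => ?_, mem_face_iff.2 ⟨fun l hl => ?_, fun l hl => ?_⟩, _, hcost,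
      fun l hl => ?_⟩
    · rcases Finset.mem_insert.1 hl with rfl | h1
      · exact Nat.lt_succ_self k.val
      · exact among_mono (Nat.le_succ _) (hBk l (Finset.mem_of_mem_erase h1))
    · rcases among_succ hl with h1 | rfl
      · exact (mem_face_iff.1 hx').1 l h1
      · exact (active_iff.1 hact).ge
    · rcases Finset.mem_insert.1 hl with rfl | h1
      · exact active_iff.1 hact
      · exact (mem_face_iff.1 hx').2 l h1
    · refine lt_of_le_of_ne ?_ (hnd.cost_ne k _ hcard _ hcost l hl).symm
      rcases Finset.mem_insert.1 hl with rfl | h1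
      · rw [Function.update_self]; exact (div_pos hp.yq hp.zq).le
      · have hne : l ≠ Sum.inl k := fun h => hkB (h ▸ Finset.mem_of_mem_erase h1)
        rw [Function.update_of_ne hne]
        exact hp.nonneg l (Finset.mem_of_mem_erase h1)
  | pivot k B x N q hrule hno p hpk hpB x' hx' =>
    obtain ⟨y, z, d, hp⟩ := h.pivotData hnd hrule
    obtain ⟨hB, hBk, hx, hlt, -⟩ := h
    have hcard : (insert p (B.erase q)).card = n := by rw [card_exchange hpB hp.hq, hB]
    have hbas := hnd.rowBasis _ hcard
    obtain ⟨y', hy'⟩ := hbas.exists_isReducedCost (objective n ε)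
    obtain ⟨z', hz'⟩ := hbas.exists_isReducedCost (A k)
    have hedge : x' ∈ (classicalPCBC A b ε).face k (B.erase q) :=
      ⟨hx'.1, fun l hl => hx'.2 l (Finset.mem_insert_of_mem hl)⟩
    obtain ⟨t, ht, rfl⟩ := hp.line x' hedge
    refine ⟨hcard, fun l hl => ?_, hx', hp.pivot_lt hx hlt hno hedge, y', z', y q / z q, hy',
      hz', (div_pos hp.yq hp.zq).le, fun l hl => ?_⟩
    · rcases Finset.mem_insert.1 hl with rfl | h1
      · exact hpk
      · exact hBk l (Finset.mem_of_mem_erase h1)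
    · have hw : (y - (y q / z q) • z) q = 0 := by
        simp only [Pi.sub_apply, Pi.smul_apply, smul_eq_mul]
        rw [div_mul_cancel₀ _ hp.zq.ne', sub_self]
      have h1 := (hp.hy.sub_smul hp.hz (y q / z q)).exchange hp.hq hw hpB
      have h2 := hbas.reducedCost_unique (hy'.sub_smul hz' (y q / z q)) h1
      have h3 := congrFun h2 l
      simp only [Pi.sub_apply, Pi.smul_apply, smul_eq_mul] at h3
      rw [h3]
      by_cases hlB : l ∈ B
      · exact hp.nonneg l hlB
      · rw [hp.hy.1 l hlB, hp.hz.1 l hlB]; simp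

end ClassicalProcedure

/-! ### Determinism and termination of the classical procedure -/

section ClassicalExecution

variable {F : Type} [Field F] [LinearOrder F] {m n : ℕ}
  {A : Matrix (Fin m) (Fin n) F} {b : Fin m → F} {ε : F} {k : Fin m}
  {B : Finset (Fin m ⊕ Fin n)} {x : Fin n → F} {N : ℕ}

theorem rule_unique (hnd : ClassicalNondegenerate A b (objective n ε)) (hB : B.card = n)
    (hBk : ∀ l ∈ B, PCBCData.Among k l) {out out' : Option (Fin m ⊕ Fin n)}
    (h : (classicalPCBC A b ε).rule k B out) (h' : (classicalPCBC A b ε).rule k B out') :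
    out = out' := by
  have hbas := hnd.rowBasis B hB
  obtain ⟨y, z, hy, hz, h⟩ := rule_unfold.1 h
  obtain ⟨y', z', hy', hz', h'⟩ := rule_unfold.1 h'
  obtain rfl := hbas.reducedCost_unique hy hy'
  obtain rfl := hbas.reducedCost_unique hz hz'
  rcases out with - | q <;> rcases out' with - | q'
  · rfl
  · exact absurd h'.1.2 (h q' h'.1.1)
  · exact absurd h.1.2 (h' q h.1.1)
  · obtain ⟨⟨hq, hyq, hzq⟩, hmin⟩ := h
    obtain ⟨⟨hq', hyq', hzq'⟩, hmin'⟩ := h'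
    by_contra hne
    have hne' : q ≠ q' := fun h => hne (congrArg some h)
    have h1 := le_antisymm (hmin q' hq' hyq' hzq') (hmin' q hq hyq hzq)
    rw [div_eq_div_iff hzq.ne' hzq'.ne'] at h1
    exact hnd.ratio_ne k B hB hBk y z hy hz q hq q' hq' hne' h1

theorem exists_rule (hnd : ClassicalNondegenerate A b (objective n ε)) (hB : B.card = n) :
    ∃ out, (classicalPCBC A b ε).rule k B out := by
  have hbas := hnd.rowBasis B hB
  obtain ⟨y, hy⟩ := hbas.exists_isReducedCost (objective n ε)
  obtain ⟨z, hz⟩ := hbas.exists_isReducedCost (A k)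
  let C := B.filter fun l => 0 < y l ∧ 0 < z l
  rcases C.eq_empty_or_nonempty with h | h
  · refine ⟨none, y, z, hy, hz, fun l hl hpos => ?_⟩
    have : l ∈ C := Finset.mem_filter.2 ⟨hl, hpos⟩
    rw [h] at this
    exact Finset.notMem_empty l this
  · obtain ⟨q, hq, hmin⟩ := Finset.exists_min_image C (fun l => y l / z l) h
    have hq' := Finset.mem_filter.1 hq
    exact ⟨some q, y, z, hy, hz, hq', fun l hl hyl hzl =>
      hmin l (Finset.mem_filter.2 ⟨hl, hyl, hzl⟩)⟩

variable [IsStrictOrderedRing F]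

/-- A constraint becoming active along an edge does so at a positive time, after which it is
violated. -/
theorem blocking_time (hnd : ClassicalNondegenerate A b (objective n ε)) (hB : B.card = n)
    {d : Fin n → F} (hx : x ∈ (classicalPCBC A b ε).face k B) {p : Fin m ⊕ Fin n}
    (hpk : PCBCData.Among k p) (hpB : p ∉ B) {t : F} (ht : 0 ≤ t)
    (hact : slack A b p (x + t • d) = 0) :
    0 < t ∧ ∀ s, 0 ≤ slack A b p (x + s • d) → s ≤ t := by
  rw [mem_face_iff] at hx
  have h1 : 0 < slack A b p x := lt_of_le_of_ne (hx.1 p hpk) (hnd.simple B hB x hx.2 p hpB).symm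
  rw [slack_add_smul] at hact
  have ht0 : 0 < t := lt_of_le_of_ne ht (by rintro rfl; rw [zero_mul, add_zero] at hact; linarith)
  have h2 : constraintRow A p ⬝ᵥ d < 0 := by
    by_contra! h
    have := mul_nonneg ht h
    linarith
  refine ⟨ht0, fun s hs => ?_⟩
  rw [slack_add_smul] at hs
  nlinarith

/-- The state after a pivot is unique: two constraints blocking the motion along the edge at
different times cannot both be reached, and at the same time they would be active together. -/
theorem Invariant.step_unique (hnd : ClassicalNondegenerate A b (objective n ε))
    {c c₁ c₂ : Config m n (Fin n → F)} (h : Invariant A b ε c)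
    (h₁ : (classicalPCBC A b ε).Step c c₁) (h₂ : (classicalPCBC A b ε).Step c c₂) : c₁ = c₂ := by
  cases h₁ with
  | finish k hk B x N =>
    cases h₂ with
    | finish => rfl
    | keep _ hk' => exact absurd hk' (by omega)
    | enter _ hk' => exact absurd hk' (by omega)
  | keep k hk B x N hsat =>
    cases h₂ with
    | finish _ hk' => exact absurd hk' (by omega)
    | keep => rfl
    | enter _ _ _ _ _ hsat' => exact absurd hsat hsat'
  | enter k hk B x N hsat =>
    cases h₂ with
    | finish _ hk' => exact absurd hk' (by omega)
    | keep _ _ _ _ _ hsat' => exact absurd hsat' hsat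
    | enter => rfl
  | infeasible k B x N hrule =>
    cases h₂ with
    | infeasible => rfl
    | hit _ _ _ _ q hrule' => exact absurd (rule_unique hnd h.1 h.2.1 hrule hrule') (by simp)
    | pivot _ _ _ _ q hrule' => exact absurd (rule_unique hnd h.1 h.2.1 hrule hrule') (by simp)
  | hit k B x N q hrule x₁ hx₁ hact =>
    cases h₂ with
    | infeasible _ _ _ _ hrule' =>
      exact absurd (rule_unique hnd h.1 h.2.1 hrule hrule') (by simp)
    | hit _ _ _ _ q' hrule' x₂ hx₂ hact' =>
      obtain rfl : q = q' := Option.some_injective _ (rule_unique hnd h.1 h.2.1 hrule hrule')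
      obtain ⟨y, z, d, hp⟩ := h.pivotData hnd hrule
      have hkB : (Sum.inl k : Fin m ⊕ Fin n) ∉ B := fun hk => not_among_self k (h.2.1 _ hk)
      have hcard : (insert (Sum.inl k) (B.erase q)).card = n := by
        rw [card_exchange hkB hp.hq, h.1]
      have hall : ∀ x', x' ∈ (classicalPCBC A b ε).face k (B.erase q) →
          (classicalPCBC A b ε).active (Sum.inl k) x' →
          ∀ l ∈ insert (Sum.inl k) (B.erase q), slack A b l x' = 0 := by
        intro x' hx' hact l hl
        rcases Finset.mem_insert.1 hl with rfl | hl
        · exact active_iff.1 hact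
        · exact (mem_face_iff.1 hx').2 l hl
      rw [rowBasis_point_unique (hnd.rowBasis _ hcard) (hall x₁ hx₁ hact) (hall x₂ hx₂ hact')]
    | pivot _ _ _ _ q' hrule' hno =>
      obtain rfl : q = q' := Option.some_injective _ (rule_unique hnd h.1 h.2.1 hrule hrule')
      exact absurd ⟨x₁, hx₁, hact⟩ hno
  | pivot k B x N q hrule hno p hpk hpB x₁ hx₁ =>
    cases h₂ with
    | infeasible _ _ _ _ hrule' =>
      exact absurd (rule_unique hnd h.1 h.2.1 hrule hrule') (by simp)
    | hit _ _ _ _ q' hrule' x₂ hx₂ hact =>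
      obtain rfl : q = q' := Option.some_injective _ (rule_unique hnd h.1 h.2.1 hrule hrule')
      exact absurd ⟨x₂, hx₂, hact⟩ hno
    | pivot _ _ _ _ q' hrule' _ p' hpk' hpB' x₂ hx₂ =>
      obtain rfl : q = q' := Option.some_injective _ (rule_unique hnd h.1 h.2.1 hrule hrule')
      obtain ⟨y, z, d, hp⟩ := h.pivotData hnd hrule
      have hedge : ∀ p x', x' ∈ (classicalPCBC A b ε).face k (insert p (B.erase q)) →
          ∃ t : F, 0 ≤ t ∧ x' = x + t • d := fun p x' hx' =>
        hp.line x' ⟨hx'.1, fun l hl => hx'.2 l (Finset.mem_insert_of_mem hl)⟩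
      obtain ⟨t₁, ht₁, rfl⟩ := hedge p x₁ hx₁
      obtain ⟨t₂, ht₂, rfl⟩ := hedge p' x₂ hx₂
      rw [mem_face_iff] at hx₁ hx₂
      have h1 := blocking_time hnd h.1 h.2.2.1 hpk hpB ht₁
        (hx₁.2 p (Finset.mem_insert_self _ _))
      have h2 := blocking_time hnd h.1 h.2.2.1 hpk' hpB' ht₂
        (hx₂.2 p' (Finset.mem_insert_self _ _))
      have ht : t₁ = t₂ := le_antisymm (h2.2 _ (hx₁.1 p' hpk')) (h1.2 _ (hx₂.1 p hpk))
      subst ht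
      have hpp : p = p' := by
        by_contra hne
        have hcard : (insert p (B.erase q)).card = n := by rw [card_exchange hpB hp.hq, h.1]
        refine hnd.simple _ hcard _ hx₁.2 p' ?_ (hx₂.2 p' (Finset.mem_insert_self _ _))
        rw [Finset.mem_insert, not_or]
        exact ⟨fun h => hne h.symm, fun h => hpB' (Finset.mem_of_mem_erase h)⟩
      subst hpp
      rfl

/-- The procedure does not stop before returning: if no inequality blocks the motion along the
edge, the violated inequality becomes active. -/
theorem Invariant.exists_halt (hnd : ClassicalNondegenerate A b (objective n ε))
    {c : Config m n (Fin n → F)} (h : Invariant A b ε c)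
    (hterm : ∀ c', ¬ (classicalPCBC A b ε).Step c c') : ∃ ans N, c = .halt ans N := by
  classical
  cases c with
  | halt ans N => exact ⟨ans, N, rfl⟩
  | loop k B x N =>
    exfalso
    by_cases hk : k = m
    · exact hterm _ (.finish k hk B x N)
    · have hk' : k < m := lt_of_le_of_ne h.1 hk
      by_cases hsat : (classicalPCBC A b ε).sat (Sum.inl ⟨k, hk'⟩) x
      · exact hterm _ (.keep k hk' B x N hsat)
      · exact hterm _ (.enter k hk' B x N hsat)
  | simplex k B x N =>
    exfalso
    obtain ⟨out, hrule⟩ := exists_rule (k := k) hnd h.1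
    rcases out with - | q
    · exact hterm _ (.infeasible k B x N hrule)
    by_cases hno : ∃ y ∈ (classicalPCBC A b ε).face k (B.erase q),
        (classicalPCBC A b ε).active (Sum.inl k) y
    · obtain ⟨x', hx', hact⟩ := hno
      exact hterm _ (.hit k B x N q hrule x' hx' hact)
    obtain ⟨y, z, d, hp⟩ := h.pivotData hnd hrule
    obtain ⟨hB, hBk, hx, hlt, -⟩ := h
    have hx' := mem_face_iff.1 hx
    have herase : ∀ t : F, ∀ l ∈ B.erase q, slack A b l (x + t • d) = 0 := fun t l hl => by
      have hl' := Finset.mem_erase.1 hl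
      rw [slack_add_smul, hx'.2 l hl'.2, hp.hd0 l hl'.2 hl'.1, mul_zero, add_zero]
    -- the constraints whose slack decreases along the edge
    let T := Finset.univ.filter fun l => l ∉ B ∧ PCBCData.Among k l ∧ constraintRow A l ⬝ᵥ d < 0
    have hfeas : ∀ t : F, 0 ≤ t → (∀ l ∈ T, 0 ≤ slack A b l (x + t • d)) →
        x + t • d ∈ (classicalPCBC A b ε).polyhedron k := by
      intro t ht hT
      refine mem_polyhedron_iff.2 fun l hl => ?_
      by_cases hlB : l ∈ B
      · by_cases hlq : l = q
        · subst hlq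
          rw [slack_add_smul, hx'.2 l hlB, hp.hd1]
          linarith
        · exact (herase t l (Finset.mem_erase.2 ⟨hlq, hlB⟩)).ge
      · rcases lt_or_ge (constraintRow A l ⬝ᵥ d) 0 with h1 | h1
        · exact hT l (Finset.mem_filter.2 ⟨Finset.mem_univ l, hlB, hl, h1⟩)
        · rw [slack_add_smul]
          exact add_nonneg (hx'.1 l hl) (mul_nonneg ht h1)
    rcases T.eq_empty_or_nonempty with hTe | hTne
    · have hvd : constraintRow A (Sum.inl k) ⬝ᵥ d = z q := hp.hvd
      have hs : 0 ≤ -slack A b (Sum.inl k) x / z q := (div_pos (by linarith) hp.zq).le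
      refine hno ⟨x + (-slack A b (Sum.inl k) x / z q) • d, ⟨hfeas _ hs fun l hl => ?_,
        fun l hl => active_iff.2 (herase _ l hl)⟩, active_iff.2 ?_⟩
      · rw [hTe] at hl
        exact absurd hl (Finset.notMem_empty l)
      · rw [slack_add_smul, hvd, div_mul_cancel₀ _ hp.zq.ne']
        ring
    · obtain ⟨p, hpT, hmin⟩ := Finset.exists_min_image T
        (fun l => slack A b l x / -(constraintRow A l ⬝ᵥ d)) hTne
      obtain ⟨-, hpB, hpk, hpd⟩ := Finset.mem_filter.1 hpT
      set t := slack A b p x / -(constraintRow A p ⬝ᵥ d) with ht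
      have ht0 : 0 ≤ t := div_nonneg (hx'.1 p hpk) (by linarith)
      refine hterm _ (.pivot k B x N q hrule hno p hpk hpB (x + t • d)
        ⟨hfeas t ht0 fun l hl => ?_, fun l hl => active_iff.2 ?_⟩)
      · obtain ⟨-, -, -, hld⟩ := Finset.mem_filter.1 hl
        have h1 := hmin l hl
        rw [le_div_iff₀ (by linarith)] at h1
        rw [slack_add_smul]
        linarith
      · rcases Finset.mem_insert.1 hl with rfl | hl'
        · have h1 : t * -(constraintRow A l ⬝ᵥ d) = slack A b l x := by
            rw [ht, div_mul_cancel₀]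
            linarith
          rw [slack_add_smul]
          linarith
        · exact herase t l hl'

open Classical in
/-- A measure of the work left, in lexicographic order. During the simplex method, it counts the bases whose basic point
is better for the violated inequality than the current one. -/
noncomputable def workLeft (A : Matrix (Fin m) (Fin n) F) (b : Fin m → F) :
    Config m n (Fin n → F) → ℕ ×ₗ ℕ
  | .loop k _ _ _ => toLex (m + 1 - k, Fintype.card (Finset (Fin m ⊕ Fin n)) + 1)
  | .simplex k _ x _ => toLex (m + 1 - k, (Finset.univ.filter fun B' : Finset (Fin m ⊕ Fin n) =>
      B'.card = n ∧ ∃ x', (∀ l ∈ B', slack A b l x' = 0) ∧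
        slack A b (Sum.inl k) x < slack A b (Sum.inl k) x').card)
  | .halt _ _ => toLex (0, 0)

theorem Invariant.workLeft_lt (hnd : ClassicalNondegenerate A b (objective n ε))
    {c c' : Config m n (Fin n → F)} (h : Invariant A b ε c)
    (hs : (classicalPCBC A b ε).Step c c') : workLeft A b c' < workLeft A b c := by
  classical
  cases hs with
  | finish k hk B x N =>
    refine Prod.Lex.toLex_lt_toLex.2 (Or.inl ?_)
    change 0 < m + 1 - k
    omega
  | keep k hk B x N hsat =>
    refine Prod.Lex.toLex_lt_toLex.2 (Or.inl ?_)
    change m + 1 - (k + 1) < m + 1 - k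
    omega
  | enter k hk B x N hsat =>
    refine Prod.Lex.toLex_lt_toLex.2 (Or.inr ⟨rfl, ?_⟩)
    dsimp only
    exact Nat.lt_succ_of_le (Finset.card_le_univ _)
  | infeasible k B x N hrule =>
    refine Prod.Lex.toLex_lt_toLex.2 (Or.inl ?_)
    change 0 < m + 1 - k.val
    omega
  | hit k B x N q hrule x' hx' hact =>
    refine Prod.Lex.toLex_lt_toLex.2 (Or.inl ?_)
    change m + 1 - (k.val + 1) < m + 1 - k.val
    omega
  | pivot k B x N q hrule hno p hpk hpB x' hx' =>
    obtain ⟨y, z, d, hp⟩ := h.pivotData hnd hrule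
    have hcard : (insert p (B.erase q)).card = n := by rw [card_exchange hpB hp.hq, h.1]
    have hxx' : slack A b (Sum.inl k) x < slack A b (Sum.inl k) x' := by
      obtain ⟨t, ht, rfl⟩ :=
        hp.line x' ⟨hx'.1, fun l hl => hx'.2 l (Finset.mem_insert_of_mem hl)⟩
      have h1 := blocking_time hnd h.1 h.2.2.1 hpk hpB ht
        ((mem_face_iff.1 hx').2 p (Finset.mem_insert_self _ _))
      have hvd : constraintRow A (Sum.inl k) ⬝ᵥ d = z q := hp.hvd
      rw [slack_add_smul, hvd]
      have := mul_pos h1.1 hp.zq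
      linarith
    refine Prod.Lex.toLex_lt_toLex.2 (Or.inr ⟨rfl, ?_⟩)
    dsimp only
    refine Finset.card_lt_card ?_
    rw [Finset.ssubset_iff_of_subset]
    · refine ⟨insert p (B.erase q), ?_, ?_⟩
      · rw [Finset.mem_filter]
        exact ⟨Finset.mem_univ _, hcard, x', (mem_face_iff.1 hx').2, hxx'⟩
      · rw [Finset.mem_filter]
        rintro ⟨-, -, x'', hx'', hlt⟩
        rw [rowBasis_point_unique (hnd.rowBasis _ hcard) hx'' (mem_face_iff.1 hx').2] at hlt
        exact lt_irrefl _ hlt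
    · intro B' hB'
      rw [Finset.mem_filter] at hB' ⊢
      obtain ⟨-, h1, x'', hx'', hlt⟩ := hB'
      exact ⟨Finset.mem_univ _, h1, x'', hx'', hxx'.trans hlt⟩

theorem Invariant.acc (hnd : ClassicalNondegenerate A b (objective n ε))
    {c : Config m n (Fin n → F)} (h : Invariant A b ε c) :
    Acc (fun c d => (classicalPCBC A b ε).Step d c) c := by
  induction hw : workLeft A b c using WellFoundedLT.induction generalizing c with
  | ind w ih =>
    refine Acc.intro c fun c' hs => ih _ ?_ (h.step hnd hs) rfl
    rw [← hw]
    exact h.workLeft_lt hnd hs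

end ClassicalExecution

/-! ### Lifts of strongly nondegenerate data are nondegenerate -/

section LiftNondegenerate

variable {m n p q : ℕ}

theorem IsDominant.sign_eval {ι : Type} {P : MvPolynomial ι PuiseuxSeries} {x : ι → SignedTrop}
    {α : ι →₀ ℕ} (h : IsDominant P x α) {x' : ι → PuiseuxSeries} (hx : ∀ i, sval (x' i) = x i) :
    SignType.sign (MvPolynomial.eval x' P) = (tropEval P x).sgn := by
  rw [← h.sval_eval hx, sval_sgn]

theorem eval_minor_variableMatrix (M : Matrix (Fin p) (Fin q) PuiseuxSeries) (K : Finset (Fin p))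
    (L : Finset (Fin q)) :
    MvPolynomial.eval (fun e => M e.1 e.2) (minor (variableMatrix p q) K L) = minor M K L := by
  let φ : MvPolynomial (Fin p × Fin q) PuiseuxSeries →+* PuiseuxSeries :=
    MvPolynomial.eval fun e => M e.1 e.2
  have h : (variableMatrix p q).map φ = M := by
    ext1 i j
    exact MvPolynomial.eval_X (i, j)
  exact (map_minor φ (variableMatrix p q) K L).trans (by rw [h])

theorem StronglyNondegenerate.minor_ne_zero {A : Matrix (Fin p) (Fin q) SignedTrop}
    (hA : StronglyNondegenerate A) {A' : Matrix (Fin p) (Fin q) PuiseuxSeries}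
    (h : ∀ i j, sval (A' i j) = A i j) {K : Finset (Fin p)} {L : Finset (Fin q)}
    (hKL : K.card = L.card) : minor A' K L ≠ 0 := by
  obtain ⟨α, hα⟩ := exists_isDominant_minor hKL (fun e => A e.1 e.2)
    (hA _ (K.orderEmbOfFin hKL).toEmbedding (L.orderEmbOfFin rfl).toEmbedding)
  rw [← eval_minor_variableMatrix]
  exact hα.eval_ne_zero fun e => h e.1 e.2

/-- Any `n` rows of a lift of a strongly nondegenerate matrix and of the identity are independent,
as their determinant is a minor of the lift up to sign. -/
theorem StronglyNondegenerate.isRowBasis {A : Matrix (Fin m) (Fin n) SignedTrop}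
    (hA : StronglyNondegenerate A) {A' : Matrix (Fin m) (Fin n) PuiseuxSeries}
    (h : ∀ i j, sval (A' i j) = A i j) {B : Finset (Fin m ⊕ Fin n)} (hB : B.card = n) :
    IsRowBasis A' B := by
  refine ⟨hB, fun d hd => ?_⟩
  let e := B.equivFinOfCardEq hB
  let ρ : Fin n → Fin m ⊕ Fin n := fun a => (e.symm a).1
  have hρ : Function.Injective ρ := fun a b h => e.symm.injective (Subtype.ext h)
  obtain ⟨hcard, hdet⟩ := det_rows_eq_minor A' ρ hρ
  have hne := hA.minor_ne_zero h hcard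
  by_contra hd0
  have h0 : (Matrix.of fun a => Sum.elim A' (1 : Matrix (Fin n) (Fin n) PuiseuxSeries) (ρ a)).det
      = 0 := by
    refine Matrix.exists_mulVec_eq_zero_iff.1 ⟨d, hd0, ?_⟩
    ext1 a
    exact hd (ρ a) (e.symm a).2
  rcases hdet with h1 | h1
  · exact hne (h1.symm.trans h0)
  · exact hne (neg_eq_zero.1 (h1.symm.trans h0))

/-- The matrix `(A b)`, with columns indexed by `Fin (n + 1)`. -/
def augmentFin {R : Type*} (A : Matrix (Fin m) (Fin n) R) (b : Fin m → R) :
    Matrix (Fin m) (Fin (n + 1)) R :=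
  (augment A b).submatrix id finSumFinEquiv.symm

theorem StronglyNondegenerate.augmentFin {A : Matrix (Fin m) (Fin n) SignedTrop}
    {b : Fin m → SignedTrop} (h : StronglyNondegenerate (augment A b)) :
    StronglyNondegenerate (augmentFin A b) := fun p f g =>
  h p f (g.trans finSumFinEquiv.symm.toEmbedding)

/-- A point activating more than `n` constraints would give a nonzero vector in the kernel of a
nonsingular submatrix of `(A b)` bordered by unit rows. -/
theorem StronglyNondegenerate.slack_ne_zero {A : Matrix (Fin m) (Fin n) SignedTrop}
    {b : Fin m → SignedTrop} (hAb : StronglyNondegenerate (augment A b))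
    {A' : Matrix (Fin m) (Fin n) PuiseuxSeries} {b' : Fin m → PuiseuxSeries}
    (hA : ∀ i j, sval (A' i j) = A i j) (hb : ∀ i, sval (b' i) = b i)
    {B : Finset (Fin m ⊕ Fin n)} (hB : B.card = n) {x : Fin n → PuiseuxSeries}
    (hx : ∀ l ∈ B, slack A' b' l x = 0) {l : Fin m ⊕ Fin n} (hl : l ∉ B) :
    slack A' b' l x ≠ 0 := by
  classical
  intro hl0
  have hx' : ∀ l' ∈ insert l B, slack A' b' l' x = 0 := by
    intro l' hl'
    rcases Finset.mem_insert.1 hl' with rfl | hl'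
    · exact hl0
    · exact hx l' hl'
  let ι : Fin m ⊕ Fin n ↪ Fin m ⊕ Fin (n + 1) :=
    (Function.Embedding.refl _).sumMap Fin.castSuccEmb
  have hcard : ((insert l B).map ι).card = n + 1 := by
    rw [Finset.card_map, Finset.card_insert_of_notMem hl, hB]
  have hbas := hAb.augmentFin.isRowBasis (A' := _root_.augmentFin A' b') (fun i j => by
    obtain ⟨c, rfl⟩ := finSumFinEquiv.surjective j
    rcases c with c | c <;>
      simp [_root_.augmentFin, hA, hb]) hcard
  have h0 := hbas.2 (Fin.snoc x 1) (by
    intro l'' hl''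
    obtain ⟨l', hl', rfl⟩ := Finset.mem_map.1 hl''
    have h1 := hx' l' hl'
    rcases l' with i | j
    · rw [slack_inl] at h1
      rw [← h1]
      change (fun c => augment A' b' i (finSumFinEquiv.symm c)) ⬝ᵥ _ = _
      simp only [dotProduct]
      rw [Fin.sum_univ_castSucc]
      congr 1
      · refine Finset.sum_congr rfl fun j _ => ?_
        rw [Fin.snoc_castSucc]
        have h2 : finSumFinEquiv.symm j.castSucc = (Sum.inl j : Fin n ⊕ Fin 1) :=
          finSumFinEquiv_symm_apply_castAdd (n := 1) j
        rw [h2]; rfl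
      · rw [Fin.snoc_last, mul_one]
        have h2 : finSumFinEquiv.symm (Fin.last n) = (Sum.inr 0 : Fin n ⊕ Fin 1) :=
          finSumFinEquiv_symm_apply_natAdd (m := n) 0
        rw [h2]; rfl
    · rw [slack_inr] at h1
      change constraintRow _ (Sum.inr j.castSucc) ⬝ᵥ _ = _
      rw [constraintRow_inr, Fin.snoc_castSucc, h1])
  have h1 := congrFun h0 (Fin.last n)
  rw [Fin.snoc_last] at h1
  exact one_ne_zero h1

end LiftNondegenerate

/-! ### The two pivoting rules agree -/

section Rules

/-- The matrix with rows `A`, `u`, `v`: the classical counterpart of `stack`. -/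
def extendRows {R : Type*} {m n : ℕ} (A : Matrix (Fin m) (Fin n) R) (u v : Fin n → R) :
    Matrix (Fin (m + 2)) (Fin n) R :=
  Matrix.of (Fin.append A ![u, v])

theorem extendRows_castAdd {R : Type*} {m n : ℕ} (A : Matrix (Fin m) (Fin n) R) (u v : Fin n → R)
    (i : Fin m) : extendRows A u v (Fin.castAdd 2 i) = A i :=
  Fin.append_left A ![u, v] i

theorem extendRows_natAdd {R : Type*} {m n : ℕ} (A : Matrix (Fin m) (Fin n) R) (u v : Fin n → R)
    (r : Fin 2) : extendRows A u v (Fin.natAdd m r) = ![u, v] r :=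
  Fin.append_right A ![u, v] r

section OrderedField

variable {F : Type} [Field F] {m n : ℕ}
  {A : Matrix (Fin m) (Fin n) F} {u v : Fin n → F} {B : Finset (Fin m ⊕ Fin n)}

theorem basisMinor_mul_reducedCost (hB : B.card = n) (r : Fin 2) {y : Fin m ⊕ Fin n → F}
    (hy : IsReducedCost A (![u, v] r) B y) {l : Fin m ⊕ Fin n} (hl : l ∈ B) :
    basisMinor (extendRows A u v) B * y l
      = (-1) ^ costExp B l * costMinor (extendRows A u v) B r l := by
  rw [basisMinor_mul (extendRows A u v) hB r y 1 _ hl, one_mul]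
  intro j
  rw [one_mul, extendRows_natAdd]
  simp only [extendRows_castAdd]
  exact hy.2 j

variable [LinearOrder F] [IsStrictOrderedRing F]

theorem sign_reducedCost (hB : B.card = n) (r : Fin 2) {y : Fin m ⊕ Fin n → F}
    (hy : IsReducedCost A (![u, v] r) B y) {l : Fin m ⊕ Fin n} (hl : l ∈ B) :
    SignType.sign (basisMinor (extendRows A u v) B) * SignType.sign (y l)
      = costSign B l * SignType.sign (costMinor (extendRows A u v) B r l) := by
  rw [← sign_mul, basisMinor_mul_reducedCost hB r hy hl, sign_mul, sign_pow, costSign_eq]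
  simp

theorem sign_ratio (hB : B.card = n) (hP : basisMinor (extendRows A u v) B ≠ 0)
    {y z : Fin m ⊕ Fin n → F} (hy : IsReducedCost A u B y) (hz : IsReducedCost A v B z)
    {k l : Fin m ⊕ Fin n} (hk : k ∈ B) (hl : l ∈ B) :
    SignType.sign (y k * z l - y l * z k) = costSign B k * costSign B l *
      SignType.sign (costMinor (extendRows A u v) B 0 k * costMinor (extendRows A u v) B 1 l
        - costMinor (extendRows A u v) B 0 l * costMinor (extendRows A u v) B 1 k) := by
  have hyk := basisMinor_mul_reducedCost (v := v) hB 0 hy hk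
  have hyl := basisMinor_mul_reducedCost (v := v) hB 0 hy hl
  have hzk := basisMinor_mul_reducedCost (u := u) hB 1 hz hk
  have hzl := basisMinor_mul_reducedCost (u := u) hB 1 hz hl
  set P := basisMinor (extendRows A u v) B
  have h1 : (P * P) * (y k * z l - y l * z k) = (-1) ^ costExp B k * (-1) ^ costExp B l *
      (costMinor (extendRows A u v) B 0 k * costMinor (extendRows A u v) B 1 l
        - costMinor (extendRows A u v) B 0 l * costMinor (extendRows A u v) B 1 k) := by
    linear_combination (P * z l) * hyk - (P * z k) * hyl
      - ((-1) ^ costExp B l * costMinor (extendRows A u v) B 0 l) * hzk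
      + ((-1) ^ costExp B k * costMinor (extendRows A u v) B 0 k) * hzl
  have h2 := congrArg SignType.sign h1
  rw [sign_mul, sign_pos (mul_self_pos.2 hP), one_mul, sign_mul, sign_mul, sign_pow, sign_pow] at h2
  rw [h2, costSign_eq, costSign_eq]
  simp

end OrderedField

variable {m n : ℕ} {A : Matrix (Fin m) (Fin n) SignedTrop} {ε : ℝ}
  {A' : Matrix (Fin m) (Fin n) PuiseuxSeries} {ε' : PuiseuxSeries} {k : Fin m}
  {B : Finset (Fin m ⊕ Fin n)}

theorem sval_extendRows (hAA : ∀ i j, sval (A' i j) = A i j) (hε' : sval ε' = SignedTrop.pos ε)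
    (k : Fin m) (e : Fin (m + 2) × Fin n) :
    sval (extendRows A' (objective n ε') (A' k) e.1 e.2)
      = stack A (tropObjective n ε) (A k) e := by
  obtain ⟨a, j⟩ := e
  refine Fin.addCases (fun i => ?_) (fun r => ?_) a
  · change sval (extendRows _ _ _ (Fin.castAdd 2 i) j) = _
    rw [extendRows_castAdd, stack_castAdd, hAA]
  · change sval (extendRows _ _ _ (Fin.natAdd m r) j) = _
    rw [extendRows_natAdd]
    fin_cases r
    · refine Eq.trans ?_ (stack_natAdd_zero _ _ _ _).symm
      change sval (ε' ^ (j.val + 1)) = SignedTrop.pos ε ^ (j.val + 1)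
      rw [← hε']
      exact map_pow svalHom ε' _
    · exact (hAA k j).trans (stack_natAdd_one _ _ _ _).symm

theorem basisPoly_eq (B : Finset (Fin m ⊕ Fin n)) :
    basisPoly B = basisMinor (variableMatrix (m + 2) n) B := rfl

theorem costPoly_eq (B : Finset (Fin m ⊕ Fin n)) (r : Fin 2) (l : Fin m ⊕ Fin n) :
    costPoly B r l = costMinor (variableMatrix (m + 2) n) B r l := by
  cases l <;> rfl

theorem eval_basisPoly (M : Matrix (Fin (m + 2)) (Fin n) PuiseuxSeries)
    (B : Finset (Fin m ⊕ Fin n)) :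
    MvPolynomial.eval (fun e => M e.1 e.2) (basisPoly B) = basisMinor M B :=
  eval_minor_variableMatrix M _ _

theorem eval_costPoly (M : Matrix (Fin (m + 2)) (Fin n) PuiseuxSeries)
    (B : Finset (Fin m ⊕ Fin n)) (r : Fin 2) (l : Fin m ⊕ Fin n) :
    MvPolynomial.eval (fun e => M e.1 e.2) (costPoly B r l) = costMinor M B r l := by
  cases l <;> exact eval_minor_variableMatrix M _ _

theorem eval_ratioPoly (M : Matrix (Fin (m + 2)) (Fin n) PuiseuxSeries)
    (B : Finset (Fin m ⊕ Fin n)) (k l : Fin m ⊕ Fin n) :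
    MvPolynomial.eval (fun e => M e.1 e.2) (ratioPoly B k l)
      = costMinor M B 0 k * costMinor M B 1 l - costMinor M B 0 l * costMinor M B 1 k := by
  rw [ratioPoly, map_sub, map_mul, map_mul, eval_costPoly, eval_costPoly, eval_costPoly,
    eval_costPoly]

theorem exists_isDominant_basisPoly (hA : StronglyNondegenerate A)
    (hε : ∀ i j i' j', (ε : WithBot ℝ) + n • (A i' j').modulus < n • (A i j).modulus)
    (k : Fin m) (hB : B.card = n) :
    ∃ α, IsDominant (basisPoly B) (stack A (tropObjective n ε) (A k)) α :=
  exists_isDominant_stack hA hε k ((liftRows_card _).trans (card_toRight_compl hB).symm)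
    (Or.inr (natAdd_notMem_liftRows _ _))

theorem exists_isDominant_costPoly (hA : StronglyNondegenerate A)
    (hε : ∀ i j i' j', (ε : WithBot ℝ) + n • (A i' j').modulus < n • (A i j).modulus)
    (k : Fin m) (hB : B.card = n) (r : Fin 2)
    (hr : r = 0 ∨ Sum.inl k ∉ B) {l : Fin m ⊕ Fin n} (hl : l ∈ B) :
    ∃ α, IsDominant (costPoly B r l) (stack A (tropObjective n ε) (A k)) α := by
  have hkey : ∀ I : Finset (Fin m), I ⊆ B.toLeft →
      Fin.castAdd 2 k ∉ insert (Fin.natAdd m r) (liftRows I) ∨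
        Fin.natAdd m 1 ∉ insert (Fin.natAdd m r) (liftRows I) := by
    intro I hI
    rcases hr with rfl | hkB
    · refine Or.inr fun h => ?_
      rcases Finset.mem_insert.1 h with h | h
      · exact absurd (Fin.natAdd_injective _ _ h) (by decide)
      · exact natAdd_notMem_liftRows _ _ h
    · refine Or.inl fun h => ?_
      rcases Finset.mem_insert.1 h with h | h
      · have := congrArg Fin.val h
        simp at this
        omega
      · obtain ⟨i, hi, h⟩ := Finset.mem_map.1 h
        obtain rfl : i = k := Fin.castAdd_injective _ _ h
        exact hkB (Finset.mem_toLeft.1 (hI hi))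
  have hcard := card_toRight_compl hB
  rcases l with i | j
  · refine exists_isDominant_stack hA hε k ?_ (hkey _ (Finset.erase_subset _ _))
    have hi : i ∈ B.toLeft := Finset.mem_toLeft.2 hl
    rw [Finset.card_insert_of_notMem (natAdd_notMem_liftRows _ _), liftRows_card,
      Finset.card_erase_of_mem hi, hcard]
    exact Nat.sub_add_cancel (Finset.card_pos.2 ⟨i, hi⟩)
  · refine exists_isDominant_stack hA hε k ?_ (hkey _ subset_rfl)
    rw [Finset.card_insert_of_notMem (natAdd_notMem_liftRows _ _), liftRows_card,
      Finset.card_insert_of_notMem, hcard]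
    rw [Finset.mem_compl, not_not]
    exact Finset.mem_toRight.2 hl

theorem exists_isDominant_ratioPoly (hA : StronglyNondegenerate A)
    (hε : ∀ i j i' j', (ε : WithBot ℝ) + n • (A i' j').modulus < n • (A i j).modulus)
    (hB : B.card = n) (hkB : Sum.inl k ∉ B)
    {l l' : Fin m ⊕ Fin n} (hl : l ∈ B) (hl' : l' ∈ B) (hne : l ≠ l') :
    ∃ α, IsDominant (ratioPoly B l l') (stack A (tropObjective n ε) (A k)) α := by
  obtain ⟨α, hα⟩ := exists_isDominant_basisPoly hA hε k hB
  have hP : basisMinor (variableMatrix (m + 2) n) B ≠ 0 := by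
    rw [← basisPoly_eq]
    intro h0
    have h1 := hα.1
    rw [h0] at h1
    simp at h1
  obtain ⟨K, L, hKL, hK, hT⟩ := costMinor_sub_eq (variableMatrix (m + 2) n) hB hP hl hl' hne
  have hk : Fin.castAdd 2 k ∉ K := by
    intro h
    rcases hK _ h with ⟨i, hi, h⟩ | ⟨r, h⟩
    · obtain rfl : k = i := Fin.castAdd_injective _ _ h
      exact hkB hi
    · have := congrArg Fin.val h
      simp at this
      omega
  obtain ⟨β, hβ⟩ := exists_isDominant_stack hA hε k hKL (Or.inl hk)
  refine ⟨α + β, ?_⟩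
  rw [ratioPoly, costPoly_eq, costPoly_eq, costPoly_eq, costPoly_eq]
  rcases hT with hT | hT
  · rw [hT]; exact hα.mul hβ
  · rw [hT]; exact (hα.mul hβ).neg

theorem objective_pos_of_sval (hε' : sval ε' = SignedTrop.pos ε) (j : Fin n) :
    0 < objective n ε' j := by
  have h1 := sval_sgn ε'
  rw [hε'] at h1
  exact pow_pos (sign_eq_one_iff.1 h1.symm) _

theorem classicalNondegenerate_of_sval {b : Fin m → SignedTrop} {b' : Fin m → PuiseuxSeries}
    (hAb : StronglyNondegenerate (augment A b))
    (hε : ∀ i j i' j', (ε : WithBot ℝ) + n • (A i' j').modulus < n • (A i j).modulus)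
    (hAA : ∀ i j, sval (A' i j) = A i j) (hbb : ∀ i, sval (b' i) = b i)
    (hε' : sval ε' = SignedTrop.pos ε) : ClassicalNondegenerate A' b' (objective n ε') where
  rowBasis _ hB := hAb.fst.isRowBasis hAA hB
  simple _ hB _ hx _ hl := hAb.slack_ne_zero hAA hbb hB hx hl
  objective_pos := objective_pos_of_sval hε'
  cost_ne k B hB y hy l hl h0 := by
    obtain ⟨α, hα⟩ := exists_isDominant_costPoly hAb.fst hε k hB 0 (Or.inl rfl) hl
    have h1 := hα.eval_ne_zero (sval_extendRows hAA hε' k)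
    rw [eval_costPoly] at h1
    have h2 := basisMinor_mul_reducedCost (v := A' k) hB 0 hy hl
    rw [h0, mul_zero] at h2
    exact mul_ne_zero (pow_ne_zero _ (neg_ne_zero.2 one_ne_zero)) h1 h2.symm
  ratio_ne k B hB hBk y z hy hz l hl l' hl' hne h0 := by
    have hkB : (Sum.inl k : Fin m ⊕ Fin n) ∉ B := fun h => not_among_self k (hBk _ h)
    obtain ⟨α, hα⟩ := exists_isDominant_ratioPoly hAb.fst hε hB hkB hl hl' hne
    have h1 := hα.eval_ne_zero (sval_extendRows hAA hε' k)
    rw [eval_ratioPoly] at h1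
    obtain ⟨β, hβ⟩ := exists_isDominant_basisPoly hAb.fst hε k hB
    have h2 := hβ.eval_ne_zero (sval_extendRows hAA hε' k)
    rw [eval_basisPoly] at h2
    have h3 := sign_ratio hB h2 hy hz hl hl'
    rw [h0, sub_self, sign_zero, costSign_eq, costSign_eq] at h3
    refine mul_ne_zero (mul_ne_zero (pow_ne_zero _ (by decide)) (pow_ne_zero _ (by decide)))
      (sign_ne_zero.2 h1) h3.symm

/-- The signs of the minors, and hence those of the reduced costs and of the differences of ratios,
are those of their tropical counterparts. -/
theorem tropShadowVertexRule_iff (hA : StronglyNondegenerate A)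
    (hε : ∀ i j i' j', (ε : WithBot ℝ) + n • (A i' j').modulus < n • (A i j).modulus)
    (hAA : ∀ i j, sval (A' i j) = A i j) (hε' : sval ε' = SignedTrop.pos ε)
    (hB : B.card = n) (hBk : ∀ l ∈ B, PCBCData.Among k l) (out : Option (Fin m ⊕ Fin n)) :
    tropShadowVertexRule A (tropObjective n ε) (A k) B out ↔
      shadowVertexRule A' (objective n ε') (A' k) B out := by
  have hkB : (Sum.inl k : Fin m ⊕ Fin n) ∉ B := fun h => not_among_self k (hBk _ h)
  have hbas := hA.isRowBasis hAA hB
  obtain ⟨y, hy⟩ := hbas.exists_isReducedCost (objective n ε')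
  obtain ⟨z, hz⟩ := hbas.exists_isReducedCost (A' k)
  have hx := sval_extendRows hAA hε' k
  obtain ⟨β, hβ⟩ := exists_isDominant_basisPoly hA hε k hB
  have hP := hβ.eval_ne_zero hx
  have hPs := hβ.sign_eval hx
  rw [eval_basisPoly] at hP hPs
  have hsign : ∀ s p c y : SignType, s ≠ 0 → p ≠ 0 → p * y = s * c → (c = s * p ↔ y = 1) := by
    decide
  have hs0 : ∀ l, costSign B l ≠ 0 := fun l => by
    rw [costSign_eq]; exact pow_ne_zero _ (by decide)
  have hcost : ∀ (r : Fin 2) (w : Fin m ⊕ Fin n → PuiseuxSeries),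
      IsReducedCost A' (![objective n ε', A' k] r) B w → ∀ l ∈ B,
      ((tropEval (costPoly B r l) (stack A (tropObjective n ε) (A k))).sgn =
        costSign B l * (tropEval (basisPoly B) (stack A (tropObjective n ε) (A k))).sgn
        ↔ 0 < w l) := by
    intro r w hw l hl
    obtain ⟨α, hα⟩ := exists_isDominant_costPoly hA hε k hB r (Or.inr hkB) hl
    have h1 := hα.sign_eval hx
    rw [eval_costPoly] at h1
    rw [← h1, ← hPs, ← sign_eq_one_iff]
    exact hsign _ _ _ _ (hs0 l) (sign_ne_zero.2 hP) (sign_reducedCost hB r hw hl)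
  have hcand : ∀ l, l ∈ tropCandidates A (tropObjective n ε) (A k) B ↔
      l ∈ B ∧ 0 < y l ∧ 0 < z l := by
    intro l
    refine and_congr_right fun hl => ?_
    rw [Fin.forall_fin_two]
    exact and_congr (hcost 0 y hy l hl) (hcost 1 z hz l hl)
  have hrule : shadowVertexRule A' (objective n ε') (A' k) B out ↔
      match out with
      | none => ∀ l ∈ B, ¬ (0 < y l ∧ 0 < z l)
      | some q => (q ∈ B ∧ 0 < y q ∧ 0 < z q) ∧
          ∀ l ∈ B, 0 < y l → 0 < z l → y q / z q ≤ y l / z l := by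
    constructor
    · rintro ⟨y', z', hy', hz', h⟩
      obtain rfl := hbas.reducedCost_unique hy hy'
      obtain rfl := hbas.reducedCost_unique hz hz'
      exact h
    · exact fun h => ⟨y, z, hy, hz, h⟩
  rw [hrule]
  rcases out with - | q
  · refine forall_congr' fun l => ?_
    rw [hcand, not_and]
  · change q ∈ tropCandidates _ _ _ _ ∧ _ ↔ _
    rw [hcand q]
    refine and_congr_right fun ⟨hq, hyq, hzq⟩ => ?_
    have hratio : ∀ l ∈ B, l ≠ q → 0 < z l →
        ((tropEval (ratioPoly B q l) (stack A (tropObjective n ε) (A k))).sgn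
          = -(costSign B q * costSign B l) ↔ y q / z q ≤ y l / z l) := by
      intro l hl hne hzl
      obtain ⟨α, hα⟩ := exists_isDominant_ratioPoly hA hε hB hkB hq hl hne.symm
      have h1 := hα.eval_ne_zero hx
      have h2 := hα.sign_eval hx
      rw [eval_ratioPoly] at h1 h2
      have h3 := sign_ratio hB hP hy hz hq hl
      have h4 : ∀ s t T : SignType, s ≠ 0 → t ≠ 0 → T ≠ 0 →
          (T = -(s * t) ↔ s * t * T = -1) ∧ s * t * T ≠ 0 := by decide
      obtain ⟨h5, h6⟩ := h4 _ _ _ (hs0 q) (hs0 l) (sign_ne_zero.2 h1)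
      rw [← h2, h5, ← h3, sign_eq_neg_one_iff, sub_neg, div_le_div_iff₀ hzq hzl]
      rw [← h3, sign_ne_zero, sub_ne_zero] at h6
      exact ⟨le_of_lt, fun h => lt_of_le_of_ne h h6⟩
    constructor
    · intro h l hl hyl hzl
      rcases eq_or_ne l q with rfl | hne
      · exact le_rfl
      · exact (hratio l hl hne hzl).1 (h l ((hcand l).2 ⟨hl, hyl, hzl⟩) hne)
    · intro h l hl hne
      obtain ⟨hl, hyl, hzl⟩ := (hcand l).1 hl
      exact (hratio l hl hne hzl).2 (h l hl hyl hzl)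

end Rules

/-! ### Constraints under the valuation map -/

section Constraints

variable {m n : ℕ}

theorem val_max_zero (a : PuiseuxSeries) : val (max a 0) = (sval a).posPart := by
  have h := sval_sgn a
  rcases lt_trichotomy a 0 with ha | rfl | ha
  · rw [max_eq_right ha.le, val_zero]
    rw [sign_neg ha] at h
    cases hs : sval a <;> simp_all [SignedTrop.sgn, SignedTrop.posPart]
  · simp [val_zero, sval, SignedTrop.posPart]
  · rw [max_eq_left ha.le, val]
    rw [sign_pos ha] at h
    cases hs : sval a <;> simp_all [SignedTrop.sgn, SignedTrop.posPart, SignedTrop.modulus]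

theorem val_max_neg_zero (a : PuiseuxSeries) : val (max (-a) 0) = (sval a).negPart := by
  have h := sval_sgn a
  rcases lt_trichotomy a 0 with ha | rfl | ha
  · rw [max_eq_left (neg_pos.2 ha).le, val_neg, val]
    rw [sign_neg ha] at h
    cases hs : sval a <;> simp_all [SignedTrop.sgn, SignedTrop.negPart, SignedTrop.modulus]
  · simp [val_zero, sval, SignedTrop.negPart]
  · rw [max_eq_right (neg_neg_of_pos ha).le, val_zero]
    rw [sign_pos ha] at h
    cases hs : sval a <;> simp_all [SignedTrop.sgn, SignedTrop.negPart]

/-- The coordinatewise valuation. -/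
noncomputable def valVec (x : Fin n → PuiseuxSeries) : Fin n → WithBot ℝ := fun j => val (x j)

variable {A : Matrix (Fin m) (Fin n) SignedTrop} {b : Fin m → SignedTrop} {ε : ℝ}
  {A' : Matrix (Fin m) (Fin n) PuiseuxSeries} {b' : Fin m → PuiseuxSeries} {ε' : PuiseuxSeries}

/-- At a nonnegative point, an affine form is the difference of two sums of nonnegative terms, whose
valuations are the two sides of the tropical inequality. -/
theorem exists_slack_eq_sub (hA : ∀ i j, sval (A' i j) = A i j) (hb : ∀ i, sval (b' i) = b i)
    {x : Fin n → PuiseuxSeries} (hx : ∀ j, 0 ≤ x j) (i : Fin m) :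
    ∃ p q : PuiseuxSeries, 0 ≤ p ∧ 0 ≤ q ∧ slack A' b' (Sum.inl i) x = p - q ∧
      val p = tropLHS A b i (valVec x) ∧ val q = tropRHS A b i (valVec x) := by
  have hp : ∀ j, 0 ≤ max (A' i j) 0 * x j := fun j => mul_nonneg (le_max_right _ _) (hx j)
  have hq : ∀ j, 0 ≤ max (-A' i j) 0 * x j := fun j => mul_nonneg (le_max_right _ _) (hx j)
  refine ⟨∑ j, max (A' i j) 0 * x j + max (b' i) 0, ∑ j, max (-A' i j) 0 * x j + max (-b' i) 0,
    add_nonneg (Finset.sum_nonneg fun j _ => hp j) (le_max_right _ _),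
    add_nonneg (Finset.sum_nonneg fun j _ => hq j) (le_max_right _ _), ?_, ?_, ?_⟩
  · have h1 : ∀ a : PuiseuxSeries, a = max a 0 - max (-a) 0 := fun a =>
      (max_zero_sub_max_neg_zero_eq_self a).symm
    rw [slack_inl, add_sub_add_comm, ← h1 (b' i), ← Finset.sum_sub_distrib]
    congr 1
    refine Finset.sum_congr rfl fun j _ => ?_
    rw [← sub_mul, ← h1]
  · rw [val_add_of_nonneg (Finset.sum_nonneg fun j _ => hp j) (le_max_right _ _),
      val_sum_of_nonneg _ _ fun j _ => hp j, val_max_zero, hb, tropLHS]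
    congr 2
    ext1 j
    rw [val_mul, val_max_zero, hA, valVec]
  · rw [val_add_of_nonneg (Finset.sum_nonneg fun j _ => hq j) (le_max_right _ _),
      val_sum_of_nonneg _ _ fun j _ => hq j, val_max_neg_zero, hb, tropRHS]
    congr 2
    ext1 j
    rw [val_mul, val_max_neg_zero, hA, valVec]

theorem sat_valVec (hA : ∀ i j, sval (A' i j) = A i j) (hb : ∀ i, sval (b' i) = b i)
    {x : Fin n → PuiseuxSeries} (hx : ∀ j, 0 ≤ x j) {l : Fin m ⊕ Fin n}
    (h : (classicalPCBC A' b' ε').sat l x) : (tropPCBC A b ε).sat l (valVec x) := by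
  rcases l with i | j
  · obtain ⟨p, q, -, hq, hpq, hp', hq'⟩ := exists_slack_eq_sub hA hb hx i
    rw [sat_iff, hpq, sub_nonneg] at h
    change tropRHS A b i (valVec x) ≤ tropLHS A b i (valVec x)
    rw [← hp', ← hq']
    exact val_mono hq h
  · exact (bot_le : ⊥ ≤ valVec x j)

theorem active_valVec (hA : ∀ i j, sval (A' i j) = A i j) (hb : ∀ i, sval (b' i) = b i)
    {x : Fin n → PuiseuxSeries} (hx : ∀ j, 0 ≤ x j) {l : Fin m ⊕ Fin n}
    (h : (classicalPCBC A' b' ε').active l x) : (tropPCBC A b ε).active l (valVec x) := by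
  rcases l with i | j
  · obtain ⟨p, q, -, -, hpq, hp', hq'⟩ := exists_slack_eq_sub hA hb hx i
    rw [active_iff, hpq, sub_eq_zero] at h
    change tropLHS A b i (valVec x) = tropRHS A b i (valVec x)
    rw [← hp', ← hq', h]
  · exact val_eq_bot.2 h

/-- Every tropical point has a lift satisfying (resp. activating) all the constraints that the point
satisfies (resp. activates): the strict tropical inequalities hold at any nonnegative lift. -/
theorem exists_lift_sat (hAb : StronglyNondegenerate (augment A b))
    (hA : ∀ i j, sval (A' i j) = A i j) (hb : ∀ i, sval (b' i) = b i) (x : Fin n → WithBot ℝ) :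
    ∃ x', valVec x' = x ∧
      (∀ l, (tropPCBC A b ε).sat l x → (classicalPCBC A' b' ε').sat l x') ∧
      ∀ l, (tropPCBC A b ε).active l x → (classicalPCBC A' b' ε').active l x' := by
  obtain ⟨x', hx', hval, hact⟩ := exists_lift hAb hA hb x
  obtain rfl : valVec x' = x := funext hval
  refine ⟨x', rfl, fun l hl => ?_, fun l hl => ?_⟩
  · rcases l with i | j
    · obtain ⟨p, q, hp, -, hpq, hp', hq'⟩ := exists_slack_eq_sub hA hb hx' i
      change tropRHS A b i (valVec x') ≤ tropLHS A b i (valVec x') at hl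
      rcases hl.lt_or_eq with h | h
      · rw [sat_iff, hpq, sub_nonneg]
        rw [← hp', ← hq'] at h
        by_contra! hlt
        exact absurd (val_mono hp hlt.le) (not_le.2 h)
      · exact (hact i h.symm).ge
    · exact hx' j
  · rcases l with i | j
    · exact hact i hl
    · exact val_eq_bot.1 hl

theorem nonneg_of_mem_polyhedron {k : ℕ} {x : Fin n → PuiseuxSeries}
    (h : x ∈ (classicalPCBC A' b' ε').polyhedron k) (j : Fin n) : 0 ≤ x j :=
  h (Sum.inr j) trivial

theorem valVec_mem_face (hA : ∀ i j, sval (A' i j) = A i j) (hb : ∀ i, sval (b' i) = b i)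
    {k : ℕ} {B : Finset (Fin m ⊕ Fin n)} {x : Fin n → PuiseuxSeries}
    (h : x ∈ (classicalPCBC A' b' ε').face k B) : valVec x ∈ (tropPCBC A b ε).face k B :=
  ⟨fun l hl => sat_valVec hA hb (nonneg_of_mem_polyhedron h.1) (h.1 l hl),
    fun l hl => active_valVec hA hb (nonneg_of_mem_polyhedron h.1) (h.2 l hl)⟩

theorem exists_mem_face_valVec_eq (hAb : StronglyNondegenerate (augment A b))
    (hA : ∀ i j, sval (A' i j) = A i j) (hb : ∀ i, sval (b' i) = b i)
    {k : ℕ} {B : Finset (Fin m ⊕ Fin n)} {x : Fin n → WithBot ℝ}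
    (h : x ∈ (tropPCBC A b ε).face k B) :
    ∃ x' ∈ (classicalPCBC A' b' ε').face k B, valVec x' = x ∧
      ∀ l, (tropPCBC A b ε).active l x → (classicalPCBC A' b' ε').active l x' := by
  obtain ⟨x', hx', hsat, hact⟩ := exists_lift_sat (ε := ε) (ε' := ε') hAb hA hb x
  exact ⟨x', ⟨fun l hl => hsat l (h.1 l hl), fun l hl => hact l (h.2 l hl)⟩, hx', hact⟩

/-- A basic point satisfies the constraints which its valuation satisfies, since it is the only
lift of its valuation that activates the basis. -/
theorem sat_valVec_iff (hAb : StronglyNondegenerate (augment A b))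
    (hA : ∀ i j, sval (A' i j) = A i j) (hb : ∀ i, sval (b' i) = b i)
    {B : Finset (Fin m ⊕ Fin n)} (hB : B.card = n) {k : ℕ} {x : Fin n → PuiseuxSeries}
    (hx : x ∈ (classicalPCBC A' b' ε').face k B) (l : Fin m ⊕ Fin n) :
    (tropPCBC A b ε).sat l (valVec x) ↔ (classicalPCBC A' b' ε').sat l x := by
  have hx0 := nonneg_of_mem_polyhedron hx.1
  refine ⟨fun h => ?_, sat_valVec hA hb hx0⟩
  obtain ⟨x', -, hsat, hact⟩ := exists_lift_sat (ε := ε) (ε' := ε') hAb hA hb (valVec x)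
  have h1 : x' = x := rowBasis_point_unique (b := b') (hAb.fst.isRowBasis hA hB)
    (fun l hl => active_iff.1 (hact l (active_valVec hA hb hx0 (hx.2 l hl))))
    (fun l hl => active_iff.1 (hx.2 l hl))
  exact h1 ▸ hsat l h

theorem polyhedron_eq_empty_iff (hAb : StronglyNondegenerate (augment A b))
    (hA : ∀ i j, sval (A' i j) = A i j) (hb : ∀ i, sval (b' i) = b i) :
    (classicalPCBC A' b' ε').polyhedron m = ∅ ↔ tropPolyhedron A b = ∅ := by
  rw [← not_iff_not, ← Ne, ← Ne, ← Set.nonempty_iff_ne_empty, ← Set.nonempty_iff_ne_empty]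
  constructor
  · rintro ⟨x, hx⟩
    exact ⟨valVec x, fun i =>
      sat_valVec (ε := 0) hA hb (nonneg_of_mem_polyhedron hx) (hx (Sum.inl i) i.2)⟩
  · rintro ⟨x, hx⟩
    obtain ⟨x', -, hsat, -⟩ := exists_lift_sat (ε := 0) (ε' := ε') hAb hA hb x
    refine ⟨x', fun l _ => hsat l ?_⟩
    rcases l with i | j
    · exact hx i
    · exact (bot_le : ⊥ ≤ x j)

end Constraints

/-! ### Executions -/

section Execution

variable {m n : ℕ} {X Y : Type}

/-- The image of a state under a map of the points. -/
def Config.map (f : X → Y) : Config m n X → Config m n Y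
  | .loop k B x N => .loop k B (f x) N
  | .simplex k B x N => .simplex k B (f x) N
  | .halt ans N => .halt ans N

theorem exists_terminal_of_acc {α : Type*} {r : α → α → Prop} {a : α}
    (h : Acc (fun c d => r d c) a) : ∃ c, Relation.ReflTransGen r a c ∧ ∀ d, ¬ r c d := by
  induction h with
  | intro a _ ih =>
    by_cases hterm : ∃ d, r a d
    · obtain ⟨d, hd⟩ := hterm
      obtain ⟨c, hc, hc'⟩ := ih d hd
      exact ⟨c, hc.head hd, hc'⟩
    · exact ⟨a, .refl, not_exists.1 hterm⟩

theorem PCBCData.Outputs.unique {S : PCBCData m n X} {ans ans' : Answer} {N N' : ℕ}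
    (h : S.Outputs ans N) (h' : S.Outputs ans' N') : ans = ans' ∧ N = N' := by
  obtain ⟨c, hc, hterm⟩ := exists_terminal_of_acc h.1
  have h1 := (h.2 c hc hterm).symm.trans (h'.2 c hc hterm)
  cases h1
  exact ⟨rfl, rfl⟩

/-- A bisimulation transports the outcome of the executions. -/
theorem PCBCData.Outputs.of_bisimulation {S : PCBCData m n X} {T : PCBCData m n Y} (f : X → Y)
    (hstart : T.start = S.start.map f) (P : Config m n X → Prop) (hP : P S.start)
    (hPS : ∀ c c', P c → S.Step c c' → P c')
    (hST : ∀ c c', P c → S.Step c c' → T.Step (c.map f) (c'.map f))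
    (hTS : ∀ c d, P c → T.Step (c.map f) d → ∃ c', S.Step c c' ∧ d = c'.map f)
    {ans : Answer} {N : ℕ} (h : S.Outputs ans N) : T.Outputs ans N := by
  constructor
  · have key : ∀ c, Acc (fun c d => S.Step d c) c → P c → Acc (fun c d => T.Step d c) (c.map f) := by
      intro c hc
      induction hc with
      | intro c _ ih =>
        refine fun hPc => Acc.intro _ fun d hd => ?_
        obtain ⟨c', hc', rfl⟩ := hTS c d hPc hd
        exact ih c' hc' (hPS c c' hPc hc')
    rw [hstart]
    exact key _ h.1 hP
  · intro d hd hterm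
    have key : ∃ c, Relation.ReflTransGen S.Step S.start c ∧ P c ∧ d = c.map f := by
      clear hterm
      induction hd with
      | refl => exact ⟨_, .refl, hP, hstart⟩
      | tail _ hstep ih =>
        obtain ⟨c, hc, hPc, rfl⟩ := ih
        obtain ⟨c', hc', rfl⟩ := hTS c _ hPc hstep
        exact ⟨c', hc.tail hc', hPS c c' hPc hc', rfl⟩
    obtain ⟨c, hc, hPc, rfl⟩ := key
    rw [h.2 c hc fun c' hc' => hterm _ (hST c c' hPc hc')]
    rfl

theorem terminal_unique {α : Type*} {r : α → α → Prop} {P : α → Prop}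
    (hPr : ∀ a a', P a → r a a' → P a') (hr : ∀ a a₁ a₂, P a → r a a₁ → r a a₂ → a₁ = a₂)
    {a c d : α} (ha : P a) (hc : Relation.ReflTransGen r a c) (hc' : ∀ e, ¬ r c e)
    (hd : Relation.ReflTransGen r a d) (hd' : ∀ e, ¬ r d e) : c = d := by
  induction hc using Relation.ReflTransGen.head_induction_on with
  | refl =>
    rcases hd.cases_head with h | ⟨e, he, -⟩
    · exact h
    · exact absurd he (hc' e)
  | head h _ ih =>
    rcases hd.cases_head with rfl | ⟨e, he, hed⟩
    · exact absurd h (hd' _)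
    · obtain rfl := hr _ _ _ ha h he
      exact ih (hPr _ _ ha h) hed

theorem exists_outputs_classicalPCBC {F : Type} [Field F] [LinearOrder F] [IsStrictOrderedRing F]
    {A : Matrix (Fin m) (Fin n) F} {b : Fin m → F} {ε : F}
    (hnd : ClassicalNondegenerate A b (objective n ε)) :
    ∃ ans N, (classicalPCBC A b ε).Outputs ans N ∧
      (ans = Answer.empty ↔ (classicalPCBC A b ε).polyhedron m = ∅) := by
  have hinv := invariant_start hnd
  have hacc := hinv.acc hnd
  obtain ⟨c, hc, hterm⟩ := exists_terminal_of_acc hacc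
  have hc' : Invariant A b ε c := by
    clear hterm
    induction hc with
    | refl => exact hinv
    | tail _ hstep ih => exact ih.step hnd hstep
  obtain ⟨ans, N, rfl⟩ := hc'.exists_halt hnd hterm
  refine ⟨ans, N, ⟨hacc, fun d hd hd' => ?_⟩, hc'⟩
  exact (terminal_unique (fun _ _ h hs => h.step hnd hs) (fun _ _ _ h => h.step_unique hnd) hinv hc
    hterm hd hd').symm

end Execution

/-! ### The tropical execution is the valuation of the classical one -/

section Bisimulation

variable {m n : ℕ} {A : Matrix (Fin m) (Fin n) SignedTrop} {b : Fin m → SignedTrop} {ε : ℝ}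
  {A' : Matrix (Fin m) (Fin n) PuiseuxSeries} {b' : Fin m → PuiseuxSeries} {ε' : PuiseuxSeries}

theorem rule_iff (hAb : StronglyNondegenerate (augment A b))
    (hε : ∀ i j i' j', (ε : WithBot ℝ) + n • (A i' j').modulus < n • (A i j).modulus)
    (hA : ∀ i j, sval (A' i j) = A i j) (hε' : sval ε' = SignedTrop.pos ε) {k : Fin m}
    {B : Finset (Fin m ⊕ Fin n)} {x : Fin n → PuiseuxSeries} {N : ℕ}
    (h : Invariant A' b' ε' (.simplex k B x N)) (out : Option (Fin m ⊕ Fin n)) :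
    (tropPCBC A b ε).rule k B out ↔ (classicalPCBC A' b' ε').rule k B out :=
  tropShadowVertexRule_iff hAb.fst hε hA hε' h.1 h.2.1 out

theorem step_map_valVec (hAb : StronglyNondegenerate (augment A b))
    (hε : ∀ i j i' j', (ε : WithBot ℝ) + n • (A i' j').modulus < n • (A i j).modulus)
    (hA : ∀ i j, sval (A' i j) = A i j) (hb : ∀ i, sval (b' i) = b i)
    (hε' : sval ε' = SignedTrop.pos ε) {c c' : Config m n (Fin n → PuiseuxSeries)}
    (h : Invariant A' b' ε' c) (hs : (classicalPCBC A' b' ε').Step c c') :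
    (tropPCBC A b ε).Step (c.map valVec) (c'.map valVec) := by
  cases hs with
  | finish k hk B x N => exact .finish k hk B _ N
  | keep k hk B x N hsat =>
    exact .keep k hk B _ N ((sat_valVec_iff hAb hA hb h.2.1 h.2.2.2.1 _).2 hsat)
  | enter k hk B x N hsat =>
    exact .enter k hk B _ N fun hsat' =>
      hsat ((sat_valVec_iff hAb hA hb h.2.1 h.2.2.2.1 _).1 hsat')
  | infeasible k B x N hrule =>
    exact .infeasible k B _ N ((rule_iff hAb hε hA hε' h _).2 hrule)
  | hit k B x N q hrule y hy hact =>
    exact .hit k B _ N q ((rule_iff hAb hε hA hε' h _).2 hrule) _ (valVec_mem_face hA hb hy)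
      (active_valVec hA hb (nonneg_of_mem_polyhedron hy.1) hact)
  | pivot k B x N q hrule hno p hpk hpB y hy =>
    refine .pivot k B _ N q ((rule_iff hAb hε hA hε' h _).2 hrule) ?_ p hpk hpB _
      (valVec_mem_face hA hb hy)
    rintro ⟨w, hw, hact⟩
    obtain ⟨w', hw', -, hact'⟩ := exists_mem_face_valVec_eq (ε' := ε') hAb hA hb hw
    exact hno ⟨w', hw', hact' _ hact⟩

theorem exists_step_of_step_map_valVec (hAb : StronglyNondegenerate (augment A b))
    (hε : ∀ i j i' j', (ε : WithBot ℝ) + n • (A i' j').modulus < n • (A i j).modulus)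
    (hA : ∀ i j, sval (A' i j) = A i j) (hb : ∀ i, sval (b' i) = b i)
    (hε' : sval ε' = SignedTrop.pos ε) {c : Config m n (Fin n → PuiseuxSeries)}
    {d : Config m n (Fin n → WithBot ℝ)} (h : Invariant A' b' ε' c)
    (hs : (tropPCBC A b ε).Step (c.map valVec) d) :
    ∃ c', (classicalPCBC A' b' ε').Step c c' ∧ d = c'.map valVec := by
  cases c with
  | halt ans N => cases hs
  | loop k B x N =>
    cases hs with
    | finish _ hk => exact ⟨_, .finish k hk B x N, rfl⟩
    | keep _ hk _ _ _ hsat =>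
      exact ⟨_, .keep k hk B x N ((sat_valVec_iff hAb hA hb h.2.1 h.2.2.2.1 _).1 hsat), rfl⟩
    | enter _ hk _ _ _ hsat =>
      exact ⟨_, .enter k hk B x N fun hsat' =>
        hsat ((sat_valVec_iff hAb hA hb h.2.1 h.2.2.2.1 _).2 hsat'), rfl⟩
  | simplex k B x N =>
    cases hs with
    | infeasible _ _ _ _ hrule =>
      exact ⟨_, .infeasible k B x N ((rule_iff hAb hε hA hε' h _).1 hrule), rfl⟩
    | hit _ _ _ _ q hrule y hy hact =>
      obtain ⟨y', hy', rfl, hact'⟩ := exists_mem_face_valVec_eq (ε' := ε') hAb hA hb hy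
      exact ⟨_, .hit k B x N q ((rule_iff hAb hε hA hε' h _).1 hrule) y' hy' (hact' _ hact), rfl⟩
    | pivot _ _ _ _ q hrule hno p hpk hpB y hy =>
      obtain ⟨y', hy', rfl, -⟩ := exists_mem_face_valVec_eq (ε' := ε') hAb hA hb hy
      refine ⟨_, .pivot k B x N q ((rule_iff hAb hε hA hε' h _).1 hrule) ?_ p hpk hpB y' hy', rfl⟩
      rintro ⟨w, hw, hact⟩
      exact hno ⟨valVec w, valVec_mem_face hA hb hw,
        active_valVec hA hb (nonneg_of_mem_polyhedron hw.1) hact⟩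

theorem exists_outputs_of_sval (hAb : StronglyNondegenerate (augment A b))
    (hε : ∀ i j i' j', (ε : WithBot ℝ) + n • (A i' j').modulus < n • (A i j).modulus)
    (hA : ∀ i j, sval (A' i j) = A i j) (hb : ∀ i, sval (b' i) = b i)
    (hε' : sval ε' = SignedTrop.pos ε) :
    ∃ ans N, (classicalPCBC A' b' ε').Outputs ans N ∧ (tropPCBC A b ε).Outputs ans N ∧
      (ans = Answer.empty ↔ tropPolyhedron A b = ∅) := by
  have hnd := classicalNondegenerate_of_sval hAb hε hA hb hε'
  obtain ⟨ans, N, hout, hans⟩ := exists_outputs_classicalPCBC hnd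
  refine ⟨ans, N, hout, hout.of_bisimulation valVec ?_ (Invariant A' b' ε') (invariant_start hnd)
    (fun _ _ h hs => h.step hnd hs)
    (fun _ _ h hs => step_map_valVec hAb hε hA hb hε' h hs)
    (fun _ _ h hs => exists_step_of_step_map_valVec hAb hε hA hb hε' h hs),
    hans.trans (polyhedron_eq_empty_iff hAb hA hb)⟩
  have h0 : (fun _ => ⊥ : Fin n → WithBot ℝ) = valVec fun _ => 0 := funext fun _ => val_zero.symm
  change Config.loop 0 _ (fun _ => ⊥) 1 = Config.loop 0 _ (valVec fun _ => 0) 1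
  rw [h0]

end Bisimulation

theorem mainTheorem2 (m n : ℕ) (A : Matrix (Fin m) (Fin n) SignedTrop) (b : Fin m → SignedTrop)
    (ε : ℝ)
    (hAb : StronglyNondegenerate (Matrix.fromCols A (Matrix.replicateCol (Fin 1) b)))
    (hε : ∀ i j i' j', (ε : WithBot ℝ) + n • (A i' j').modulus < n • (A i j).modulus) :
    ∃ (ans : Answer) (N : ℕ),
      (tropPCBC A b ε).Outputs ans N ∧
      (ans = Answer.empty ↔ tropPolyhedron A b = ∅) ∧
      ∀ (A' : Matrix (Fin m) (Fin n) PuiseuxSeries) (b' : Fin m → PuiseuxSeries)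
        (ε' : PuiseuxSeries),
        (∀ i j, sval (A' i j) = A i j) → (∀ i, sval (b' i) = b i) →
        sval ε' = SignedTrop.pos ε →
        ∃ ans' : Answer, (classicalPCBC A' b' ε').Outputs ans' N := by
  choose A' hA using fun i j => exists_sval_eq (A i j)
  choose b' hb using fun i => exists_sval_eq (b i)
  obtain ⟨ε', hε'⟩ := exists_sval_eq (SignedTrop.pos ε)
  obtain ⟨ans, N, -, hout, hans⟩ := exists_outputs_of_sval hAb hε hA hb hε'
  refine ⟨ans, N, hout, hans, fun A'' b'' ε'' hA'' hb'' hε'' => ?_⟩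
  obtain ⟨ans', N', hout', hout'', -⟩ := exists_outputs_of_sval hAb hε hA'' hb'' hε''
  obtain ⟨-, rfl⟩ := hout.unique hout''
  exact ⟨ans', hout'⟩
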